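/- A finite state machine (FSM) is a tuple $Z=(Q,\Sigma,\delta,s)$ with finite sets $Q$ (states) and $\Sigma$ (symbols), a partial function $\delta:Q\times\Sigma\rightharpoonup Q$ and a start state $s\in Q$; an $x$-arc $u\to v$ means $\delta(u,x)=v$. The output function of $Z$ maps a word $x_1\cdots x_m\in\Sigma^*$ to $\delta(\cdots\delta(\delta(s,x_1),x_2)\cdots,x_m)$ where this is defined, and $Z$ is accessible if every state is a value of the output function. For $\emptyset\neq M\subseteq Q$, the restriction $Z[M]$ is the induced labelled graph on $M$, with start state $s$ if $s\in M$, and otherwise a node of $M$ that is the head of a maximal number of arcs with tail outside $M$. The contraction $Z/M$ is obtained by identifying $M$ to one node and deleting the arcs inside $M$ (it is an FSM only if at most one $x$-arc leaves the node $M$ for each $x$). The expansion $Z/M\cdot_M Z[M]$ replaces the node $M$ by $Z[M]$: arcs into $M$ (and the start state, if it is $M$) go to the start state of $Z[M]$, and a node of $Z[M]$ without an $x$-arc receives the $x$-arc of the node $M$, if there is one. $M$ is a module if $Z/M\cdot_M Z[M]$ is well defined and has the same output function as $Z$. A module $M$ is thin if for every $x\in\Sigma$ either no $x$-arc leaves $M$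 or $M$ contains no $x$-cycle (loops count as cycles). Two sets overlap if they intersect and neither contains the other; a collection of sets is overlapping if, for every partition of it into two nonempty parts, some set of one part overlaps some set of the other. A thin module is indecomposable if it is not the union of an overlapping collection of at least two thin modules. The decomposition tree of $Z$ is the digraph whose nodes are the indecomposable thin modules of $Z$ and whose arcs form the transitive reduction of the relation $K\supsetneq M$. Theorem. The decomposition tree of an accessible FSM with $n$ states and $k$ symbols can be constructed in $O(n^2k)$ time. Precisely: there are a single program for the unit-cost RAM with words of $O(\log(n+k))$ bits and a constant $C$ such that, for every accessible FSM with state set $\{0,\dots,n-1\}$ and alphabet $\{0,\dots,k-1\}$, given by its $n\times k$ transition table and start state, the program halts after at most $C(n^2k+1)$ steps and outputs the number $m$ of nodes of the decomposition tree and its list of arcs, for a numbering of the nodes by $0,\dots,m-1$ in which the sink $\{i\}$ has the number $i$ for each state $i<n$. -/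

import Mathlib

/-- A finite state machine with state set `Q`, alphabet `A`, partial transition function `δ`
(`none` means undefined) and start state. -/
structure FSM (Q A : Type*) where
  δ : Q → A → Option Q
  start : Q

namespace FSM

/-- The output function: run a word from the start state. -/
def output {Q A : Type*} (Z : FSM Q A) (w : List A) : Option Q :=
  w.foldl (fun o a => o.bind fun q => Z.δ q a) (some Z.start)

/-- Every state is reachable from the start state. -/
def Accessible {Q A : Type*} (Z : FSM Q A) : Prop :=
  ∀ q : Q, ∃ w : List A, Z.output w = some q

/-- `v` is an `x`-exit of `M`. -/
def IsExit {Q A : Type*} (Z : FSM Q A) (M : Set Q) (x : A) (v : Q) : Prop :=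
  v ∉ M ∧ ∃ u ∈ M, Z.δ u x = some v

/-- Number of (labelled) arcs with head `q` and tail outside `M`. -/
noncomputable def entryCount {Q A : Type*} (Z : FSM Q A) (M : Set Q) (q : Q) : ℕ :=
  Set.ncard {p : Q × A | p.1 ∉ M ∧ Z.δ p.1 p.2 = some q}

/-- `H` is a restriction `Z[M]`: the induced labelled graph on `M`, whose start state is the start
state of `Z` if that lies in `M`, and otherwise some node of `M` that is the head of a maximal
number of arcs coming from outside `M`. -/
structure IsRestriction {Q A : Type*} (Z : FSM Q A) (M : Set Q) (H : FSM {q // q ∈ M} A) :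
    Prop where
  arc : ∀ (u v : {q // q ∈ M}) (a : A), H.δ u a = some v ↔ Z.δ u.1 a = some v.1
  start_of_mem : ∀ h : Z.start ∈ M, H.start = ⟨Z.start, h⟩
  start_of_notMem : Z.start ∉ M →
    ∀ v : {q // q ∈ M}, Z.entryCount M v.1 ≤ Z.entryCount M H.start.1

open Classical in
/-- The block of `q` in the partition of `Q` into `M` (written `none`) and the singletons of the
states outside `M`. -/
noncomputable def blockOf {Q : Type*} (M : Set Q) (q : Q) : Option {q // q ∉ M} :=
  if h : q ∈ M then none else some ⟨q, h⟩

/-- `G` is the contraction `Z/M`. The arcs inside the contracted set `M` disappear; a `G` of this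
kind exists only if the quotient transition relation is a partial function. -/
structure IsContraction {Q A : Type*} (Z : FSM Q A) (M : Set Q)
    (G : FSM (Option {q // q ∉ M}) A) : Prop where
  arc : ∀ (p p' : Option {q // q ∉ M}) (a : A), G.δ p a = some p' ↔
    ∃ q r : Q, Z.δ q a = some r ∧ blockOf M q = p ∧ blockOf M r = p' ∧ ¬ (q ∈ M ∧ r ∈ M)
  start : G.start = blockOf M Z.start

open Classical in
/-- A state of `G` seen in the expansion of `H` at `v`: the node `v` is replaced by the start
state of `H`. -/
noncomputable def redirect {S T A : Type*} (v : S) (H : FSM T A) (p : S) : {p : S // p ≠ v} ⊕ T :=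
  if h : p = v then Sum.inr H.start else Sum.inl ⟨p, h⟩

/-- The expansion `G ·_v H`, which nests `H` in the state `v` of `G`. -/
noncomputable def expand {S T A : Type*} (G : FSM S A) (v : S) (H : FSM T A) :
    FSM ({p : S // p ≠ v} ⊕ T) A where
  δ := fun q a =>
    match q with
    | Sum.inl p => (G.δ p.1 a).map (redirect v H)
    | Sum.inr t =>
      match H.δ t a with
      | some t' => some (Sum.inr t')
      | none => (G.δ v a).map (redirect v H)
  start := redirect v H G.start

/-- The states of `Z/M ·_M Z[M]` are the states of `Z`. -/
def expandedState {Q : Type*} (M : Set Q) :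
    {p : Option {q // q ∉ M} // p ≠ none} ⊕ {q // q ∈ M} → Q
  | Sum.inl ⟨some q, _⟩ => q.1
  | Sum.inl ⟨none, h⟩ => absurd rfl h
  | Sum.inr q => q.1

/-- A nonempty `M` is a module if `Z/M ·_M Z[M]` is (well defined and) equivalent to `Z`,
that is, has the same output function. -/
def IsModule {Q A : Type*} (Z : FSM Q A) (M : Set Q) : Prop :=
  M.Nonempty ∧
    ∃ (G : FSM (Option {q // q ∉ M}) A) (H : FSM {q // q ∈ M} A),
      Z.IsContraction M G ∧ Z.IsRestriction M H ∧
        ∀ w : List A, ((G.expand none H).output w).map (expandedState M) = Z.output w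

/-- `M` contains an `x`-cycle (loops included). -/
def HasCycleIn {Q A : Type*} (Z : FSM Q A) (M : Set Q) (x : A) : Prop :=
  ∃ u, Relation.TransGen (fun p q => p ∈ M ∧ q ∈ M ∧ Z.δ p x = some q) u u

/-- Thin modules. -/
def IsThinModule {Q A : Type*} (Z : FSM Q A) (M : Set Q) : Prop :=
  Z.IsModule M ∧ ∀ x : A, (∀ v, ¬ Z.IsExit M x v) ∨ ¬ Z.HasCycleIn M x

end FSM

/-- Two sets overlap. -/
def Overlap {X : Type*} (S T : Set X) : Prop :=
  (S ∩ T).Nonempty ∧ ¬ S ⊆ T ∧ ¬ T ⊆ S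

/-- A collection of sets is overlapping if, however it is split into two nonempty parts, some
member of one part overlaps some member of the other. -/
def OverlappingFamily {X : Type*} (D : Set (Set X)) : Prop :=
  ∀ P R : Set (Set X), P.Nonempty → R.Nonempty → Disjoint P R → P ∪ R = D →
    ∃ S ∈ P, ∃ T ∈ R, Overlap S T

/-- `M` is the union of an overlapping collection of members of `F`. The collection has at least
two members (otherwise `{M}` would decompose every `M`). -/
def Decomposable {X : Type*} (F : Set (Set X)) (M : Set X) : Prop :=
  ∃ D : Set (Set X), D ⊆ F ∧ D.Nontrivial ∧ OverlappingFamily D ∧ ⋃₀ D = M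

/-- The transitive reduction of a finite dag: the arcs `u → v` for which there is no other path
from `u` to `v`. -/
def transitiveReduction {V : Type*} (R : V → V → Prop) (u v : V) : Prop :=
  R u v ∧ ¬ ∃ w, Relation.TransGen R u w ∧ Relation.TransGen R w v

namespace FSM

/-- The indecomposable thin modules. -/
def Ind {Q A : Type*} (Z : FSM Q A) : Set (Set Q) :=
  {M | Z.IsThinModule M ∧ ¬ Decomposable {K | Z.IsThinModule K} M}

/-- The arcs of the decomposition tree, whose nodes are the indecomposable thin modules: the
transitive reduction of strict containment. -/
def treeArc {Q A : Type*} (Z : FSM Q A) : Z.Ind → Z.Ind → Prop :=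
  transitiveReduction fun K M => M.1 ⊂ K.1

/-- An `n`-state FSM over `k` symbols as a list of numbers: `n`, `k`, the start state, and the
`n × k` transition table row by row, with `0` for "undefined" and `v + 1` for the state `v`. -/
def encode {n k : ℕ} (Z : FSM (Fin n) (Fin k)) : List ℕ :=
  n :: k :: Z.start.val ::
    (List.finRange n).flatMap fun u => (List.finRange k).map fun x =>
      (Z.δ u x).elim 0 fun v => v.val + 1

/-- The list `o` of numbers describes the decomposition tree of `Z`: it consists of the number `m`
of nodes, followed by the arcs (each once, as pairs tail, head) of a digraph on `0, …, m - 1` that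
is the decomposition tree, where node `i < n` is the sink `{i}`. -/
def IsTreeEncoding {n k : ℕ} (Z : FSM (Fin n) (Fin k)) (o : List ℕ) : Prop :=
  ∃ (m : ℕ) (e : Fin m ≃ Z.Ind) (arcs : List (Fin m × Fin m)),
    (∀ i : Fin n, ∃ j : Fin m, j.val = i.val ∧ (e j).1 = {i}) ∧
    arcs.Nodup ∧
    (∀ a b : Fin m, (a, b) ∈ arcs ↔ Z.treeArc (e a) (e b)) ∧
    o = m :: arcs.flatMap fun p => [p.1.val, p.2.val]

end FSM

/-! A word RAM with structured programs: finitely many registers (named by the program), a random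
access memory, and an append-only output. Every instruction and every test costs one step. -/

namespace RAM

structure Store where
  reg : ℕ → ℕ
  mem : ℕ → ℕ
  out : List ℕ

namespace Store

def setReg (s : Store) (r v : ℕ) : Store := { s with reg := Function.update s.reg r v }

def setMem (s : Store) (a v : ℕ) : Store := { s with mem := Function.update s.mem a v }

def emit (s : Store) (v : ℕ) : Store := { s with out := s.out ++ [v] }

end Store

/-- Programs; `r`, `a`, `b` are register names. -/
inductive Prog where
  /-- do nothing -/
  | skip
  /-- `r := c` -/
  | const (r c : ℕ)
  /-- `r := a + b` -/
  | add (r a b : ℕ)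
  /-- `r := a - b`, truncated at `0` -/
  | sub (r a b : ℕ)
  /-- `r := a * b` -/
  | mul (r a b : ℕ)
  /-- `r := mem[a]` -/
  | load (r a : ℕ)
  /-- `mem[a] := b` -/
  | store (a b : ℕ)
  /-- append `a` to the output -/
  | emit (a : ℕ)
  | seq (P₁ P₂ : Prog)
  /-- if `r ≠ 0` then `P₁` else `P₂` -/
  | cond (r : ℕ) (P₁ P₂ : Prog)
  /-- while `r ≠ 0` do `P` -/
  | loop (r : ℕ) (P : Prog)

/-- `Exec W P s s' t`: started in `s`, the program `P` terminates in `s'` after exactly `t` steps.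
All numbers written are below `W`; a program that exceeds this word size gets stuck. -/
inductive Exec (W : ℕ) : Prog → Store → Store → ℕ → Prop
  | skip (s : Store) : Exec W .skip s s 1
  | const (s : Store) (r c : ℕ) : c < W → Exec W (.const r c) s (s.setReg r c) 1
  | add (s : Store) (r a b : ℕ) : s.reg a + s.reg b < W →
      Exec W (.add r a b) s (s.setReg r (s.reg a + s.reg b)) 1
  | sub (s : Store) (r a b : ℕ) : s.reg a - s.reg b < W →
      Exec W (.sub r a b) s (s.setReg r (s.reg a - s.reg b)) 1
  | mul (s : Store) (r a b : ℕ) : s.reg a * s.reg b < W →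
      Exec W (.mul r a b) s (s.setReg r (s.reg a * s.reg b)) 1
  | load (s : Store) (r a : ℕ) : s.mem (s.reg a) < W →
      Exec W (.load r a) s (s.setReg r (s.mem (s.reg a))) 1
  | store (s : Store) (a b : ℕ) : s.reg b < W →
      Exec W (.store a b) s (s.setMem (s.reg a) (s.reg b)) 1
  | emit (s : Store) (a : ℕ) : Exec W (.emit a) s (s.emit (s.reg a)) 1
  | seq {P₁ P₂ : Prog} {s s₁ s₂ : Store} {t₁ t₂ : ℕ} :
      Exec W P₁ s s₁ t₁ → Exec W P₂ s₁ s₂ t₂ → Exec W (.seq P₁ P₂) s s₂ (t₁ + t₂)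
  | cond_true {r : ℕ} {P₁ P₂ : Prog} {s s' : Store} {t : ℕ} :
      s.reg r ≠ 0 → Exec W P₁ s s' t → Exec W (.cond r P₁ P₂) s s' (t + 1)
  | cond_false {r : ℕ} {P₁ P₂ : Prog} {s s' : Store} {t : ℕ} :
      s.reg r = 0 → Exec W P₂ s s' t → Exec W (.cond r P₁ P₂) s s' (t + 1)
  | loop_true {r : ℕ} {P : Prog} {s s₁ s₂ : Store} {t₁ t₂ : ℕ} :
      s.reg r ≠ 0 → Exec W P s s₁ t₁ → Exec W (.loop r P) s₁ s₂ t₂ →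
        Exec W (.loop r P) s s₂ (t₁ + t₂ + 1)
  | loop_false {r : ℕ} {P : Prog} {s : Store} :
      s.reg r = 0 → Exec W (.loop r P) s s 1

/-- The input list is in memory from address `0` on; everything else is `0`. -/
def init (input : List ℕ) : Store where
  reg := fun _ => 0
  mem := fun a => input.getD a 0
  out := []

end RAM

set_option linter.constructorNameAsVariable false

/-! ### Thin modules in local form: one entry, and for each symbol at most one exit. -/

namespace FSM

variable {Q A : Type*} {Z : FSM Q A}

/-! For an accessible machine, being a thin module is a local condition. A thin module `M` has one
entry `u`: no other state of `M` is the start or the head of an arc from outside. For each symbol,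
either `M` is closed under it, or every state of `M` is led by arcs with that symbol, inside `M`, to
one common exit. This is `ThinAt u M`; the two directions are `IsThinModule.exists_thinAt` and
`ThinAt.isThinModule`.

Once `u` is fixed, these conditions become implications between memberships. The exit for `x` must
lie on the `x`-walk from `u`, so each state of `M` forces certain others into `M` (`Forces u`), and
closure under forcing is also sufficient (`thinAt_of_forces`). Hence there is a smallest candidate
containing `u` and `v`, namely `hull u v`, found by graph search. It is thin exactly if the start is
not forced against its role (`Admits u v`). Each pair of a state and a symbol contributes at most
three arcs to `Forces u`, so one search takes O(nk) time and n searches take O(n²k).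

`Admits` is a partial order in which the states admitting a given `v` form a chain. Every
indecomposable thin module is some `hull u v`, by maximality of a proper thin submodule with the
same entry. Let `b` be the nearest state other than `v` that admits `v`. If `hull b v` lies in `hull
u v`, then indecomposability lets `b` replace `v` as generator, unless `u = b`. If it does not, the
intersection of the two hulls is not thin, and the only obstruction is that `u` is an exit of `hull
b v`; moreover `u` is then the nearest such exit that admits `v`. So `mem_ind_iff` leaves one
singleton and at most two further hulls per state: 3n candidates, computable in O(n²k) time.

Containment of two candidates is decided in O(k) time: a thin module lies in `K` if and only if its
entry does and it contains no exit of `K` (`ThinAt.exists_exit_mem`). This gives the strict order on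
all O(n²) pairs within the bound. For its transitive reduction, a child of `K` is found by climbing
from an unmarked set below `K` to a maximal one, after which everything below that child is marked;
this costs O(n) per arc. The tree must therefore have only O(nk) arcs. By `card_antichain_le`, at
most 3k pairwise incomparable indecomposable thin modules, other than the singleton, pass through a
state: there are at most three different entries (`not_chain_four`), and for a fixed entry and
symbol the modules are generated by states on one walk and are nested. So each node has at most 3k
parents.

The algorithm is written in a small language with counted loops, whose running time can be read off
statically (`ev_t_le`), and is compiled to the RAM with a constant factor (`exec_comp`). Values
exceed the initial bound by at most the running time, which gives the polynomial word size. -/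

theorem output_concat (Z : FSM Q A) (w : List A) (a : A) :
    Z.output (w ++ [a]) = (Z.output w).bind fun q => Z.δ q a := by
  simp [output, List.foldl_append]

/-- Induction along the arcs of an accessible machine. -/
theorem Accessible.induction (hZ : Z.Accessible) {P : Q → Prop} (h0 : P Z.start)
    (h1 : ∀ q x r, P q → Z.δ q x = some r → P r) (q : Q) : P q := by
  have key : ∀ w : List A, ∀ q, Z.output w = some q → P q := by
    intro w
    induction w using List.reverseRecOn with
    | nil => intro q hq; simp [output] at hq; exact hq ▸ h0
    | append_singleton w a ih =>
      intro q hq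
      rw [output_concat, Option.bind_eq_some_iff] at hq
      obtain ⟨p, hp, hpq⟩ := hq
      exact h1 p a q (ih p hp) hpq
  obtain ⟨w, hw⟩ := hZ q
  exact key w q hw

/-- Following `x`-arcs from `q`, one stays in `M` until one reaches `e`. -/
inductive Leads (Z : FSM Q A) (M : Set Q) (x : A) (e : Q) : Q → Prop
  | last {q : Q} : q ∈ M → Z.δ q x = some e → Leads Z M x e q
  | step {q r : Q} : q ∈ M → Z.δ q x = some r → Leads Z M x e r → Leads Z M x e q

/-- `M` is a thin module, described locally, that is entered at `u`. -/
structure ThinAt (Z : FSM Q A) (u : Q) (M : Set Q) : Prop where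
  mem : u ∈ M
  ne_start : ∀ v ∈ M, v ≠ u → v ≠ Z.start
  pred : ∀ v ∈ M, v ≠ u → ∀ q x, Z.δ q x = some v → q ∈ M
  exit : ∀ x, (∀ q ∈ M, ∀ r, Z.δ q x = some r → r ∈ M) ∨
    ∃ e, e ∉ M ∧ ∀ q ∈ M, Z.Leads M x e q

theorem Leads.mem {M : Set Q} {x : A} {e q : Q} (h : Z.Leads M x e q) : q ∈ M := by
  cases h <;> assumption

theorem Leads.mono {M N : Set Q} (hMN : M ⊆ N) {x : A} {e q : Q} (h : Z.Leads M x e q) :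
    Z.Leads N x e q := by
  induction h with
  | last hq hd => exact .last (hMN hq) hd
  | step hq hd _ ih => exact .step (hMN hq) hd ih

theorem Leads.trans {M : Set Q} {x : A} {e f q : Q} (h : Z.Leads M x e q)
    (h' : Z.Leads M x f e) : Z.Leads M x f q := by
  induction h with
  | last hq hd => exact .step hq hd h'
  | step hq hd _ ih => exact .step hq hd ih

theorem Leads.not_cycle {M : Set Q} {x : A} {e q : Q} (he : e ∉ M) (h : Z.Leads M x e q) :
    ¬ Relation.TransGen (fun p q => p ∈ M ∧ q ∈ M ∧ Z.δ p x = some q) q q := by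
  induction h with
  | last hq hd =>
    intro hc
    obtain ⟨r, hr, -⟩ := Relation.TransGen.head'_iff.mp hc
    rw [hd] at hr
    exact he (by simpa using (Option.some_injective _ hr.2.2) ▸ hr.2.1)
  | step hq hd h ih =>
    intro hc
    obtain ⟨r, hr, hrq⟩ := Relation.TransGen.head'_iff.mp hc
    rw [hd] at hr
    obtain rfl := Option.some_injective _ hr.2.2
    exact ih (Relation.TransGen.tail' hrq ⟨hq, hr.2.1, hd⟩)

open Classical in
/-- The state of `Z/M ·_M Z[M]` that corresponds to a state of `Z`. -/
noncomputable def expandedOf (M : Set Q) (q : Q) :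
    {p : Option {q // q ∉ M} // p ≠ none} ⊕ {q // q ∈ M} :=
  if h : q ∈ M then Sum.inr ⟨q, h⟩ else Sum.inl ⟨some ⟨q, h⟩, by simp⟩

theorem expandedOf_expandedState (M : Set Q) (p) : expandedOf M (expandedState M p) = p := by
  rcases p with ⟨_ | q, h⟩ | q
  · exact absurd rfl h
  · simp [expandedState, expandedOf, q.2]
  · simp [expandedState, expandedOf, q.2]

/-- The local form of equivalence of an accessible machine and an expansion of it. -/
theorem expand_output_iff (hZ : Z.Accessible) (M : Set Q) (E : FSM _ A) :
    (∀ w : List A, (E.output w).map (expandedState M) = Z.output w) ↔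
      expandedState M E.start = Z.start ∧
        ∀ q x, (E.δ (expandedOf M q) x).map (expandedState M) = Z.δ q x := by
  constructor
  · intro h
    refine ⟨by simpa [output] using h [], fun q x => ?_⟩
    obtain ⟨w, hw⟩ := hZ q
    have h1 := h w
    have h2 := h (w ++ [x])
    rw [output_concat, output_concat, hw] at h2
    rw [hw, Option.map_eq_some_iff] at h1
    obtain ⟨p, hp, rfl⟩ := h1
    rw [hp] at h2
    simpa [expandedOf_expandedState] using h2
  · rintro ⟨h0, h1⟩ w
    induction w using List.reverseRecOn with
    | nil => simpa [output] using h0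
    | append_singleton w a ih =>
      rw [output_concat, output_concat, ← ih]
      cases E.output w with
      | none => rfl
      | some p =>
        have := h1 (expandedState M p) a
        rw [expandedOf_expandedState] at this
        simpa using this

theorem blockOf_mem {M : Set Q} {q : Q} (h : q ∈ M) : blockOf M q = none := by simp [blockOf, h]

theorem blockOf_notMem {M : Set Q} {q : Q} (h : q ∉ M) : blockOf M q = some ⟨q, h⟩ := by
  simp [blockOf, h]

theorem blockOf_eq_none {M : Set Q} {q : Q} : blockOf M q = none ↔ q ∈ M := by
  by_cases h : q ∈ M <;> simp [blockOf, h]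

theorem blockOf_eq_some {M : Set Q} {q : Q} {p : {q // q ∉ M}} :
    blockOf M q = some p ↔ q = p.1 := by
  by_cases h : q ∈ M
  · simp only [blockOf, h, dite_true, reduceCtorEq, false_iff]
    rintro rfl; exact p.2 h
  · simp [blockOf, h, Subtype.ext_iff]

open Classical in
theorem expandedState_redirect (M : Set Q) (H : FSM {q // q ∈ M} A) (q : Q) :
    expandedState M (redirect (none : Option {q // q ∉ M}) H (blockOf M q)) =
      if q ∈ M then H.start.1 else q := by
  by_cases h : q ∈ M
  · simp [blockOf_mem h, redirect, expandedState, h]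
  · simp [blockOf_notMem h, redirect, expandedState, h]

/-- The entry is the start state of the restriction. An arc from outside is redirected there by the
expansion, and since the expansion reproduces the transitions of `Z`, the arc must have ended there
already. -/
theorem IsThinModule.exists_thinAt [Finite Q] (hZ : Z.Accessible) {M : Set Q}
    (h : Z.IsThinModule M) : ∃ u, Z.ThinAt u M := by
  obtain ⟨⟨-, G, H, hG, hH, hout⟩, hthin⟩ := h
  rw [expand_output_iff hZ] at hout
  obtain ⟨hst, hstep⟩ := hout
  have hGout : ∀ q x r, q ∉ M → Z.δ q x = some r → G.δ (blockOf M q) x = some (blockOf M r) :=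
    fun q x r hq hr => (hG.arc _ _ _).mpr ⟨q, r, hr, rfl, rfl, fun h => hq h.1⟩
  have hGin : ∀ q x r, r ∉ M → Z.δ q x = some r → G.δ (blockOf M q) x = some (blockOf M r) :=
    fun q x r hq hr => (hG.arc _ _ _).mpr ⟨q, r, hr, rfl, rfl, fun h => hq h.2⟩
  refine ⟨H.start.1, H.start.2, ?_, ?_, ?_⟩
  · rintro v hv hne rfl
    apply hne
    have : expandedState M (redirect none H G.start) = Z.start := hst
    rw [hG.start, expandedState_redirect, if_pos hv] at this
    exact this.symm
  · intro v hv hne q x hq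
    by_contra hqM
    have h1 := hstep q x
    rw [hq] at h1
    simp only [expandedOf, hqM, dite_false, expand] at h1
    have h2 := hGout q x v hqM hq
    rw [blockOf_notMem hqM] at h2
    rw [h2] at h1
    simp only [Option.map_some, Option.some.injEq] at h1
    rw [expandedState_redirect, if_pos hv] at h1
    exact hne h1.symm
  · intro x
    rcases hthin x with hno | hcyc
    · left
      intro q hq r hr
      by_contra hrM
      exact hno r ⟨hrM, q, hq, hr⟩
    · by_cases hex : ∃ e, Z.IsExit M x e
      · right
        obtain ⟨e, heM, p, hp, hpe⟩ := hex
        have hGe := hGin p x e heM hpe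
        rw [blockOf_mem hp] at hGe
        -- A state without an `x`-arc inside `M` inherits the `x`-arc of the contracted node, which
        -- goes to `e`.
        have hstep' : ∀ q ∈ M, (∃ r ∈ M, Z.δ q x = some r) ∨ Z.δ q x = some e := by
          intro q hq
          have h1 := hstep q x
          simp only [expandedOf, hq, dite_true, expand] at h1
          cases hHq : H.δ ⟨q, hq⟩ x with
          | some t =>
            left
            exact ⟨t.1, t.2, (hH.arc _ _ _).mp hHq⟩
          | none =>
            right
            rw [hHq] at h1
            simp only [hGe, Option.map_some, expandedState_redirect, if_neg heM] at h1
            exact h1.symm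
        refine ⟨e, heM, ?_⟩
        let R : Q → Q → Prop := fun p q => p ∈ M ∧ q ∈ M ∧ Z.δ p x = some q
        -- Without `x`-cycles in a finite `M`, the `x`-arcs inside `M` are well founded, so
        -- following them ends at the exit.
        have hwf : WellFounded (fun a b => Relation.TransGen R b a) := by
          have : IsTrans Q (fun a b => Relation.TransGen R b a) :=
            ⟨fun a b c h1 h2 => h2.trans h1⟩
          have : Std.Irrefl (fun a b => Relation.TransGen R b a) := ⟨fun a h => hcyc ⟨a, h⟩⟩
          exact Finite.wellFounded_of_trans_of_irrefl _
        intro q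
        induction q using hwf.induction with
        | _ q ih =>
          intro hq
          rcases hstep' q hq with ⟨r, hr, hqr⟩ | hqe
          · exact .step hq hqr (ih r (.single ⟨hq, hr, hqr⟩) hr)
          · exact .last hq hqe
      · left
        intro q hq r hr
        by_contra hrM
        exact hex ⟨r, hrM, q, hq, hr⟩

theorem ThinAt.leads_of_exit {u : Q} {M : Set Q} (h : Z.ThinAt u M) {x : A} {e : Q}
    (he : Z.IsExit M x e) : ∀ q ∈ M, Z.Leads M x e q := by
  obtain ⟨heM, p, hp, hpe⟩ := he
  rcases h.exit x with hc | ⟨e', he', hl⟩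
  · exact absurd (hc p hp e hpe) heM
  · cases hl p hp with
    | last _ hd => rw [hpe] at hd; obtain rfl := Option.some_injective _ hd; exact hl
    | step _ hd hr =>
      rw [hpe] at hd; obtain rfl := Option.some_injective _ hd; exact absurd hr.mem heM

theorem Leads.step_or {M : Set Q} {x : A} {e q : Q} (h : Z.Leads M x e q) :
    Z.δ q x = some e ∨ ∃ r ∈ M, Z.δ q x = some r := by
  cases h with
  | last _ hd => exact .inl hd
  | step _ hd hr => exact .inr ⟨_, hr.mem, hd⟩

theorem Leads.exists_exit {M : Set Q} {x : A} {e q : Q} (he : e ∉ M) (h : Z.Leads M x e q) :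
    Z.IsExit M x e := by
  induction h with
  | last hq hd => exact ⟨he, _, hq, hd⟩
  | step _ _ _ ih => exact ih

theorem ThinAt.exit_unique {u : Q} {M : Set Q} (h : Z.ThinAt u M) {x : A} {e f : Q}
    (he : Z.IsExit M x e) (hf : Z.IsExit M x f) : e = f := by
  obtain ⟨hfM, p, hp, hpf⟩ := hf
  rcases (h.leads_of_exit he p hp).step_or with h1 | ⟨r, hr, h1⟩
  · rw [hpf] at h1; exact (Option.some_injective _ h1).symm
  · rw [hpf] at h1; obtain rfl := Option.some_injective _ h1; exact absurd hr hfM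

open Classical in
-- One exit per symbol makes the quotient relation a partial function, and one entry makes the
-- redirected arcs return to their true heads. A state of `M` whose `x`-arc does not stay inside
-- goes to the common exit, as in the expansion.
theorem ThinAt.isThinModule {u : Q} {M : Set Q} (hZ : Z.Accessible)
    (h : Z.ThinAt u M) : Z.IsThinModule M := by
  have hthin : ∀ x : A, (∀ v, ¬ Z.IsExit M x v) ∨ ¬ Z.HasCycleIn M x := by
    intro x
    rcases h.exit x with hc | ⟨e, he, hl⟩
    · left
      rintro v ⟨hv, q, hq, hqv⟩
      exact hv (hc q hq v hqv)
    · right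
      rintro ⟨p, hp⟩
      obtain ⟨r, hr, -⟩ := Relation.TransGen.head'_iff.mp hp
      exact (hl p hr.1).not_cycle he hp
  refine ⟨⟨⟨u, h.mem⟩, ?_⟩, hthin⟩
  let rel : Option {q // q ∉ M} → A → Option {q // q ∉ M} → Prop := fun p a p' =>
    ∃ q r : Q, Z.δ q a = some r ∧ blockOf M q = p ∧ blockOf M r = p' ∧ ¬ (q ∈ M ∧ r ∈ M)
  have hfun : ∀ p a p₁ p₂, rel p a p₁ → rel p a p₂ → p₁ = p₂ := by
    rintro p a p₁ p₂ ⟨q, r, hqr, hq, hr, hM⟩ ⟨q', r', hqr', hq', hr', hM'⟩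
    cases p with
    | none =>
      rw [blockOf_eq_none] at hq hq'
      have := h.exit_unique (x := a) ⟨fun hh => hM ⟨hq, hh⟩, q, hq, hqr⟩
        ⟨fun hh => hM' ⟨hq', hh⟩, q', hq', hqr'⟩
      rw [← hr, ← hr', this]
    | some p =>
      rw [blockOf_eq_some] at hq hq'
      rw [hq] at hqr; rw [hq', hqr] at hqr'
      rw [← hr, ← hr', Option.some_injective _ hqr']
  let G : FSM (Option {q // q ∉ M}) A :=
    { δ := fun p a => if hh : ∃ p', rel p a p' then some hh.choose else none
      start := blockOf M Z.start }
  let H : FSM {q // q ∈ M} A :=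
    { δ := fun t a => if hh : ∃ v : {q // q ∈ M}, Z.δ t.1 a = some v.1 then some hh.choose else none
      start := ⟨u, h.mem⟩ }
  have hG : Z.IsContraction M G := by
    refine ⟨fun p p' a => ?_, rfl⟩
    change (if hh : ∃ p', rel p a p' then some hh.choose else none) = some p' ↔ rel p a p'
    constructor
    · intro hp
      split at hp
      · rename_i hh
        exact Option.some_injective _ hp ▸ hh.choose_spec
      · simp at hp
    · intro hp
      have hh : ∃ p', rel p a p' := ⟨p', hp⟩
      rw [dif_pos hh, hfun p a _ _ hh.choose_spec hp]
  have hH : Z.IsRestriction M H := by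
    refine ⟨fun t v a => ?_, fun hs => ?_, fun hs v => ?_⟩
    · change (if hh : ∃ v : {q // q ∈ M}, Z.δ t.1 a = some v.1 then some hh.choose else none)
        = some v ↔ _
      constructor
      · intro hp
        split at hp
        · rename_i hh
          exact Option.some_injective _ hp ▸ hh.choose_spec
        · simp at hp
      · intro hp
        have hh : ∃ v : {q // q ∈ M}, Z.δ t.1 a = some v.1 := ⟨v, hp⟩
        rw [dif_pos hh]
        congr 1
        exact Subtype.ext (Option.some_injective _ (hh.choose_spec.symm.trans hp))
    · refine Subtype.ext ?_
      by_contra hne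
      exact h.ne_start _ hs (Ne.symm hne) rfl
    -- Only `u` receives arcs from outside; all other states have entry count 0, so `u` is a
    -- legitimate start of the restriction.
    · by_cases hv : v.1 = u
      · rw [hv]
      · have : {p : Q × A | p.1 ∉ M ∧ Z.δ p.1 p.2 = some v.1} = ∅ := by
          ext p
          simp only [Set.mem_ofPred_eq, Set.mem_empty_iff_false, iff_false, not_and]
          exact fun hp hd => hp (h.pred v.1 v.2 hv _ _ hd)
        simp [entryCount, this]
  refine ⟨G, H, hG, hH, (expand_output_iff hZ M _).mpr ⟨?_, fun q x => ?_⟩⟩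
  · change expandedState M (redirect none H (blockOf M Z.start)) = _
    rw [expandedState_redirect]
    split
    · rename_i hs
      by_contra hne
      exact h.ne_start _ hs (Ne.symm hne) rfl
    · rfl
  · have hout : ∀ r, q ∉ M → Z.δ q x = some r →
        ((G.δ (blockOf M q) x).map (redirect none H)).map (expandedState M) = some r := by
      intro r hq hr
      rw [(hG.arc (blockOf M q) (blockOf M r) x).mpr ⟨q, r, hr, rfl, rfl, fun h => hq h.1⟩]
      simp only [Option.map_some, expandedState_redirect]
      split
      · rename_i hrM
        by_contra hne
        exact hq (h.pred r hrM (fun h => hne (by rw [h])) q x hr)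
      · rfl
    by_cases hq : q ∈ M
    · simp only [expandedOf, hq, dite_true, expand]
      cases hHq : H.δ ⟨q, hq⟩ x with
      | some t => simpa [expandedState] using ((hH.arc _ _ _).mp hHq).symm
      | none =>
        have hno : ∀ r ∈ M, Z.δ q x ≠ some r := by
          intro r hr hqr
          have := (hH.arc ⟨q, hq⟩ ⟨r, hr⟩ x).mpr hqr
          rw [hHq] at this
          simp at this
        rcases hex : G.δ none x with _ | p
        · cases hqx : Z.δ q x with
          | none => rfl
          | some r =>
            have hr : r ∉ M := fun hr => hno r hr hqx
            have := (hG.arc none (blockOf M r) x).mpr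
              ⟨q, r, hqx, blockOf_mem hq, rfl, fun h => hr h.2⟩
            rw [hex] at this
            simp at this
        · obtain ⟨q', r, hqr, hq', hr, hM⟩ := (hG.arc _ _ _).mp hex
          rw [blockOf_eq_none] at hq'
          have hrM : r ∉ M := fun hr => hM ⟨hq', hr⟩
          rcases (h.leads_of_exit ⟨hrM, q', hq', hqr⟩ q hq).step_or with h1 | ⟨r', hr', h1⟩
          · rw [h1, ← hr]
            simp [expandedState_redirect, hrM]
          · exact absurd h1 (hno r' hr')
    · simp only [expandedOf, hq, dite_false, expand]
      rw [← blockOf_notMem hq]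
      cases hqx : Z.δ q x with
      | some r => exact hout r hq hqx
      | none =>
        cases hex : G.δ (blockOf M q) x with
        | none => rfl
        | some p =>
          obtain ⟨q', r, hqr, hq', hr, hM⟩ := (hG.arc _ _ _).mp hex
          rw [blockOf_notMem hq, blockOf_eq_some] at hq'
          rw [hq'] at hqr
          simp [hqx] at hqr

end FSM

/-! ### Unions and intersections of thin modules. -/

namespace FSM

variable {Q A : Type*} {Z : FSM Q A}

/-- A set that contains the entry of `N` but not all of `N` has an exit in `N`. -/
theorem ThinAt.exists_exit_mem (hZ : Z.Accessible) {b : Q} {N K : Set Q} (hN : Z.ThinAt b N)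
    (hb : b ∈ K) (hNK : ¬ N ⊆ K) : ∃ x, ∃ e ∈ N, Z.IsExit K x e := by
  by_contra hno
  apply hNK
  intro q
  refine hZ.induction (P := fun q => q ∈ N → q ∈ K) ?_ ?_ q
  · intro hs
    by_cases h : Z.start = b
    · rwa [h]
    · exact absurd rfl (hN.ne_start _ hs h)
  · intro q x r ih hr hrN
    by_cases h : r = b
    · rwa [h]
    · have hq := ih (hN.pred r hrN h q x hr)
      by_contra hrK
      exact hno ⟨x, r, hrN, hrK, q, hq, hr⟩

/-- Go back along a path from the start to the common state. A state of both sets that is the entry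
of neither has its predecessor in both, so the path must meet one of the entries inside the other
set. -/
theorem ThinAt.mem_or_mem (hZ : Z.Accessible) {u b q : Q} {M N : Set Q} (hM : Z.ThinAt u M)
    (hN : Z.ThinAt b N) (hqM : q ∈ M) (hqN : q ∈ N) : u ∈ N ∨ b ∈ M := by
  refine hZ.induction (P := fun q => q ∈ M → q ∈ N → u ∈ N ∨ b ∈ M) ?_ ?_ q hqM hqN
  · intro h1 h2
    by_cases h : Z.start = u
    · exact .inl (h ▸ h2)
    · exact absurd rfl (hM.ne_start _ h1 h)
  · intro q x r ih hr h1 h2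
    by_cases hru : r = u
    · exact .inl (hru ▸ h2)
    by_cases hrb : r = b
    · exact .inr (hrb ▸ h1)
    exact ih (hM.pred r h1 hru q x hr) (hN.pred r h2 hrb q x hr)

/-- Otherwise each entry is a non-entry of the other set. Then no arc enters the union from outside
and the start is not in it, so no state of it is accessible. -/
theorem ThinAt.eq_of_mem_of_mem (hZ : Z.Accessible) {u b : Q} {M N : Set Q} (hM : Z.ThinAt u M)
    (hN : Z.ThinAt b N) (hu : u ∈ N) (hb : b ∈ M) : u = b := by
  by_contra hne
  have : ∀ q, q ∉ M ∧ q ∉ N := by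
    refine hZ.induction ?_ ?_
    · constructor
      · intro h
        by_cases hs : Z.start = u
        · exact hN.ne_start u hu hne hs.symm
        · exact hM.ne_start _ h hs rfl
      · intro h
        by_cases hs : Z.start = b
        · exact hM.ne_start b hb (Ne.symm hne) hs.symm
        · exact hN.ne_start _ h hs rfl
    · rintro q x r ⟨h1, h2⟩ hr
      constructor
      · intro h
        by_cases hru : r = u
        · exact h2 (hN.pred u hu hne q x (hru ▸ hr))
        · exact h1 (hM.pred r h hru q x hr)
      · intro h
        by_cases hrb : r = b
        · exact h1 (hM.pred b hb (Ne.symm hne) q x (hrb ▸ hr))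
        · exact h2 (hN.pred r h hrb q x hr)
  exact (this u).1 hM.mem

theorem Leads.mem_of_closed {M N : Set Q} {x : A} {f q : Q} (h : Z.Leads N x f q)
    (hM : ∀ q ∈ M, ∀ r, Z.δ q x = some r → r ∈ M) (hq : q ∈ M) : f ∈ M := by
  induction h with
  | last _ hd => exact hM _ hq _ hd
  | step _ hd _ ih => exact ih (hM _ hq _ hd)

theorem Leads.inter {M N : Set Q} {x : A} {f q : Q}
    (hM : ∀ q ∈ M, ∀ r, Z.δ q x = some r → r ∈ M ∨ r ∉ N)
    (h : Z.Leads N x f q) (hq : q ∈ M) : Z.Leads (M ∩ N) x f q := by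
  induction h with
  | last hN hd => exact .last ⟨hq, hN⟩ hd
  | step hN hd hr ih => exact .step ⟨hq, hN⟩ hd (ih ((hM _ hq _ hd).resolve_right (· hr.mem)))

/-- The two walks are one deterministic walk. The state at which it first leaves one of the sets
lies outside the other one as well. -/
theorem Leads.eq_of_eq {M N : Set Q} {x : A} {e f q : Q} (h : Z.Leads M x e q)
    (h' : Z.Leads N x f q) (heN : e ∉ N) (hfM : f ∉ M) : e = f := by
  induction h with
  | last _ hd =>
    rcases h'.step_or with h1 | ⟨r, hr, h1⟩
    · rw [hd] at h1; exact Option.some_injective _ h1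
    · rw [hd] at h1; exact absurd (Option.some_injective _ h1 ▸ hr) heN
  | step _ hd hr ih =>
    cases h' with
    | last _ hd' => rw [hd] at hd'; exact absurd (Option.some_injective _ hd' ▸ hr.mem) hfM
    | step _ hd' hr' => rw [hd] at hd'; exact ih (Option.some_injective _ hd' ▸ hr')

theorem Leads.succ_mem {M : Set Q} {x : A} {e q r : Q} (h : Z.Leads M x e q)
    (hr : Z.δ q x = some r) : r ∈ M ∨ r = e := by
  rcases h.step_or with h1 | ⟨r', hr', h1⟩
  · rw [hr] at h1; exact .inr (Option.some_injective _ h1)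
  · rw [hr] at h1; exact .inl (Option.some_injective _ h1 ▸ hr')

/-- For one symbol, a walk that leaves one set at a state of the other goes on there. If each exit
lies in the other set, the union is closed. If just one does, the other exit serves both. If neither
does, the exits agree, because the walk from `b` starts in both sets. -/
theorem ThinAt.union {u b : Q} {M N : Set Q} (hM : Z.ThinAt u M)
    (hN : Z.ThinAt b N) (hb : b ∈ M) : Z.ThinAt u (M ∪ N) := by
  refine ⟨.inl hM.mem, ?_, ?_, ?_⟩
  · rintro v hv hvu
    by_cases hvM : v ∈ M
    · exact hM.ne_start v hvM hvu
    · exact hN.ne_start v (hv.resolve_left hvM) (fun h => hvM (h ▸ hb))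
  · rintro v hv hvu q x hq
    by_cases hvM : v ∈ M
    · exact .inl (hM.pred v hvM hvu q x hq)
    · exact .inr (hN.pred v (hv.resolve_left hvM) (fun h => hvM (h ▸ hb)) q x hq)
  · intro x
    rcases hM.exit x with hMc | ⟨e, he, hMe⟩ <;> rcases hN.exit x with hNc | ⟨f, hf, hNf⟩
    · left
      rintro q (hq | hq) r hr
      · exact .inl (hMc q hq r hr)
      · exact .inr (hNc q hq r hr)
    · left
      have hfM : f ∈ M := (hNf b hN.mem).mem_of_closed hMc hb
      rintro q (hq | hq) r hr
      · exact .inl (hMc q hq r hr)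
      · rcases (hNf q hq).succ_mem hr with h | rfl
        · exact .inr h
        · exact .inl hfM
    · left
      have heN : e ∈ N := (hMe b hb).mem_of_closed hNc hN.mem
      rintro q (hq | hq) r hr
      · rcases (hMe q hq).succ_mem hr with h | rfl
        · exact .inl h
        · exact .inr heN
      · exact .inr (hNc q hq r hr)
    · by_cases heN : e ∈ N <;> by_cases hfM : f ∈ M
      · left
        rintro q (hq | hq) r hr
        · rcases (hMe q hq).succ_mem hr with h | rfl
          · exact .inl h
          · exact .inr heN
        · rcases (hNf q hq).succ_mem hr with h | rfl
          · exact .inr h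
          · exact .inl hfM
      · right
        refine ⟨f, fun h => h.elim hfM hf, ?_⟩
        rintro q (hq | hq)
        · exact ((hMe q hq).mono Set.subset_union_left).trans
            ((hNf e heN).mono Set.subset_union_right)
        · exact (hNf q hq).mono Set.subset_union_right
      · right
        refine ⟨e, fun h => h.elim he heN, ?_⟩
        rintro q (hq | hq)
        · exact (hMe q hq).mono Set.subset_union_left
        · exact ((hNf q hq).mono Set.subset_union_right).trans
            ((hMe f hfM).mono Set.subset_union_left)
      · right
        have hef : e = f := (hMe b hb).eq_of_eq (hNf b hN.mem) heN hfM
        subst hef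
        refine ⟨e, fun h => h.elim he hf, ?_⟩
        rintro q (hq | hq)
        · exact (hMe q hq).mono Set.subset_union_left
        · exact (hNf q hq).mono Set.subset_union_right

/-- Inside `N`, which avoids `u`, the walk cannot pass from outside `M` into `M`. So it can do this
only with its last arc, and then only through the entry. -/
theorem Leads.eq_entry {u : Q} {M N : Set Q} (hM : Z.ThinAt u M) (hu : u ∉ N) {x : A} {f q : Q}
    (h : Z.Leads N x f q) (hq : q ∉ M) (hf : f ∈ M) : f = u := by
  induction h with
  | last _ hd =>
    by_contra hne
    exact hq (hM.pred f hf hne _ x hd)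
  | @step q r _ hd hr ih =>
    apply ih
    intro hrM
    have : r ≠ u := fun h => hu (h ▸ hr.mem)
    exact hq (hM.pred r hrM this _ x hd)

/-- The intersection of two thin modules, the second entered in the first, is a thin module
unless some symbol leads from the second to the entry of the first, and from the first into the
second. -/
theorem ThinAt.inter (hZ : Z.Accessible) {u b : Q} {M N : Set Q} (hM : Z.ThinAt u M)
    (hN : Z.ThinAt b N) (hb : b ∈ M) (hne : u ≠ b) :
    Z.ThinAt b (M ∩ N) ∨ ∃ x, Z.IsExit N x u ∧ ∃ e ∈ N, Z.IsExit M x e := by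
  have hu : u ∉ N := fun hu => hne (hM.eq_of_mem_of_mem hZ hN hu hb)
  by_cases hw : ∃ x, Z.IsExit N x u ∧ ∃ e ∈ N, Z.IsExit M x e
  · exact .inr hw
  left
  refine ⟨⟨hb, hN.mem⟩, fun v hv h => hN.ne_start v hv.2 h, fun v hv h q x hq =>
    ⟨hM.pred v hv.1 (fun h => hu (h ▸ hv.2)) q x hq, hN.pred v hv.2 h q x hq⟩, ?_⟩
  intro x
  rcases hM.exit x with hMc | ⟨e, he, hMe⟩ <;> rcases hN.exit x with hNc | ⟨f, hf, hNf⟩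
  · exact .inl fun q hq r hr => ⟨hMc q hq.1 r hr, hNc q hq.2 r hr⟩
  · exact .inr ⟨f, fun h => hf h.2, fun q hq =>
      (hNf q hq.2).inter (fun q hq r hr => .inl (hMc q hq r hr)) hq.1⟩
  · refine .inr ⟨e, fun h => he h.1, fun q hq => ?_⟩
    rw [Set.inter_comm]
    exact (hMe q hq.1).inter (fun q hq r hr => .inl (hNc q hq r hr)) hq.2
  · by_cases heN : e ∈ N
    -- This is where the exceptional symbol is excluded: the walk from `e`, which is outside `M`,
    -- would enter `M` at `f`, so `f` would be the entry `u`.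
    · have hfM : f ∉ M := by
        intro hfM
        obtain rfl := (hNf e heN).eq_entry hM hu he hfM
        exact hw ⟨x, (hNf b hN.mem).exists_exit hf, e, heN, (hMe b hb).exists_exit he⟩
      refine .inr ⟨e, fun h => he h.1, fun q hq => ?_⟩
      rw [Set.inter_comm]
      refine (hMe q hq.1).inter (fun q hq r hr => ?_) hq.2
      exact ((hNf q hq).succ_mem hr).imp id (fun h => by rwa [h])
    · refine .inr ⟨f, fun h => hf h.2, fun q hq => ?_⟩
      refine (hNf q hq.2).inter (fun q hq r hr => ?_) hq.1
      exact ((hMe q hq).succ_mem hr).imp id (fun h => by rwa [h])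

/-- If all of `N` leads to a non-entry of `K`, and the entry of `K` is not in `N`, then `K`
contains `N`. -/
theorem ThinAt.subset_of_exit {u b c : Q} {K N : Set Q} (hK : Z.ThinAt u K) (hN : Z.ThinAt b N)
    {x : A} (hc : Z.IsExit N x c) (hcK : c ∈ K) (hcu : c ≠ u) (hu : u ∉ N) : N ⊆ K := by
  intro q hq
  have h := hN.leads_of_exit hc q hq
  clear hq
  induction h with
  | last _ hd => exact hK.pred c hcK hcu _ x hd
  | @step q r _ hd hr ih => exact hK.pred r ih (fun h => hu (h ▸ hr.mem)) _ x hd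

theorem ThinAt.singleton (q : Q) : Z.ThinAt q {q} := by
  refine ⟨rfl, fun v hv h => absurd hv h, fun v hv h => absurd hv h, fun x => ?_⟩
  by_cases h : ∃ e, e ≠ q ∧ Z.δ q x = some e
  · obtain ⟨e, he, hqe⟩ := h
    right
    refine ⟨e, he, ?_⟩
    rintro p rfl
    exact .last rfl hqe
  · left
    rintro p rfl r hr
    by_contra hne
    exact h ⟨r, hne, hr⟩

end FSM

/-! ### Walks along one symbol, forced membership, and the hull of two states. -/

namespace FSM

variable {Q A : Type*} {Z : FSM Q A}

/-- The walk from `u` along `x`-arcs. -/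
def orb (Z : FSM Q A) (x : A) (u : Q) : ℕ → Option Q
  | 0 => some u
  | j + 1 => (Z.orb x u j).bind fun q => Z.δ q x

/-- `q` is on the walk from `u` along `x`-arcs. -/
def OnOrb (Z : FSM Q A) (x : A) (u q : Q) : Prop := ∃ i, Z.orb x u i = some q

/-- The walk from `u` along `x`-arcs meets its last new state after `j` steps. -/
structure OrbEnd (Z : FSM Q A) (x : A) (u : Q) (j : ℕ) : Prop where
  isSome : ∃ q, Z.orb x u j = some q
  inj : ∀ i i', i < i' → i' ≤ j → Z.orb x u i ≠ Z.orb x u i'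
  closed : Z.orb x u (j + 1) = none ∨ ∃ i ≤ j, Z.orb x u (j + 1) = Z.orb x u i

/-- `l` is the last new state of the walk from `u` along `x`-arcs. -/
def OrbLast (Z : FSM Q A) (x : A) (u l : Q) : Prop := ∃ j, Z.OrbEnd x u j ∧ Z.orb x u j = some l

/-- `y` is first reached from `p` on the walk from `u` along `x`-arcs. -/
def OrbPred (Z : FSM Q A) (x : A) (u p y : Q) : Prop :=
  ∃ j, Z.orb x u j = some p ∧ Z.orb x u (j + 1) = some y ∧ ∀ i ≤ j, Z.orb x u i ≠ some y

/-- `w` is on an `x`-cycle. -/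
def OnCycle (Z : FSM Q A) (x : A) (w : Q) : Prop := ∃ j, Z.orb x w (j + 1) = some w

/-- A thin module entered at `u` that contains the first state contains the second one. -/
inductive Forces (Z : FSM Q A) (u : Q) : Q → Q → Prop
  | pred {v q : Q} {x : A} : v ≠ u → Z.δ q x = some v → Forces Z u v q
  | undef {w l : Q} {x : A} : ¬ Z.OnOrb x u w → Z.δ w x = none → Z.OrbLast x u l → Forces Z u w l
  | join {w y p : Q} {x : A} : ¬ Z.OnOrb x u w → Z.δ w x = some y → y ≠ u → Z.OrbPred x u p y →
      Forces Z u w p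
  | off {w y : Q} {x : A} : ¬ Z.OnOrb x u w → Z.δ w x = some y → ¬ Z.OnOrb x u y → Forces Z u w y
  | cycle {w l : Q} {x : A} : ¬ Z.OnOrb x u w → Z.OnCycle x w → Z.OrbLast x u l → Forces Z u w l

theorem orb_add {x : A} {u q : Q} {i : ℕ} (h : Z.orb x u i = some q) (j : ℕ) :
    Z.orb x u (i + j) = Z.orb x q j := by
  induction j with
  | zero => simpa [orb] using h
  | succ j ih => rw [← add_assoc]; simp only [orb]; rw [ih]

theorem orb_succ' {x : A} {u q : Q} (h : Z.δ u x = some q) (j : ℕ) :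
    Z.orb x u (j + 1) = Z.orb x q j := by
  rw [add_comm]; exact orb_add (by simpa [orb] using h) j

theorem OnOrb.self (x : A) (u : Q) : Z.OnOrb x u u := ⟨0, rfl⟩

theorem OnOrb.step {x : A} {u q r : Q} (h : Z.OnOrb x u q) (hr : Z.δ q x = some r) :
    Z.OnOrb x u r := by
  obtain ⟨i, hi⟩ := h
  exact ⟨i + 1, by simp [orb, hi, hr]⟩

theorem exists_orb_of_le {x : A} {u q : Q} {j : ℕ} (h : Z.orb x u j = some q) :
    ∀ i ≤ j, ∃ r, Z.orb x u i = some r := by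
  induction j generalizing q with
  | zero => intro i hi; obtain rfl := Nat.le_zero.mp hi; exact ⟨q, h⟩
  | succ j ih =>
    intro i hi
    rcases Nat.lt_or_eq_of_le hi with hi | rfl
    · simp only [orb, Option.bind_eq_some_iff] at h
      obtain ⟨p, hp, -⟩ := h
      exact ih hp i (by omega)
    · exact ⟨q, h⟩

theorem OrbEnd.exists_le {x : A} {u : Q} {j : ℕ} (h : Z.OrbEnd x u j) {q : Q}
    (hq : Z.OnOrb x u q) : ∃ i ≤ j, Z.orb x u i = some q := by
  obtain ⟨m, hm⟩ := hq
  induction m using Nat.strong_induction_on with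
  | _ m ih =>
    by_cases hmj : m ≤ j
    · exact ⟨m, hmj, hm⟩
    obtain ⟨d, rfl⟩ := Nat.exists_eq_add_of_lt (not_le.mp hmj)
    obtain ⟨r, hr⟩ := exists_orb_of_le hm (j + 1) (by omega)
    rcases h.closed with h0 | ⟨i, hi, hij⟩
    · rw [h0] at hr; simp at hr
    · rw [show j + d + 1 = j + 1 + d by omega, orb_add hr, ← orb_add (hij ▸ hr)] at hm
      exact ih (i + d) (by omega) hm

theorem exists_repeat_or_none [Finite Q] (x : A) (u : Q) :
    ∃ j, (∃ q, Z.orb x u j = some q) ∧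
      (Z.orb x u (j + 1) = none ∨ ∃ i ≤ j, Z.orb x u (j + 1) = Z.orb x u i) := by
  by_contra hno
  push Not at hno
  have hsome : ∀ j, ∃ q, Z.orb x u j = some q := by
    intro j
    induction j with
    | zero => exact ⟨u, rfl⟩
    | succ j ih => exact Option.ne_none_iff_exists'.mp (hno j ih).1
  have hinj : Function.Injective (Z.orb x u) := by
    intro a b hab
    rcases lt_trichotomy a b with h | h | h
    · obtain ⟨c, rfl⟩ := Nat.exists_eq_add_of_lt h
      exact absurd hab.symm ((hno _ (hsome _)).2 a (by omega))
    · exact h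
    · obtain ⟨c, rfl⟩ := Nat.exists_eq_add_of_lt h
      exact absurd hab ((hno _ (hsome _)).2 b (by omega))
  exact not_injective_infinite_finite _ hinj

theorem exists_orbEnd [Finite Q] (x : A) (u : Q) : ∃ j, Z.OrbEnd x u j := by
  classical
  have h := Z.exists_repeat_or_none x u
  obtain ⟨h1, h2⟩ := Nat.find_spec h
  refine ⟨Nat.find h, h1, ?_, h2⟩
  intro i i' hi hi' heq
  obtain ⟨q, hq⟩ := h1
  cases i' with
  | zero => omega
  | succ i' =>
    exact Nat.find_min h (m := i') (by omega)
      ⟨exists_orb_of_le hq i' (by omega), .inr ⟨i, by omega, heq.symm⟩⟩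

theorem Leads.exists_orb {M : Set Q} {x : A} {e q : Q} (h : Z.Leads M x e q) :
    ∃ i, Z.orb x q i = some e ∧ ∀ i' < i, ∃ r ∈ M, Z.orb x q i' = some r := by
  induction h with
  | @last q hq hd => exact ⟨1, by simp [orb, hd], fun i hi => ⟨q, hq, by
      obtain rfl : i = 0 := by omega
      rfl⟩⟩
  | @step q r hq hd _ ih =>
    obtain ⟨i, hi, hi'⟩ := ih
    refine ⟨i + 1, by rw [orb_succ' hd, hi], fun j hj => ?_⟩
    cases j with
    | zero => exact ⟨q, hq, rfl⟩
    | succ j => rw [orb_succ' hd]; exact hi' j (by omega)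

theorem OnCycle.exists_ge {x : A} {w : Q} (h : Z.OnCycle x w) (i : ℕ) :
    ∃ j ≥ i, Z.orb x w j = some w := by
  obtain ⟨c, hc⟩ := h
  induction i with
  | zero => exact ⟨c + 1, by omega, hc⟩
  | succ i ih =>
    obtain ⟨j, hj, hjw⟩ := ih
    exact ⟨j + (c + 1), by omega, by rw [orb_add hjw, hc]⟩

/-- An `x`-exit lies on the `x`-walk from `u`, since `u` itself leads to it. A state off this walk
that has no `x`-arc cannot lead to it. Nor can one on an `x`-cycle, for the cycle would pass through
the exit and put the state on the walk. In both cases `M` is closed under `x` and contains the whole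
walk with its last state. If `w` steps onto the walk at `y`, either `y` belongs to `M`, and then so
do its predecessors, or `y` is the exit, and then the walk from `u` stays in `M` up to its first
arrival at `y`. -/
theorem ThinAt.forces {u : Q} {M : Set Q} (h : Z.ThinAt u M) {a b : Q} (ha : a ∈ M)
    (hab : Z.Forces u a b) : b ∈ M := by
  have horb : ∀ x q, (∀ q ∈ M, ∀ r, Z.δ q x = some r → r ∈ M) → Z.OnOrb x u q → q ∈ M := by
    rintro x q hc ⟨i, hi⟩
    induction i generalizing q with
    | zero => simp only [orb, Option.some.injEq] at hi; exact hi ▸ h.mem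
    | succ i ih =>
      simp only [orb, Option.bind_eq_some_iff] at hi
      obtain ⟨p, hp, hpq⟩ := hi
      exact hc p (ih p hp) q hpq
  cases hab with
  | pred hne hd => exact h.pred a ha hne _ _ hd
  | @undef _ x hw hd hl =>
    obtain ⟨j, -, hj⟩ := hl
    rcases h.exit x with hc | ⟨e, he, hle⟩
    · exact horb x _ hc ⟨j, hj⟩
    · rcases (hle a ha).step_or with h1 | ⟨r, -, h1⟩ <;> rw [hd] at h1 <;> simp at h1
  | @cycle _ x hw hcyc hl =>
    obtain ⟨j, -, hj⟩ := hl
    rcases h.exit x with hc | ⟨e, he, hle⟩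
    · exact horb x _ hc ⟨j, hj⟩
    · exfalso
      obtain ⟨i, hi, -⟩ := (hle u h.mem).exists_orb
      obtain ⟨i', hi', -⟩ := (hle a ha).exists_orb
      obtain ⟨m, hm, hma⟩ := hcyc.exists_ge i'
      obtain ⟨d, rfl⟩ := Nat.exists_eq_add_of_le hm
      rw [orb_add hi'] at hma
      exact hw ⟨i + d, by rw [orb_add hi, hma]⟩
  | @off _ x hw hd hy =>
    rcases h.exit x with hc | ⟨e, he, hle⟩
    · exact hc a ha b hd
    · rcases (hle a ha).succ_mem hd with h1 | rfl
      · exact h1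
      · obtain ⟨i, hi, -⟩ := (hle u h.mem).exists_orb
        exact absurd ⟨i, hi⟩ hy
  | @join y _ x hw hd hyu hp =>
    obtain ⟨j, hj, hj', hjf⟩ := hp
    rcases h.exit x with hc | ⟨e, he, hle⟩
    · exact horb x _ hc ⟨j, hj⟩
    · rcases (hle a ha).succ_mem hd with h1 | rfl
      · refine h.pred y h1 hyu b x ?_
        simpa [orb, hj] using hj'
      · obtain ⟨i, hi, hi'⟩ := (hle u h.mem).exists_orb
        have : j < i := by
          by_contra hlt
          exact hjf i (not_lt.mp hlt) hi
        obtain ⟨r, hr, hjr⟩ := hi' j this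
        rw [hj] at hjr
        exact Option.some_injective _ hjr ▸ hr

theorem exists_orbPred {x : A} {u y : Q} (hy : Z.OnOrb x u y) (hyu : y ≠ u) :
    ∃ p, Z.OrbPred x u p y := by
  classical
  have hspec := Nat.find_spec hy
  have hmin := fun m hm => Nat.find_min hy (m := m) hm
  cases hj : Nat.find hy with
  | zero => rw [hj] at hspec; simp only [orb, Option.some.injEq] at hspec; exact absurd hspec.symm hyu
  | succ j =>
    rw [hj] at hspec hmin
    have h := hspec
    simp only [orb, Option.bind_eq_some_iff] at h
    obtain ⟨p, hp, -⟩ := h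
    exact ⟨p, j, hp, hspec, fun i hi => hmin i (by omega)⟩

/-- The last new state `l` of the `x`-walk from `u` separates the two kinds of symbol. If `l` is in
`M`, predecessor forcing puts the whole walk into `M`, and `M` is closed under `x`. If it is not,
the first state of the walk outside `M` is the common exit. -/
theorem thinAt_of_forces [Finite Q] {u : Q} {M : Set Q} (hu : u ∈ M)
    (hs : ∀ v ∈ M, v ≠ u → v ≠ Z.start) (hM : ∀ a ∈ M, ∀ b, Z.Forces u a b → b ∈ M) :
    Z.ThinAt u M := by
  classical
  refine ⟨hu, hs, fun v hv hne q x hq => hM v hv q (.pred hne hq), fun x => ?_⟩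
  obtain ⟨j, hj⟩ := Z.exists_orbEnd x u
  obtain ⟨l, hl⟩ := hj.isSome
  have hlast : Z.OrbLast x u l := ⟨j, hj, hl⟩
  have hne : ∀ i q, i + 1 ≤ j → Z.orb x u (i + 1) = some q → q ≠ u := by
    rintro i q hi hq rfl
    exact hj.inj 0 (i + 1) (by omega) hi (by rw [hq]; rfl)
  -- With a state of the walk, `M` contains all earlier ones. Positions are kept at most `j`, so
  -- that no state after position 0 is `u`, to which `Forces.pred` does not apply.
  have hdown : ∀ a q, a ≤ j → Z.orb x u a = some q → q ∈ M → ∀ i ≤ a, ∀ r, Z.orb x u i = some r →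
      r ∈ M := by
    intro a
    induction a with
    | zero => intro q _ hq hqM i hi r hr
              obtain rfl := Nat.le_zero.mp hi
              rw [hq] at hr; exact Option.some_injective _ hr ▸ hqM
    | succ a ih =>
      intro q ha hq hqM i hi r hr
      rcases Nat.lt_or_eq_of_le hi with hi | rfl
      · have h := hq
        simp only [orb, Option.bind_eq_some_iff] at h
        obtain ⟨p, hp, hpq⟩ := h
        exact ih p (by omega) hp (hM q hqM p (.pred (hne a q ha hq) hpq)) i (by omega) r hr
      · rw [hq] at hr; exact Option.some_injective _ hr ▸ hqM
  by_cases hlM : l ∈ M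
  · left
    have horb : ∀ q, Z.OnOrb x u q → q ∈ M := by
      intro q hq
      obtain ⟨i, hi, hiq⟩ := hj.exists_le hq
      exact hdown j l le_rfl hl hlM i hi q hiq
    intro q hq r hr
    by_cases hqo : Z.OnOrb x u q
    · exact horb r (hqo.step hr)
    · by_cases hro : Z.OnOrb x u r
      · exact horb r hro
      · exact hM q hq r (.off hqo hr hro)
  · right
    have hex : ∃ i, ∃ q, Z.orb x u i = some q ∧ q ∉ M := ⟨j, l, hl, hlM⟩
    obtain ⟨e, he, heM⟩ := Nat.find_spec hex
    set i := Nat.find hex with hi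
    have hij : i ≤ j := Nat.find_min' hex ⟨l, hl, hlM⟩
    have hmin : ∀ i' < i, ∀ q, Z.orb x u i' = some q → q ∈ M := by
      intro i' hi' q hq
      by_contra hqM
      exact Nat.find_min hex hi' ⟨q, hq, hqM⟩
    have hlead : ∀ d i' q, i' + d + 1 = i → Z.orb x u i' = some q → Z.Leads M x e q := by
      intro d
      induction d with
      | zero =>
        intro i' q hi' hq
        refine .last (hmin i' (by omega) q hq) ?_
        rw [← hi'] at he
        simpa [orb, hq] using he
      | succ d ih =>
        intro i' q hi' hq
        obtain ⟨r, hr⟩ := exists_orb_of_le he (i' + 1) (by omega)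
        refine .step (hmin i' (by omega) q hq) (r := r) ?_ (ih (i' + 1) r (by omega) hr)
        simpa [orb, hq] using hr
    have hlt : ∀ i' q, Z.orb x u i' = some q → i' < i → Z.Leads M x e q := by
      intro i' q hq hi'
      obtain ⟨d, hd⟩ := Nat.exists_eq_add_of_lt hi'
      exact hlead d i' q hd.symm hq
    have hon : ∀ q ∈ M, Z.OnOrb x u q → Z.Leads M x e q := by
      intro q hq hqo
      obtain ⟨a, ha, haq⟩ := hj.exists_le hqo
      refine hlt a q haq ?_
      by_contra hai
      exact heM (hdown a q ha haq hq i (not_lt.mp hai) e he)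
    refine ⟨e, heM, fun q hq => ?_⟩
    by_cases hqo : Z.OnOrb x u q
    · exact hon q hq hqo
    by_contra hno
    -- If `q` does not lead to `e`, forcing keeps its entire `x`-walk defined, in `M` and off the
    -- walk from `u`. By finiteness this walk reaches a cycle, which forces `l` into `M`.
    have hwalk : ∀ m, ∃ r, Z.orb x q m = some r ∧ r ∈ M ∧ ¬ Z.OnOrb x u r ∧ ¬ Z.Leads M x e r := by
      intro m
      induction m with
      | zero => exact ⟨q, rfl, hq, hqo, hno⟩
      | succ m ih =>
        obtain ⟨r, hr, hrM, hro, hrl⟩ := ih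
        cases hy : Z.δ r x with
        | none => exact absurd (hM r hrM l (.undef hro hy hlast)) hlM
        | some y =>
          have hnl : ¬ Z.Leads M x e y := fun h => hrl (.step hrM hy h)
          have hyo : ¬ Z.OnOrb x u y := by
            intro hyo
            by_cases hyu : y = u
            · exact hnl (hyu ▸ hon u hu (OnOrb.self x u))
            · obtain ⟨p, hp⟩ := exists_orbPred hyo hyu
              have hpM := hM r hrM p (.join hro hy hyu hp)
              obtain ⟨b, hb, hb', hbf⟩ := hp
              have hbj : b + 1 ≤ j := by
                obtain ⟨a, ha, hay⟩ := hj.exists_le hyo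
                by_contra hlt
                exact hbf a (by omega) hay
              have hbi : b < i := by
                by_contra hlt
                exact heM (hdown b p (by omega) hb hpM i (not_lt.mp hlt) e he)
              rcases Nat.lt_or_eq_of_le hbi with h | h
              · exact hnl (hlt (b + 1) y hb' h)
              · have hb'' : Z.orb x u i = some y := by rw [← h]; exact hb'
                rw [he] at hb''
                obtain rfl := Option.some_injective _ hb''
                exact hrl (.last hrM hy)
          exact ⟨y, by simp [orb, hr, hy], hM r hrM y (.off hro hy hyo), hyo, hnl⟩
    obtain ⟨c, -, hend⟩ := Z.exists_repeat_or_none x q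
    obtain ⟨r', hr', hr'M, hr'o, -⟩ := hwalk (c + 1)
    rcases hend with h0 | ⟨a, ha, hca⟩
    · rw [h0] at hr'; simp at hr'
    · have har : Z.orb x q a = some r' := hca ▸ hr'
      have hcyc : Z.OnCycle x r' := by
        refine ⟨c - a, ?_⟩
        rw [← orb_add har, ← hr']
        congr 1; omega
      exact hlM (hM r' hr'M l (.cycle hr'o hcyc hlast))

/-- The smallest set containing `u` and `v` that can be a thin module entered at `u`. -/
def hull (Z : FSM Q A) (u v : Q) : Set Q := {q | q = u ∨ Relation.ReflTransGen (Z.Forces u) v q}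

/-- Some thin module entered at `u` contains `v`. -/
def Admits (Z : FSM Q A) (u v : Q) : Prop :=
  u = Z.start ∨ ¬ Relation.ReflTransGen (Z.Forces u) v Z.start

/-- All rules except `pred` start off the walk from `u`, which contains `u`; `pred` excludes `u`
explicitly. So the entry imposes nothing, and `hull u u` is a singleton. -/
theorem Forces.ne {u a b : Q} (h : Z.Forces u a b) : a ≠ u := by
  rintro rfl
  cases h with
  | pred h => exact h rfl
  | undef h => exact h (OnOrb.self _ _)
  | join h => exact h (OnOrb.self _ _)
  | off h => exact h (OnOrb.self _ _)
  | cycle h => exact h (OnOrb.self _ _)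

theorem mem_hull_left (u v : Q) : u ∈ Z.hull u v := .inl rfl

theorem mem_hull_right (u v : Q) : v ∈ Z.hull u v := .inr .refl

theorem hull_self (u : Q) : Z.hull u u = {u} := by
  ext q
  simp only [hull, Set.mem_ofPred_eq, Set.mem_singleton_iff, or_iff_left_iff_imp]
  intro h
  rcases h.cases_head with h | ⟨r, h, -⟩
  · exact h.symm
  · exact absurd rfl h.ne

theorem hull_closed {u v a b : Q} (ha : a ∈ Z.hull u v) (h : Z.Forces u a b) : b ∈ Z.hull u v := by
  rcases ha with rfl | ha
  · exact absurd rfl h.ne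
  · exact .inr (ha.tail h)

/-- Together with `Admits.thinAt`, this makes the hull the least thin module with entry `u` through
`v`, whenever there is one. -/
theorem ThinAt.hull_subset {u v : Q} {M : Set Q} (h : Z.ThinAt u M) (hv : v ∈ M) :
    Z.hull u v ⊆ M := by
  rintro q (rfl | hq)
  · exact h.mem
  · induction hq with
    | refl => exact hv
    | tail _ hab ih => exact h.forces ih hab

theorem ThinAt.admits {u v : Q} {M : Set Q} (h : Z.ThinAt u M) (hv : v ∈ M) : Z.Admits u v := by
  by_cases hu : u = Z.start
  · exact .inl hu
  · refine .inr fun hr => ?_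
    exact h.ne_start _ (h.hull_subset hv (.inr hr)) (Ne.symm hu) rfl

theorem Admits.thinAt [Finite Q] {u v : Q} (h : Z.Admits u v) : Z.ThinAt u (Z.hull u v) := by
  refine thinAt_of_forces (mem_hull_left u v) ?_ fun a ha b hab => hull_closed ha hab
  rintro q (rfl | hq) hne rfl
  · exact hne rfl
  · rcases h with h | h
    · exact hne h.symm
    · exact h hq

theorem Admits.subset [Finite Q] {u v w : Q} (h : Z.Admits u v) (hw : w ∈ Z.hull u v) :
    Z.hull u w ⊆ Z.hull u v := h.thinAt.hull_subset hw

end FSM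

/-! ### The order `Admits` and a list of 3n candidates for the indecomposable thin modules. -/

namespace FSM

variable {Q A : Type*} {Z : FSM Q A}

theorem Admits.refl (u : Q) : Z.Admits u u := (ThinAt.singleton u).admits rfl

/-- The union of the two hulls is thin, because the second is entered in the first. -/
theorem Admits.trans [Finite Q] {a b c : Q} (hab : Z.Admits a b) (hbc : Z.Admits b c) :
    Z.Admits a c :=
  (hab.thinAt.union hbc.thinAt (mem_hull_right a b)).admits (.inr (mem_hull_right b c))

theorem Admits.antisymm [Finite Q] (hZ : Z.Accessible) {a b : Q} (hab : Z.Admits a b)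
    (hba : Z.Admits b a) : a = b :=
  hab.thinAt.eq_of_mem_of_mem hZ hba.thinAt (mem_hull_right b a) (mem_hull_right a b)

theorem Admits.total [Finite Q] (hZ : Z.Accessible) {a b v : Q} (ha : Z.Admits a v)
    (hb : Z.Admits b v) : Z.Admits a b ∨ Z.Admits b a := by
  rcases ha.thinAt.mem_or_mem hZ hb.thinAt (mem_hull_right a v) (mem_hull_right b v) with h | h
  · exact .inr (hb.thinAt.admits h)
  · exact .inl (ha.thinAt.admits h)

theorem Admits.mem_hull [Finite Q] (hZ : Z.Accessible) {a b v : Q} (ha : Z.Admits a v)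
    (hb : Z.Admits b v) (hab : Z.Admits a b) : b ∈ Z.hull a v := by
  rcases ha.thinAt.mem_or_mem hZ hb.thinAt (mem_hull_right a v) (mem_hull_right b v) with h | h
  · rw [hab.antisymm hZ (hb.thinAt.admits h)]; exact mem_hull_left b v
  · exact h

theorem decomposable_union [Finite Q] (hZ : Z.Accessible) {u b : Q} {M N : Set Q}
    (hM : Z.ThinAt u M) (hN : Z.ThinAt b N) (h : Overlap M N) :
    Decomposable {K | Z.IsThinModule K} (M ∪ N) := by
  have hne : M ≠ N := fun h' => h.2.1 h'.subset
  refine ⟨{M, N}, ?_, ⟨M, by simp, N, by simp, hne⟩, ?_, by simp⟩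
  · rintro K (rfl | rfl)
    · exact hM.isThinModule hZ
    · exact hN.isThinModule hZ
  · rintro P R ⟨S, hS⟩ ⟨T, hT⟩ hd hPR
    have hS' : S ∈ ({M, N} : Set (Set Q)) := hPR ▸ Set.mem_union_left _ hS
    have hT' : T ∈ ({M, N} : Set (Set Q)) := hPR ▸ Set.mem_union_right _ hT
    have hST : S ≠ T := fun h' => Set.disjoint_left.mp hd hS (h' ▸ hT)
    refine ⟨S, hS, T, hT, ?_⟩
    rcases hS' with rfl | rfl <;> rcases hT' with rfl | rfl
    · exact absurd rfl hST
    · exact h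
    · exact ⟨by rw [Set.inter_comm]; exact h.1, h.2.2, h.2.1⟩
    · exact absurd rfl hST

/-- Split the overlapping family into the members that lie in a thin module entered at `u` and
missing `v`, and the rest. An overlap across the split yields a member `T` whose entry `b` can be
reached without `v`, while `T` contains `v`. -/
theorem exists_of_decomposable [Finite Q] (hZ : Z.Accessible) {u v : Q} (huv : Z.Admits u v)
    (h : Decomposable {K | Z.IsThinModule K} (Z.hull u v)) :
    ∃ b, b ≠ u ∧ b ∈ Z.hull u v ∧ Z.Admits b v ∧ Z.hull b v ⊆ Z.hull u v ∧ v ∉ Z.hull u b := by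
  obtain ⟨D, hDF, hnt, hov, hU⟩ := h
  have hsub : ∀ S ∈ D, S ⊆ Z.hull u v := fun S hS => hU ▸ Set.subset_sUnion_of_mem hS
  have hM := huv.thinAt
  have hMD : Z.hull u v ∉ D := by
    intro hMD
    obtain ⟨S, hS, hSM⟩ := hnt.exists_ne (Z.hull u v)
    obtain ⟨S', hS', T, hT, hST⟩ := hov {Z.hull u v} (D \ {Z.hull u v}) ⟨_, rfl⟩ ⟨S, hS, hSM⟩
      Set.disjoint_sdiff_right (by simp [hMD])
    obtain rfl := hS'
    exact hST.2.2 (hsub T hT.1)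
  have hentry : ∀ S b, Z.ThinAt b S → S ⊆ Z.hull u v → u ∈ S → b = u := fun S b hb hS hu =>
    hb.eq_of_mem_of_mem hZ hM (hS hb.mem) hu
  let good : Set Q → Prop := fun C => Z.ThinAt u C ∧ C ⊆ Z.hull u v ∧ v ∉ C
  have hgood : ∀ S ∈ D, u ∈ S → good S := by
    intro S hS hu
    obtain ⟨b, hb⟩ := (hDF hS : Z.IsThinModule S).exists_thinAt hZ
    obtain rfl := hentry S b hb (hsub S hS) hu
    refine ⟨hb, hsub S hS, fun hv => hMD ?_⟩
    rwa [← (hsub S hS).antisymm (hb.hull_subset hv)]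
  have hP : {S ∈ D | ∃ C, good C ∧ S ⊆ C}.Nonempty := by
    have : u ∈ ⋃₀ D := hU ▸ mem_hull_left u v
    obtain ⟨S, hS, hu⟩ := this
    exact ⟨S, hS, S, hgood S hS hu, subset_rfl⟩
  have hR : {S ∈ D | ¬ ∃ C, good C ∧ S ⊆ C}.Nonempty := by
    have : v ∈ ⋃₀ D := hU ▸ mem_hull_right u v
    obtain ⟨S, hS, hv⟩ := this
    exact ⟨S, hS, fun ⟨C, hC, hSC⟩ => hC.2.2 (hSC hv)⟩
  obtain ⟨S, ⟨hS, C, hC, hSC⟩, T, ⟨hT, hTno⟩, hST⟩ := hov _ _ hP hR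
    (Set.disjoint_left.mpr fun S h1 h2 => h2.2 h1.2)
    (Set.ext fun S => ⟨fun h => h.elim And.left And.left, fun h =>
      (em (∃ C, good C ∧ S ⊆ C)).imp (And.intro h) (And.intro h)⟩)
  have huT : u ∉ T := fun hu => hTno ⟨T, hgood T hT hu, subset_rfl⟩
  obtain ⟨b, hb⟩ := (hDF hT : Z.IsThinModule T).exists_thinAt hZ
  obtain ⟨p, hpS, hpT⟩ := hST.1
  -- `C` and `T` meet, and `u` is not in `T`; so the entry of `T` lies in `C`.
  have hbC : b ∈ C := (hC.1.mem_or_mem hZ hb (hSC hpS) hpT).resolve_left huT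
  -- If `T` missed `v`, then `C ∪ T` would be a good set containing `T`, and `T` would belong to the
  -- first part.
  have hvT : v ∈ T := by
    by_contra hvT
    exact hTno ⟨C ∪ T, ⟨hC.1.union hb hbC, Set.union_subset hC.2.1 (hsub T hT),
      fun h => h.elim hC.2.2 hvT⟩, Set.subset_union_right⟩
  exact ⟨b, fun h => huT (h ▸ hb.mem), hC.2.1 hbC, hb.admits hvT,
    (hb.hull_subset hvT).trans (hsub T hT), fun h => hC.2.2 (hC.1.hull_subset hbC h)⟩

theorem hull_mem_ind [Finite Q] (hZ : Z.Accessible) {u v : Q} (huv : Z.Admits u v)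
    (h : ∀ b, b ≠ u → b ∈ Z.hull u v → Z.Admits b v → Z.hull b v ⊆ Z.hull u v → v ∈ Z.hull u b) :
    Z.hull u v ∈ Z.Ind :=
  ⟨huv.thinAt.isThinModule hZ, fun hd => by
    obtain ⟨b, h1, h2, h3, h4, h5⟩ := exists_of_decomposable hZ huv hd
    exact h5 (h b h1 h2 h3 h4)⟩

theorem singleton_mem_ind [Finite Q] (hZ : Z.Accessible) (q : Q) : {q} ∈ Z.Ind := by
  rw [← hull_self (Z := Z) q]
  refine hull_mem_ind hZ (Admits.refl q) fun b hb hb' => ?_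
  rw [hull_self] at hb'
  exact absurd hb' hb

/-- An indecomposable thin module is generated by its entry and one more state. -/
theorem exists_hull_of_mem_ind [Finite Q] (hZ : Z.Accessible) {K : Set Q} (hK : K ∈ Z.Ind) :
    ∃ u v, Z.Admits u v ∧ K = Z.hull u v := by
  obtain ⟨hthin, hdec⟩ := hK
  obtain ⟨u, hu⟩ := hthin.exists_thinAt hZ
  by_contra hno
  have hfin : {M : Set Q | Z.ThinAt u M ∧ M ⊂ K}.Finite := Set.toFinite _
  have hne : {M : Set Q | Z.ThinAt u M ∧ M ⊂ K}.Nonempty := by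
    refine ⟨{u}, ThinAt.singleton u, ?_⟩
    refine Set.ssubset_iff_subset_ne.mpr ⟨Set.singleton_subset_iff.mpr hu.mem, fun h => hno ?_⟩
    exact ⟨u, u, Admits.refl u, by rw [hull_self, h]⟩
  -- With a maximal proper thin submodule `M` with the same entry and a state `v` outside it, the
  -- union of `M` and `hull u v` is all of `K`. If `hull u v` were proper, the two would overlap and
  -- decompose `K`.
  obtain ⟨M, ⟨hM, hMK⟩, hmax⟩ := hfin.exists_maximal hne
  obtain ⟨v, hvK, hvM⟩ := Set.exists_of_ssubset hMK
  have huv := hu.admits hvK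
  have hsub := hu.hull_subset hvK
  have hnK : Z.hull u v ≠ K := fun h => hno ⟨u, v, huv, h.symm⟩
  have hun : M ∪ Z.hull u v = K := by
    by_contra hne'
    have h1 := hmax (y := M ∪ Z.hull u v) ⟨hM.union huv.thinAt hM.mem,
      Set.ssubset_iff_subset_ne.mpr ⟨Set.union_subset hMK.subset hsub, hne'⟩⟩
      Set.subset_union_left
    exact hvM (h1 (.inr (mem_hull_right u v)))
  apply hdec
  rw [← hun]
  refine decomposable_union hZ hM huv.thinAt ⟨⟨u, hM.mem, mem_hull_left u v⟩, fun h => ?_,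
    fun h => hvM (h (mem_hull_right u v))⟩
  rw [Set.union_eq_self_of_subset_left h] at hun
  exact hnK hun

/-- `b` is the nearest state other than `v` that admits `v`. -/
structure Near (Z : FSM Q A) (v b : Q) : Prop where
  ne : b ≠ v
  admits : Z.Admits b v
  nearest : ∀ c, c ≠ v → Z.Admits c v → Z.Admits c b

/-- `u` is the nearest exit of `hull b v` that admits `v`. -/
structure NearExit (Z : FSM Q A) (v b u : Q) : Prop where
  exit : ∃ x, Z.IsExit (Z.hull b v) x u
  admits : Z.Admits u v
  nearest : ∀ c, (∃ x, Z.IsExit (Z.hull b v) x c) → Z.Admits c v → Z.Admits c u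

/-- The start admits everything, so there are candidates. They form a chain, and the one with the
most states admitting it is the nearest. -/
theorem exists_near [Finite Q] (hZ : Z.Accessible) {v : Q} (hv : v ≠ Z.start) :
    ∃ b, Z.Near v b := by
  have hfin : {c | c ≠ v ∧ Z.Admits c v}.Finite := Set.toFinite _
  obtain ⟨b, ⟨hbv, hb⟩, hmax⟩ := Set.exists_max_image _ (fun b => {c | Z.Admits c b}.ncard) hfin
    ⟨Z.start, Ne.symm hv, .inl rfl⟩
  refine ⟨b, hbv, hb, fun c hcv hc => ?_⟩
  rcases hc.total hZ hb with h | h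
  · exact h
  · have hsub : {d | Z.Admits d b} ⊆ {d | Z.Admits d c} := fun d hd => Admits.trans hd h
    have := Set.eq_of_subset_of_ncard_le hsub (hmax c ⟨hcv, hc⟩)
    have hcc : c ∈ {d | Z.Admits d c} := Admits.refl c
    rwa [← this] at hcc

/-- If the intersection of the two hulls were thin with entry `b`, it would contain `v` and hence
`hull b v`. So the exceptional case of `ThinAt.inter` occurs. -/
theorem exit_of_not_subset [Finite Q] (hZ : Z.Accessible) {u b v : Q} (hu : Z.Admits u v)
    (hb : Z.Admits b v) (hub : Z.Admits u b) (hne : u ≠ b) (hsub : ¬ Z.hull b v ⊆ Z.hull u v) :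
    ∃ x, Z.IsExit (Z.hull b v) x u := by
  rcases hu.thinAt.inter hZ hb.thinAt (hu.mem_hull hZ hb hub) hne with h | ⟨x, hx, -⟩
  · exact absurd ((h.hull_subset ⟨mem_hull_right u v, mem_hull_right b v⟩).trans
      Set.inter_subset_left) hsub
  · exact ⟨x, hx⟩

/-- A decomposition would provide a state strictly between `b` and `v` in the chain of states
admitting `v`. -/
theorem hull_near_mem_ind [Finite Q] (hZ : Z.Accessible) {v b : Q} (h : Z.Near v b) :
    Z.hull b v ∈ Z.Ind := by
  refine hull_mem_ind hZ h.admits fun c hcb hc hcv _ => ?_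
  by_cases hv : c = v
  · rw [hv]; exact mem_hull_right b v
  · exact absurd ((h.nearest c hv hcv).antisymm hZ (h.admits.thinAt.admits hc)) hcb

/-- A decomposition would provide a `c` inside `hull u v`, other than its entry, with `hull c v`
contained in it. Then `hull b v` is not contained in `hull c v` either, so `c` is an exit of `hull b
v`. But a set that avoids `u` and leads to a non-entry of `hull u v` is contained in `hull u v`. -/
theorem hull_nearExit_mem_ind [Finite Q] (hZ : Z.Accessible) {v b u : Q} (h : Z.Near v b)
    (hu : Z.NearExit v b u) (hsub : ¬ Z.hull b v ⊆ Z.hull u v) : Z.hull u v ∈ Z.Ind := by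
  obtain ⟨x, hx⟩ := hu.exit
  refine hull_mem_ind hZ hu.admits fun c hcu hc hcv hcs => ?_
  by_cases hv : c = v
  · rw [hv]; exact mem_hull_right u v
  exfalso
  have hcb := h.nearest c hv hcv
  have hne : c ≠ b := fun h' => hsub (h' ▸ hcs)
  obtain ⟨y, hy⟩ := exit_of_not_subset hZ hcv h.admits hcb hne fun h' => hsub (h'.trans hcs)
  exact hsub (hu.admits.thinAt.subset_of_exit h.admits.thinAt hy hc hcu hx.1)

/-- Each `v` determines its `b`, and then `u`, so there are at most three candidates per state. The
last condition has to be tested: without it the set in question may be decomposable. -/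
theorem mem_ind_iff [Finite Q] (hZ : Z.Accessible) {K : Set Q} :
    K ∈ Z.Ind ↔ (∃ q, K = {q}) ∨ (∃ v b, Z.Near v b ∧ K = Z.hull b v) ∨
      ∃ v b u, Z.Near v b ∧ Z.NearExit v b u ∧ K = Z.hull u v ∧ ¬ Z.hull b v ⊆ Z.hull u v := by
  constructor
  · intro hK
    obtain ⟨u, v, huv, rfl⟩ := exists_hull_of_mem_ind hZ hK
    -- The same hull may have many generators. Passing from `v` to `b` strictly reduces the number
    -- of states admitting the generator.
    induction hm : {c | Z.Admits c v}.ncard using Nat.strong_induction_on generalizing v with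
    | _ m ih =>
      by_cases hne : v = u
      · left; exact ⟨u, by rw [hne, hull_self]⟩
      have hvs : v ≠ Z.start := huv.thinAt.ne_start v (mem_hull_right u v) hne
      obtain ⟨b, hb⟩ := exists_near hZ hvs
      by_cases hub : u = b
      · right; left; exact ⟨v, b, hb, by rw [hub]⟩
      have hub' := hb.nearest u (Ne.symm hne) huv
      have hbM : b ∈ Z.hull u v := huv.mem_hull hZ hb.admits hub'
      have huN : u ∉ Z.hull b v := fun h =>
        hub (hub'.antisymm hZ (hb.admits.thinAt.admits h))
      by_cases hsub : Z.hull b v ⊆ Z.hull u v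
      -- Otherwise `hull u b` and `hull b v` overlap and have the union `hull u v`, which would be
      -- decomposable.
      · have hv : v ∈ Z.hull u b := by
          by_contra hv
          have hun : Z.hull u b ∪ Z.hull b v = Z.hull u v :=
            (Set.union_subset (huv.subset hbM) hsub).antisymm
              ((hub'.thinAt.union hb.admits.thinAt (mem_hull_right u b)).hull_subset
                (.inr (mem_hull_right b v)))
          apply hK.2
          rw [← hun]
          exact decomposable_union hZ hub'.thinAt hb.admits.thinAt
            ⟨⟨b, mem_hull_right u b, mem_hull_left b v⟩, fun h => huN (h (mem_hull_left u b)),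
              fun h => hv (h (mem_hull_right b v))⟩
        have heq : Z.hull u v = Z.hull u b := (hub'.subset hv).antisymm (huv.subset hbM)
        rw [heq]
        refine ih _ ?_ b hub' (heq ▸ hK) rfl
        rw [← hm]
        refine Set.ncard_lt_ncard (Set.ssubset_iff_of_subset ?_ |>.mpr ⟨v, Admits.refl v, ?_⟩)
        · exact fun c hc => Admits.trans hc hb.admits
        · exact fun h => hb.ne (hb.admits.antisymm hZ h)
      · right; right
        refine ⟨v, b, u, hb, ⟨exit_of_not_subset hZ huv hb.admits hub' hub hsub, huv, ?_⟩, rfl, hsub⟩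
        rintro c ⟨x, hx⟩ hc
        rcases hc.total hZ huv with h | h
        · exact h
        -- An exit `c` of `hull b v` nearer than `u` would be a non-entry of `hull u v`, and then
        -- all of `hull b v` would lie in `hull u v`.
        · by_cases hcu : c = u
          · rw [hcu]; exact Admits.refl u
          · exact absurd (huv.thinAt.subset_of_exit hb.admits.thinAt hx (huv.mem_hull hZ hc h)
              hcu huN) hsub
  · rintro (⟨q, rfl⟩ | ⟨v, b, h, rfl⟩ | ⟨v, b, u, h, hu, rfl, hsub⟩)
    · exact singleton_mem_ind hZ q
    · exact hull_near_mem_ind hZ h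
    · exact hull_nearExit_mem_ind hZ h hu hsub

/-! ### Antichains of indecomposable thin modules through a state -/

/-- The states of `hull u v` that do not force `v` form a thin module with entry `u`. It has an exit
inside the hull. This exit lies on the walk from `u` with its symbol, and it generates the same hull
because it forces `v`. The first visit to it is taken, so that the walk does not return to `u`
before. -/
theorem exists_orb_hull [Finite Q] (hZ : Z.Accessible) {u v : Q} (huv : Z.Admits u v)
    (hne : v ≠ u) : ∃ x j p, Z.orb x u j = some p ∧ Z.hull u v = Z.hull u p ∧ Z.Admits u p ∧
      ∀ l, 0 < l → l ≤ j → Z.orb x u l ≠ some u := by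
  classical
  let N : Set Q := {q ∈ Z.hull u v | v ∉ Z.hull u q}
  have huN : u ∈ N := ⟨mem_hull_left u v, by rw [hull_self]; exact hne⟩
  have hN : Z.ThinAt u N := by
    refine thinAt_of_forces huN (fun q hq => huv.thinAt.ne_start q hq.1) fun a ha b hab => ?_
    refine ⟨huv.thinAt.forces ha.1 hab, fun h => ha.2 ?_⟩
    rcases h with h | h
    · exact absurd h hne
    · exact .inr (h.head hab)
  have hnot : ¬ Z.hull u v ⊆ N := fun h => (h (mem_hull_right u v)).2 (mem_hull_right u v)
  obtain ⟨x, e, he, hex⟩ := huv.thinAt.exists_exit_mem hZ huN hnot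
  have hve : v ∈ Z.hull u e := by
    by_contra h
    exact hex.1 ⟨he, h⟩
  have hue := huv.thinAt.admits he
  obtain ⟨i, hi, -⟩ := (hN.leads_of_exit hex u huN).exists_orb
  have hex' : ∃ i, Z.orb x u i = some e := ⟨i, hi⟩
  refine ⟨x, Nat.find hex', e, Nat.find_spec hex', (hue.subset hve).antisymm (huv.subset he), hue,
    fun l hl hlj hlu => ?_⟩
  obtain ⟨d, hd⟩ := Nat.exists_eq_add_of_le hlj
  have := Nat.find_spec hex'
  rw [hd, orb_add hlu] at this
  exact Nat.find_min hex' (m := d) (by omega) this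

/-- A state of the walk forces its predecessors, as long as `u` is not met again. So the hulls
generated along one walk increase. -/
theorem hull_orb_subset [Finite Q] {u p p' : Q} {x : A} {i j : ℕ} (hij : i ≤ j)
    (hp : Z.orb x u i = some p) (hp' : Z.orb x u j = some p') (hu : Z.Admits u p')
    (hj : ∀ l, 0 < l → l ≤ j → Z.orb x u l ≠ some u) : Z.hull u p ⊆ Z.hull u p' := by
  apply hu.subset
  have : ∀ d q, d + i ≤ j → Z.orb x u (d + i) = some q → q ∈ Z.hull u p' → p ∈ Z.hull u p' := by
    intro d
    induction d with
    | zero =>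
      intro q _ hq hqM
      rw [zero_add, hp] at hq
      exact Option.some_injective _ hq ▸ hqM
    | succ d ih =>
      intro q hd hq hqM
      have hqu : q ≠ u := fun h => hj (d + 1 + i) (by omega) hd (h ▸ hq)
      rw [show d + 1 + i = d + i + 1 by omega] at hq
      simp only [orb, Option.bind_eq_some_iff] at hq
      obtain ⟨r, hr, hrq⟩ := hq
      exact ih r (by omega) hr (hu.thinAt.pred q hqM hqu r x hrq)
  exact this (j - i) p' (by omega) (by rw [Nat.sub_add_cancel hij]; exact hp')
    (mem_hull_right u p')

/-- All of `L` follows one symbol to a state of `N` outside `L`. Trace these walks backwards: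
predecessors stay in `N` down to its entry `c`. This is a non-entry of `K`, and from there
predecessors stay in `K`, whose entry is not in `L`. -/
theorem subset_union_of_chain {a b c : Q} {K L N : Set Q} (hZ : Z.Accessible) (hK : Z.ThinAt a K)
    (hL : Z.ThinAt b L) (hN : Z.ThinAt c N) (hcK : c ∈ K) (hcL : c ∈ L) (hca : c ≠ a) (haL : a ∉ L)
    (hNL : ¬ N ⊆ L) : L ⊆ K ∪ N := by
  obtain ⟨x, e, heN, he⟩ := hN.exists_exit_mem hZ hcL hNL
  intro z hz
  have h := hL.leads_of_exit he z hz
  clear hz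
  induction h with
  | @last z hz hd =>
    by_cases hzN : z ∈ N
    · exact .inr hzN
    · by_cases hec : e = c
      · exact absurd (hec ▸ hcL) he.1
      · exact .inr (hN.pred e heN hec z x hd)
  | @step z r hz hd hr ih =>
    rcases ih with hrK | hrN
    · exact .inl (hK.pred r hrK (fun h => haL (h ▸ hr.mem)) z x hd)
    · by_cases hrc : r = c
      · exact .inl (hK.pred r (hrc ▸ hcK) (hrc ▸ hca) z x hd)
      · exact .inr (hN.pred r hrN hrc z x hd)

/-- Pairwise incomparable indecomposable thin modules through a state do not have four entries. -/
theorem not_chain_four [Finite Q] (hZ : Z.Accessible) {a b c d q : Q} {J K L N : Set Q}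
    (hJ : Z.ThinAt d J) (hK : Z.ThinAt a K) (hL : Z.ThinAt b L) (hN : Z.ThinAt c N)
    (hq : q ∈ K ∧ q ∈ L ∧ q ∈ N) (had : a ≠ d) (hba : b ≠ a) (hcb : c ≠ b) (hca : c ≠ a)
    (hbd : b ≠ d) (haJ : a ∈ J) (hbJ : b ∈ J) (hbK : b ∈ K) (hcK : c ∈ K) (hcL : c ∈ L)
    (hLi : ¬ Decomposable {K | Z.IsThinModule K} L)
    (hLJ : ¬ L ⊆ J) (hNK : ¬ N ⊆ K) (hNL : ¬ N ⊆ L) (hLK : ¬ L ⊆ K) : False := by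
  have haL : a ∉ L := fun h => hba (hL.eq_of_mem_of_mem hZ hK hbK h)
  have haN : a ∉ N := fun h => hca (hN.eq_of_mem_of_mem hZ hK hcK h)
  have hbN : b ∉ N := fun h => hcb (hN.eq_of_mem_of_mem hZ hL hcL h)
  have hdL : d ∉ L := fun h => hbd (hL.eq_of_mem_of_mem hZ hJ hbJ h)
  have hsub := subset_union_of_chain hZ hK hL hN hcK hcL hca haL hNL
  -- Both intersections below are thin. In the exceptional cases `L` would lead to the non-entry `a`
  -- of `J`, or `N` to the non-entry `b` of `K`, and would be contained there. This is the role of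
  -- the fourth set `J`.
  rcases hK.inter hZ hL hbK (Ne.symm hba) with h1 | ⟨x, hx, -⟩
  · rcases hL.inter hZ hN hcL (Ne.symm hcb) with h2 | ⟨x, hx, -⟩
    · apply hLi
      -- Thus `L` is the union of two overlapping thin modules, which contradicts its
      -- indecomposability.
      have : L = K ∩ L ∪ L ∩ N := by
        ext z
        constructor
        · intro hz
          rcases hsub hz with h | h
          · exact .inl ⟨h, hz⟩
          · exact .inr ⟨hz, h⟩
        · rintro (h | h)
          · exact h.2
          · exact h.1
      rw [this]
      refine decomposable_union hZ h1 h2 ⟨⟨q, ⟨hq.1, hq.2.1⟩, hq.2⟩, fun h => hbN (h h1.mem).2, ?_⟩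
      intro h
      apply hLK
      rw [this]
      exact Set.union_subset Set.inter_subset_left (h.trans Set.inter_subset_left)
    · exact hNK (hK.subset_of_exit hN hx hbK hba haN)
  · exact hLJ (hJ.subset_of_exit hL hx haJ had hdL)

theorem exists_top [Finite Q] (hZ : Z.Accessible) {q : Q} {E : Finset Q} (hE : E.Nonempty)
    (h : ∀ a ∈ E, Z.Admits a q) : ∃ a ∈ E, ∀ b ∈ E, Z.Admits a b := by
  classical
  induction hE using Finset.Nonempty.cons_induction with
  | singleton a => exact ⟨a, by simp, by simpa using Admits.refl a⟩
  | cons a E ha hE ih =>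
    obtain ⟨t, ht, htop⟩ := ih fun b hb => h b (Finset.mem_cons_of_mem hb)
    rcases (h a (Finset.mem_cons_self a E)).total hZ (h t (Finset.mem_cons_of_mem ht)) with h' | h'
    · refine ⟨a, Finset.mem_cons_self a E, fun b hb => ?_⟩
      rcases Finset.mem_cons.mp hb with rfl | hb
      · exact Admits.refl _
      · exact h'.trans (htop b hb)
    · refine ⟨t, Finset.mem_cons_of_mem ht, fun b hb => ?_⟩
      rcases Finset.mem_cons.mp hb with rfl | hb
      · exact h'
      · exact htop b hb

theorem card_entries_le [Finite Q] (hZ : Z.Accessible) {q : Q} {E : Finset Q} (K : Q → Set Q)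
    (hK : ∀ u ∈ E, Z.ThinAt u (K u) ∧ K u ∈ Z.Ind ∧ q ∈ K u)
    (hinc : ∀ u ∈ E, ∀ u' ∈ E, u ≠ u' → ¬ K u ⊆ K u') : E.card ≤ 3 := by
  classical
  by_contra hcard
  have hadm : ∀ a ∈ E, Z.Admits a q := fun a ha => (hK a ha).1.admits (hK a ha).2.2
  have hmem : ∀ a ∈ E, ∀ b ∈ E, Z.Admits a b → b ∈ K a := by
    intro a ha b hb hab
    rcases (hK a ha).1.mem_or_mem hZ (hK b hb).1 (hK a ha).2.2 (hK b hb).2.2 with h | h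
    · rw [hab.antisymm hZ ((hK b hb).1.admits h)]; exact (hK b hb).1.mem
    · exact h
  have hex : ∀ F : Finset Q, F ⊆ E → 0 < F.card → ∃ a ∈ F, ∀ b ∈ F, Z.Admits a b := fun F hF hc =>
    exists_top hZ (Finset.card_pos.mp hc) fun a ha => hadm a (hF ha)
  obtain ⟨d, hd, hd'⟩ := hex E subset_rfl (by omega)
  have c1 := Finset.card_erase_of_mem hd
  obtain ⟨a, ha, ha'⟩ := hex (E.erase d) (Finset.erase_subset _ _) (by omega)
  have c2 := Finset.card_erase_of_mem ha
  obtain ⟨b, hb, hb'⟩ := hex ((E.erase d).erase a)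
    ((Finset.erase_subset _ _).trans (Finset.erase_subset _ _)) (by omega)
  have c3 := Finset.card_erase_of_mem hb
  obtain ⟨c, hc⟩ := Finset.card_pos.mp (show 0 < (((E.erase d).erase a).erase b).card by omega)
  simp only [Finset.mem_erase] at ha hb hc ha' hb'
  obtain ⟨had, haE⟩ := ha
  obtain ⟨hba, hbd, hbE⟩ := hb
  obtain ⟨hcb, hca, hcd, hcE⟩ := hc
  exact not_chain_four hZ (hK d hd).1 (hK a haE).1 (hK b hbE).1 (hK c hcE).1
    ⟨(hK a haE).2.2, (hK b hbE).2.2, (hK c hcE).2.2⟩ had hba hcb hca hbd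
    (hmem d hd a haE (hd' a haE)) (hmem d hd b hbE (hd' b hbE))
    (hmem a haE b hbE (ha' b ⟨hbd, hbE⟩)) (hmem a haE c hcE (ha' c ⟨hcd, hcE⟩))
    (hmem b hbE c hcE (hb' c ⟨hca, hcd, hcE⟩)) (hK b hbE).2.1.2
    (hinc b hbE d hd hbd) (hinc c hcE a haE hca) (hinc c hcE b hbE hcb) (hinc b hbE a haE hba)

/-- There are at most `3 k` pairwise incomparable indecomposable thin modules through a state. -/
theorem card_antichain_le [Finite Q] [Fintype A] (hZ : Z.Accessible) {q : Q}
    {S : Finset (Set Q)} (hS : ∀ K ∈ S, K ∈ Z.Ind ∧ q ∈ K ∧ K ≠ {q})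
    (hinc : ∀ K ∈ S, ∀ L ∈ S, K ≠ L → ¬ K ⊆ L) : S.card ≤ 3 * Fintype.card A := by
  classical
  have h1 : ∀ K : Set Q, K ∈ S → ∃ u x j p, Z.orb x u j = some p ∧ K = Z.hull u p ∧ Z.Admits u p ∧
      ∀ l, 0 < l → l ≤ j → Z.orb x u l ≠ some u := by
    intro K hK
    obtain ⟨hKi, hqK, hKq⟩ := hS K hK
    obtain ⟨u, v, huv, rfl⟩ := exists_hull_of_mem_ind hZ hKi
    have hne : v ≠ u := by
      rintro rfl
      rw [hull_self] at hqK hKq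
      exact hKq (by rw [hqK])
    obtain ⟨x, j, p, h1, h2, h3, h4⟩ := exists_orb_hull hZ huv hne
    exact ⟨u, x, j, p, h1, h2, h3, h4⟩
  rcases S.eq_empty_or_nonempty with rfl | ⟨K₀, hK₀⟩
  · simp
  have : Nonempty Q := ⟨q⟩
  have : Nonempty A := ⟨(h1 K₀ hK₀).choose_spec.choose⟩
  choose! u x j p ho hh ha hl using h1
  have hthin : ∀ K ∈ S, Z.ThinAt (u K) K := fun K hK => by
    have := (ha K hK).thinAt
    rwa [← hh K hK] at this
  have hE : (S.image u).card ≤ 3 := by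
    have hex : ∀ e : Q, e ∈ S.image u → ∃ K ∈ S, u K = e := fun e he => Finset.mem_image.mp he
    choose! f hf hfu using hex
    refine card_entries_le hZ (q := q) f (fun e he => ⟨?_, (hS _ (hf e he)).1, (hS _ (hf e he)).2.1⟩) ?_
    · have := hthin _ (hf e he)
      rwa [hfu e he] at this
    · intro e he e' he' hne
      refine hinc _ (hf e he) _ (hf e' he') fun h => hne ?_
      rw [← hfu e he, ← hfu e' he', h]
  -- For a fixed entry and symbol, all the sets are generated by states on one walk and hence
  -- nested. So pairwise incomparable sets have different pairs of entry and symbol.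
  calc S.card ≤ (S.image u ×ˢ (Finset.univ : Finset A)).card := by
        refine Finset.card_le_card_of_injOn (fun K => (u K, x K)) (fun K hK => ?_) ?_
        · simpa using ⟨K, hK, rfl⟩
        · intro K hK L hL hKL
          have hK' := hK; have hL' := hL
          rw [Finset.mem_coe] at hK' hL'
          simp only [Prod.mk.injEq] at hKL
          by_contra hne
          rcases le_total (j K) (j L) with h | h
          · refine hinc K hK' L hL' hne ?_
            have := hull_orb_subset h (hKL.1 ▸ hKL.2 ▸ ho K hK') (ho L hL') (ha L hL') (hl L hL')
            rw [hh K hK', hh L hL', hKL.1]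
            exact this
          · refine hinc L hL' K hK' (Ne.symm hne) ?_
            have := hull_orb_subset h (hKL.1 ▸ hKL.2 ▸ ho L hL') (ho K hK') (ha K hK') (hl K hK')
            rw [hh K hK', hh L hL', ← hKL.1]
            exact this
    _ ≤ 3 * Fintype.card A := by
        rw [Finset.card_product, Finset.card_univ]
        exact Nat.mul_le_mul_right _ hE

theorem treeArc_iff (K M : Z.Ind) :
    Z.treeArc K M ↔ M.1 ⊂ K.1 ∧ ¬ ∃ L ∈ Z.Ind, M.1 ⊂ L ∧ L ⊂ K.1 := by
  have : Relation.TransGen (fun K M : Z.Ind => M.1 ⊂ K.1) = fun K M : Z.Ind => M.1 ⊂ K.1 := by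
    have : IsTrans Z.Ind (fun K M : Z.Ind => M.1 ⊂ K.1) := ⟨fun a b c h1 h2 => h2.trans h1⟩
    exact Relation.transGen_eq_self
  unfold treeArc transitiveReduction
  rw [this]
  refine and_congr_right fun _ => not_congr ⟨?_, ?_⟩
  · rintro ⟨L, h1, h2⟩; exact ⟨L.1, L.2, h2, h1⟩
  · rintro ⟨L, hL, h1, h2⟩; exact ⟨⟨L, hL⟩, h2, h1⟩

end FSM

/-! ### A small imperative language with counted loops, and its compilation -/


namespace Imp

/-- Variables. -/
inductive Var
  | n | k | s | m | bn | w | x | i | j | u | v | r | r1 | q | c | d | t | y | z | cur | rv | root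
  | ql | qi | a | b | e | f | cn | K | M
  deriving DecidableEq

/-- Arrays, with two indices. -/
inductive Arr
  | cy | dg | ad | ip | pp | vi | qu | va | ro | en | ok | ex | na | su | ca | id | ss | mk
  deriving DecidableEq

/-- Machine states; the field `t` is a clock. -/
structure St where
  v : Var → ℕ
  a : Arr → ℕ → ℕ → ℕ
  out : List ℕ
  t : ℕ

namespace St

def tick (s : St) : St := { s with t := s.t + 1 }

def setV (s : St) (x : Var) (c : ℕ) : St := { s with v := Function.update s.v x c }

def setA (s : St) (r : Arr) (i j c : ℕ) : St :=
  { s with a := fun r' i' j' => if r' = r ∧ i' = i ∧ j' = j then c else s.a r' i' j' }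

def emit (s : St) (c : ℕ) : St := { s with out := s.out ++ [c] }

@[simp] theorem tick_v (s : St) : s.tick.v = s.v := rfl
@[simp] theorem tick_a (s : St) : s.tick.a = s.a := rfl
@[simp] theorem tick_out (s : St) : s.tick.out = s.out := rfl
@[simp] theorem tick_t (s : St) : s.tick.t = s.t + 1 := rfl
@[simp] theorem setV_v (s : St) (x y : Var) (c : ℕ) :
    (s.setV x c).v y = if y = x then c else s.v y := by simp [setV, Function.update_apply]
@[simp] theorem setV_a (s : St) (x : Var) (c : ℕ) : (s.setV x c).a = s.a := rfl
@[simp] theorem setV_out (s : St) (x : Var) (c : ℕ) : (s.setV x c).out = s.out := rfl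
@[simp] theorem setV_t (s : St) (x : Var) (c : ℕ) : (s.setV x c).t = s.t := rfl
@[simp] theorem setA_v (s : St) (r : Arr) (i j c : ℕ) : (s.setA r i j c).v = s.v := rfl
@[simp] theorem setA_a (s : St) (r r' : Arr) (i j c i' j' : ℕ) :
    (s.setA r i j c).a r' i' j' = if r' = r ∧ i' = i ∧ j' = j then c else s.a r' i' j' := rfl
@[simp] theorem setA_out (s : St) (r : Arr) (i j c : ℕ) : (s.setA r i j c).out = s.out := rfl
@[simp] theorem setA_t (s : St) (r : Arr) (i j c : ℕ) : (s.setA r i j c).t = s.t := rfl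
@[simp] theorem emit_v (s : St) (c : ℕ) : (s.emit c).v = s.v := rfl
@[simp] theorem emit_a (s : St) (c : ℕ) : (s.emit c).a = s.a := rfl
@[simp] theorem emit_out (s : St) (c : ℕ) : (s.emit c).out = s.out ++ [c] := rfl
@[simp] theorem emit_t (s : St) (c : ℕ) : (s.emit c).t = s.t := rfl

end St

/-- Operands: variables and literals. -/
inductive Opd
  | var (x : Var)
  | lit (c : ℕ)

def Opd.val (s : St) : Opd → ℕ
  | .var x => s.v x
  | .lit c => c

/-- Commands. `tab` reads the transition table; `loop x o c` runs `c` for `x = 0, …, o - 1`. -/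
inductive Cmd
  | skip
  | set (x : Var) (o : Opd)
  | inc (x : Var)
  | dec (x : Var)
  | get (x : Var) (r : Arr) (o p : Opd)
  | put (r : Arr) (o p o' : Opd)
  | tab (x : Var) (o p : Opd)
  | emit (o : Opd)
  | seq (c d : Cmd)
  | ifnz (x : Var) (c d : Cmd)
  | ifeq (o p : Opd) (c d : Cmd)
  | loop (x : Var) (o : Opd) (c : Cmd)

/-- Iterate `f`, setting `x` to the number of the iteration beforehand. -/
def iter (f : St → St) (x : Var) : ℕ → St → St
  | 0, s => s
  | i + 1, s => f ((iter f x i s).setV x i).tick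

/-- Run a command, with transition table `T`. -/
def ev (T : ℕ → ℕ → ℕ) : Cmd → St → St
  | .skip, s => s.tick
  | .set x o, s => (s.setV x (o.val s)).tick
  | .inc x, s => (s.setV x (s.v x + 1)).tick
  | .dec x, s => (s.setV x (s.v x - 1)).tick
  | .get x r o p, s => (s.setV x (s.a r (o.val s) (p.val s))).tick
  | .put r o p o', s => (s.setA r (o.val s) (p.val s) (o'.val s)).tick
  | .tab x o p, s => (s.setV x (T (o.val s) (p.val s))).tick
  | .emit o, s => (s.emit (o.val s)).tick
  | .seq c d, s => ev T d (ev T c s)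
  | .ifnz x c d, s => if s.v x ≠ 0 then ev T c s.tick else ev T d s.tick
  | .ifeq o p c d, s => if o.val s = p.val s then ev T c s.tick else ev T d s.tick
  | .loop x o c, s => ((iter (ev T c) x (o.val s) s.tick).setV x (o.val s)).tick

/-- The command may change the variable. -/
def Cmd.modV (y : Var) : Cmd → Bool
  | .set x _ | .inc x | .dec x | .get x _ _ _ | .tab x _ _ => x = y
  | .seq c d | .ifnz _ c d | .ifeq _ _ c d => c.modV y || d.modV y
  | .loop x _ c => (x = y : Bool) || c.modV y
  | _ => false

/-- The command may change the array. -/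
def Cmd.modA (r' : Arr) : Cmd → Bool
  | .put r _ _ _ => r = r'
  | .seq c d | .ifnz _ c d | .ifeq _ _ c d => c.modA r' || d.modA r'
  | .loop _ _ c => c.modA r'
  | _ => false

/-- The command may emit. -/
def Cmd.emits : Cmd → Bool
  | .emit _ => true
  | .seq c d | .ifnz _ c d | .ifeq _ _ c d => c.emits || d.emits
  | .loop _ _ c => c.emits
  | _ => false

/-- The bodies of loops change neither the counter nor the bound. -/
def Cmd.wf : Cmd → Bool
  | .seq c d | .ifnz _ c d | .ifeq _ _ c d => c.wf && d.wf
  | .loop x (.var y) c => !(x = y : Bool) && !c.modV x && !c.modV y && c.wf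
  | .loop x (.lit _) c => !c.modV x && c.wf
  | _ => true

variable {T : ℕ → ℕ → ℕ}

theorem ev_v {c : Cmd} {y : Var} (h : c.modV y = false) (s : St) : (ev T c s).v y = s.v y := by
  induction c generalizing s with
  | skip | put | emit => rfl
  | set | inc | dec | get | tab =>
    simp only [Cmd.modV, decide_eq_false_iff_not] at h
    simp [ev, Ne.symm h]
  | seq c d ihc ihd =>
    simp only [Cmd.modV, Bool.or_eq_false_iff] at h
    simp [ev, ihd h.2, ihc h.1]
  | ifnz x c d ihc ihd | ifeq o p c d ihc ihd =>
    simp only [Cmd.modV, Bool.or_eq_false_iff] at h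
    simp only [ev]
    split <;> simp [ihd h.2, ihc h.1]
  | loop x o c ih =>
    simp only [Cmd.modV, Bool.or_eq_false_iff, decide_eq_false_iff_not] at h
    have : ∀ N (s : St), (iter (ev T c) x N s).v y = s.v y := by
      intro N
      induction N with
      | zero => intro s; rfl
      | succ N ihN => intro s; simp [iter, ih h.2, Ne.symm h.1, ihN]
    simp [ev, Ne.symm h.1, this]

theorem ev_a {c : Cmd} {r : Arr} (h : c.modA r = false) (s : St) : (ev T c s).a r = s.a r := by
  induction c generalizing s with
  | skip | emit | set | inc | dec | get | tab => rfl
  | put =>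
    simp only [Cmd.modA, decide_eq_false_iff_not] at h
    funext i j
    simp [ev, Ne.symm h]
  | seq c d ihc ihd =>
    simp only [Cmd.modA, Bool.or_eq_false_iff] at h
    simp [ev, ihd h.2, ihc h.1]
  | ifnz x c d ihc ihd | ifeq o p c d ihc ihd =>
    simp only [Cmd.modA, Bool.or_eq_false_iff] at h
    simp only [ev]
    split <;> simp [ihd h.2, ihc h.1]
  | loop x o c ih =>
    have : ∀ N (s : St), (iter (ev T c) x N s).a r = s.a r := by
      intro N
      induction N with
      | zero => intro s; rfl
      | succ N ihN => intro s; simp [iter, ih h, ihN]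
    simp [ev, this]

theorem ev_out {c : Cmd} (h : c.emits = false) (s : St) : (ev T c s).out = s.out := by
  induction c generalizing s with
  | skip | set | inc | dec | get | tab | put => rfl
  | emit => simp [Cmd.emits] at h
  | seq c d ihc ihd =>
    simp only [Cmd.emits, Bool.or_eq_false_iff] at h
    simp [ev, ihd h.2, ihc h.1]
  | ifnz x c d ihc ihd | ifeq o p c d ihc ihd =>
    simp only [Cmd.emits, Bool.or_eq_false_iff] at h
    simp only [ev]
    split <;> simp [ihd h.2, ihc h.1]
  | loop x o c ih =>
    have : ∀ N (s : St), (iter (ev T c) x N s).out = s.out := by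
      intro N
      induction N with
      | zero => intro s; rfl
      | succ N ihN => intro s; simp [iter, ih h, ihN]
    simp [ev, this]

theorem le_iter_t {f : St → St} (hf : ∀ s, s.t ≤ (f s).t) (x : Var) (N : ℕ) (s : St) :
    s.t ≤ (iter f x N s).t := by
  induction N with
  | zero => exact le_rfl
  | succ N ih =>
    refine ih.trans ?_
    exact (Nat.le_succ _).trans (hf ((iter f x N s).setV x N).tick)

theorem le_ev_t (c : Cmd) (s : St) : s.t ≤ (ev T c s).t := by
  induction c generalizing s with
  | skip | set | inc | dec | get | tab | put | emit => exact Nat.le_succ _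
  | seq c d ihc ihd => exact (ihc s).trans (ihd _)
  | ifnz x c d ihc ihd | ifeq o p c d ihc ihd =>
    simp only [ev]
    split
    · exact (Nat.le_succ _).trans (ihc s.tick)
    · exact (Nat.le_succ _).trans (ihd s.tick)
  | loop x o c ih =>
    have := le_iter_t (f := ev T c) ih x (o.val s) s.tick
    simp only [ev, St.tick_t, St.setV_t] at *
    omega

/-- The loop rule. -/
theorem iter_rule {f : St → St} {x : Var} {N : ℕ} {s : St} (I : ℕ → St → Prop) (h0 : I 0 s)
    (h1 : ∀ i s', i < N → I i s' → I (i + 1) (f (s'.setV x i).tick)) : I N (iter f x N s) := by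
  have : ∀ i ≤ N, I i (iter f x i s) := by
    intro i hi
    induction i with
    | zero => exact h0
    | succ i ih => exact h1 i _ (by omega) (ih (by omega))
  exact this N le_rfl

/-! ### Compilation -/

/-- The number of a variable. -/
def Var.code (x : Var) : ℕ := x.ctorIdx

/-- The number of an array. -/
def Arr.code (r : Arr) : ℕ := r.ctorIdx

theorem Var.code_injective : Function.Injective Var.code := by
  intro x y h
  cases x <;> cases y <;> first | rfl | (simp [Var.code, Var.ctorIdx] at h)

theorem Arr.code_injective : Function.Injective Arr.code := by
  intro x y h
  cases x <;> cases y <;> first | rfl | (simp [Arr.code, Arr.ctorIdx] at h)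

theorem Arr.code_lt (r : Arr) : r.code < 20 := by
  cases r <;> decide

end Imp

namespace Imp

open RAM

/-- The register of a variable. The registers `0`, `5`, `6`, `7` hold the end of the input, `0`, and
the numbers of states and of symbols; the registers `1`, …, `4` are for temporary values. -/
def reg (x : Var) : ℕ := 8 + x.code

def load (d : ℕ) : Opd → Prog
  | .var x => .add d (reg x) 5
  | .lit c => .const d c

/-- Put the address of an array entry into register `1`. -/
def addr (r : Arr) (o p : Opd) : Prog :=
  .seq (load 1 o) <| .seq (load 2 p) <| .seq (.add 1 1 2) <| .seq (.mul 1 1 1) <|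
  .seq (.add 1 1 2) <| .seq (.const 3 20) <| .seq (.mul 1 1 3) <| .seq (.const 3 r.code) <|
  .seq (.add 1 1 3) (.add 1 1 0)

/-- In the code of a loop, register `3` holds the number of iterations that remain. A table access
tests its indices first, because an address computed from indices out of range would point to some
other cell; such an access yields 0. -/
def comp : Cmd → Prog
  | .skip => .skip
  | .set x o => load (reg x) o
  | .inc x => .seq (.const 1 1) (.add (reg x) (reg x) 1)
  | .dec x => .seq (.const 1 1) (.sub (reg x) (reg x) 1)
  | .get x r o p => .seq (addr r o p) (.load (reg x) 1)
  | .put r o p o' => .seq (addr r o p) (.seq (load 2 o') (.store 1 2))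
  | .tab x o p => .seq (load 1 o) <| .seq (load 2 p) <| .seq (.sub 3 6 1) <|
      .cond 3 (.seq (.sub 3 7 2) <| .cond 3 (.seq (.mul 1 1 7) <| .seq (.add 1 1 2) <|
        .seq (.const 3 3) <| .seq (.add 1 1 3) (.load (reg x) 1)) (.const (reg x) 0))
        (.const (reg x) 0)
  | .emit o => .seq (load 1 o) (.emit 1)
  | .seq c d => .seq (comp c) (comp d)
  | .ifnz x c d => .cond (reg x) (comp c) (comp d)
  | .ifeq o p c d => .seq (load 1 o) <| .seq (load 2 p) <| .seq (.sub 3 1 2) <|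
      .seq (.sub 4 2 1) <| .seq (.add 3 3 4) <| .cond 3 (comp d) (comp c)
  | .loop x o c => .seq (.const (reg x) 0) <| .seq (load 1 o) <| .seq (.sub 3 1 (reg x)) <|
      .loop 3 (.seq (comp c) <| .seq (.const 1 1) <| .seq (.add (reg x) (reg x) 1) <|
        .seq (load 1 o) (.sub 3 1 (reg x)))

/-- All literals in the command are at most `B`. -/
def Opd.litLe (B : ℕ) : Opd → Bool
  | .var _ => true
  | .lit c => c ≤ B

def Cmd.litLe (B : ℕ) : Cmd → Bool
  | .set _ o | .emit o => o.litLe B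
  | .get _ _ o p | .tab _ o p => o.litLe B && p.litLe B
  | .put _ o p o' => o.litLe B && p.litLe B && o'.litLe B
  | .seq c d | .ifnz _ c d => c.litLe B && d.litLe B
  | .ifeq o p c d => o.litLe B && p.litLe B && c.litLe B && d.litLe B
  | .loop _ o c => o.litLe B && c.litLe B
  | _ => true

/-- The numbers in a state exceed `B` by at most the running time. -/
structure Bounded (B : ℕ) (s : St) : Prop where
  v : ∀ x, s.v x ≤ B + s.t
  a : ∀ r i j, s.a r i j ≤ B + s.t

/-- The address of an array entry. -/
def pos (base : ℕ) (r : Arr) (i j : ℕ) : ℕ := ((i + j) * (i + j) + j) * 20 + r.code + base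

/-- Since `j ≤ i + j`, the number `(i + j)² + j` lies below the next square and determines `i + j`
and `j`. The factor 20 leaves room for the number of the array. -/
theorem pos_inj {base : ℕ} {r r' : Arr} {i j i' j' : ℕ} :
    pos base r i j = pos base r' i' j' ↔ r = r' ∧ i = i' ∧ j = j' := by
  constructor
  · intro h
    unfold pos at h
    have h1 := r.code_lt
    have h2 := r'.code_lt
    have h3 : r.code = r'.code := by omega
    have h4 : (i + j) * (i + j) + j = (i' + j') * (i' + j') + j' := by omega
    have h5 : i + j = i' + j' := by
      rcases lt_trichotomy (i + j) (i' + j') with h | h | h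
      · nlinarith
      · exact h
      · nlinarith
    rw [h5] at h4
    exact ⟨Arr.code_injective h3, by omega, by omega⟩
  · rintro ⟨rfl, rfl, rfl⟩; rfl

/-- The store represents the state. -/
structure Rep (n k : ℕ) (T : ℕ → ℕ → ℕ) (s : St) (σ : Store) : Prop where
  base : σ.reg 0 = 3 + n * k
  zero : σ.reg 5 = 0
  hn : σ.reg 6 = n
  hk : σ.reg 7 = k
  v : ∀ x, σ.reg (reg x) = s.v x
  a : ∀ r i j, σ.mem (pos (3 + n * k) r i j) = s.a r i j
  tab : ∀ i j, i < n → j < k → σ.mem (i * k + j + 3) = T i j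
  out : σ.out = s.out

section

variable {n k : ℕ} {T : ℕ → ℕ → ℕ} {s : St} {σ : Store} {B D W : ℕ}

theorem reg_inj {x y : Var} : reg x = reg y ↔ x = y := by
  unfold reg
  constructor
  · intro h; exact Var.code_injective (by omega)
  · rintro rfl; rfl

theorem reg_ge (x : Var) : 8 ≤ reg x := by unfold reg; omega

theorem Rep.setTemp (h : Rep n k T s σ) {d : ℕ} (hd : 1 ≤ d ∧ d ≤ 4) (c : ℕ) :
    Rep n k T s (σ.setReg d c) := by
  have : ∀ e, (e = 0 ∨ 5 ≤ e) → (σ.setReg d c).reg e = σ.reg e := by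
    intro e he
    simp only [Store.setReg, Function.update_apply]
    rw [if_neg (by omega)]
  exact ⟨by rw [this _ (by omega)]; exact h.base, by rw [this _ (by omega)]; exact h.zero,
    by rw [this _ (by omega)]; exact h.hn, by rw [this _ (by omega)]; exact h.hk,
    fun x => by rw [this _ (by have := reg_ge x; omega)]; exact h.v x, h.a, h.tab, h.out⟩

theorem Rep.tick (h : Rep n k T s σ) : Rep n k T s.tick σ :=
  ⟨h.base, h.zero, h.hn, h.hk, h.v, h.a, h.tab, h.out⟩

theorem Rep.setVar (h : Rep n k T s σ) (x : Var) (c : ℕ) :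
    Rep n k T (s.setV x c) (σ.setReg (reg x) c) := by
  have : ∀ e, e < 8 → (σ.setReg (reg x) c).reg e = σ.reg e := by
    intro e he
    simp only [Store.setReg, Function.update_apply]
    rw [if_neg (by have := reg_ge x; omega)]
  refine ⟨by rw [this _ (by omega)]; exact h.base, by rw [this _ (by omega)]; exact h.zero,
    by rw [this _ (by omega)]; exact h.hn, by rw [this _ (by omega)]; exact h.hk,
    fun y => ?_, h.a, h.tab, h.out⟩
  simp only [Store.setReg, Function.update_apply, reg_inj, St.setV_v, h.v]

/-- Array entries lie behind the input, which ends at `3 + n * k`, so the table is never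
overwritten. -/
theorem Rep.setMem (h : Rep n k T s σ) (r : Arr) (i j c : ℕ) :
    Rep n k T (s.setA r i j c) (σ.setMem (pos (3 + n * k) r i j) c) := by
  refine ⟨h.base, h.zero, h.hn, h.hk, h.v, fun r' i' j' => ?_, fun i' j' hi hj => ?_, h.out⟩
  · simp only [Store.setMem, Function.update_apply, pos_inj, St.setA_a, h.a]
  · have : i' * k + j' + 3 ≠ pos (3 + n * k) r i j := by
      have h1 : i' * k + k ≤ n * k := by
        have := Nat.mul_le_mul_right k (Nat.succ_le_of_lt hi)
        rwa [Nat.succ_mul] at this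
      unfold pos
      omega
    simp only [Store.setMem, Function.update_apply, if_neg this]
    exact h.tab i' j' hi hj

theorem Rep.emit (h : Rep n k T s σ) (c : ℕ) : Rep n k T (s.emit c) (σ.emit c) :=
  ⟨h.base, h.zero, h.hn, h.hk, h.v, h.a, h.tab, by simp [Store.emit, h.out]⟩

theorem Bounded.tick (h : Bounded B s) : Bounded B s.tick :=
  ⟨fun x => (h.v x).trans (by simp), fun r i j => (h.a r i j).trans (by simp)⟩

/-- One command raises the largest value by at most 1 and takes at least one unit of time. So a
bound on the running time also bounds all numbers, and the word size needs no separate analysis. -/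
theorem Bounded.setV (h : Bounded B s) {x : Var} {c : ℕ} (hc : c ≤ B + s.t + 1) :
    Bounded B (s.setV x c).tick := by
  refine ⟨fun y => ?_, fun r i j => (h.a r i j).trans (by simp)⟩
  simp only [St.tick_v, St.setV_v, St.tick_t, St.setV_t]
  split
  · omega
  · exact (h.v y).trans (by omega)

theorem Bounded.setA (h : Bounded B s) {r : Arr} {i j c : ℕ} (hc : c ≤ B + s.t + 1) :
    Bounded B (s.setA r i j c).tick := by
  refine ⟨fun y => (h.v y).trans (by simp), fun r' i' j' => ?_⟩
  simp only [St.tick_a, St.setA_a, St.tick_t, St.setA_t]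
  split
  · omega
  · exact (h.a r' i' j').trans (by omega)

theorem Bounded.val (h : Bounded B s) {o : Opd} (ho : o.litLe B = true) : o.val s ≤ B + s.t := by
  cases o with
  | var x => exact h.v x
  | lit c => simp only [Opd.litLe, decide_eq_true_eq] at ho; simp only [Opd.val]; omega

theorem exec_load (hR : Rep n k T s σ) {o : Opd} (ho : o.val s < W) (d : ℕ) :
    Exec W (load d o) σ (σ.setReg d (o.val s)) 1 := by
  cases o with
  | var x =>
    have h := Exec.add (W := W) σ d (reg x) 5 (by rw [hR.v, hR.zero]; exact ho)
    rw [hR.v, hR.zero] at h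
    exact h
  | lit c => exact Exec.const σ d c ho

/-- The bound on `W` covers the largest intermediate result when both indices are at most `D`; then
`(i + j)²` is at most `4 * D * D`. -/
theorem exec_addr (hR : Rep n k T s σ) {o p : Opd} (r : Arr) (ho : o.val s ≤ D) (hp : p.val s ≤ D)
    (hW : (4 * D * D + D) * 20 + 20 + (3 + n * k) + 2 * D < W) :
    ∃ σ', Exec W (addr r o p) σ σ' 10 ∧ σ'.reg 1 = pos (3 + n * k) r (o.val s) (p.val s) ∧
      Rep n k T s σ' := by
  set i := o.val s with hi
  set j := p.val s with hj
  have hr := r.code_lt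
  have hsq : (i + j) * (i + j) ≤ 4 * D * D := by nlinarith
  have h1 := exec_load (W := W) hR (o := o) (by omega) 1
  have hR1 := hR.setTemp (d := 1) (by omega) (o.val s)
  have h2 := exec_load (W := W) hR1 (o := p) (by omega) 2
  have hR2 := hR1.setTemp (d := 2) (by omega) (p.val s)
  refine ⟨_, .seq h1 <| .seq h2 <| .seq (.add _ _ _ _ ?_) <| .seq (.mul _ _ _ _ ?_) <|
    .seq (.add _ _ _ _ ?_) <| .seq (.const _ _ _ (by omega)) <| .seq (.mul _ _ _ _ ?_) <|
    .seq (.const _ _ _ (by omega)) <| .seq (.add _ _ _ _ ?_) (.add _ _ _ _ ?_), ?_, ?_⟩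
  all_goals try simp only [Store.setReg, Function.update_apply]
  all_goals try simp +decide only [if_true, if_false, hR.base, ← hi, ← hj]
  · omega
  · omega
  · omega
  · omega
  · omega
  · omega
  · rfl
  · exact ((((((((hR2.setTemp (d := 1) (by omega) _).setTemp (d := 1) (by omega) _).setTemp (d := 1)
      (by omega) _).setTemp (d := 3) (by omega) _).setTemp (d := 1) (by omega) _).setTemp (d := 3)
      (by omega) _).setTemp (d := 1) (by omega) _).setTemp (d := 1) (by omega) _)

theorem exec_tab (hR : Rep n k T s σ) {o p : Opd} (x : Var) (ho : o.val s < W) (hp : p.val s < W)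
    (hT : ∀ i j, ¬ (i < n ∧ j < k) → T i j = 0) (hTB : ∀ i j, T i j < W)
    (hW : n * k + n + k + 3 < W) :
    ∃ σ' τ, Exec W (comp (.tab x o p)) σ σ' τ ∧ τ ≤ 12 ∧
      Rep n k T (s.setV x (T (o.val s) (p.val s))) σ' := by
  set i := o.val s with hi
  set j := p.val s with hj
  have h1 := exec_load (W := W) hR (o := o) ho 1
  have hR1 := hR.setTemp (d := 1) (by omega) (o.val s)
  have h2 := exec_load (W := W) hR1 (o := p) hp 2
  have hR2 := hR1.setTemp (d := 2) (by omega) (p.val s)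
  rw [← hi] at h1 h2 hR1 hR2
  rw [← hj] at h2 hR2
  set σ2 := (σ.setReg 1 i).setReg 2 j with hσ2
  have e1 : σ2.reg 1 = i := by simp [hσ2, Store.setReg]
  have e2 : σ2.reg 2 = j := by simp [hσ2, Store.setReg]
  have h3 := Exec.sub (W := W) σ2 3 6 1 (by rw [hR2.hn]; omega)
  rw [hR2.hn, e1] at h3
  have hR3 := hR2.setTemp (d := 3) (by omega) (n - i)
  set σ3 := σ2.setReg 3 (n - i) with hσ3
  have e13 : σ3.reg 1 = i := by rw [hσ3]; simp [Store.setReg, e1]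
  have e23 : σ3.reg 2 = j := by rw [hσ3]; simp [Store.setReg, e2]
  by_cases hin : i < n
  · have h4 := Exec.sub (W := W) σ3 3 7 2 (by rw [hR3.hk]; omega)
    rw [hR3.hk, e23] at h4
    have hR4 := hR3.setTemp (d := 3) (by omega) (k - j)
    set σ4 := σ3.setReg 3 (k - j) with hσ4
    have e14 : σ4.reg 1 = i := by rw [hσ4]; simp [Store.setReg, e13]
    have e24 : σ4.reg 2 = j := by rw [hσ4]; simp [Store.setReg, e23]
    by_cases hjk : j < k
    · have hlt : i * k + k ≤ n * k := by
        have := Nat.mul_le_mul_right k (Nat.succ_le_of_lt hin)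
        rwa [Nat.succ_mul] at this
      have h5 := Exec.mul (W := W) σ4 1 1 7 (by rw [hR4.hk, e14]; omega)
      rw [hR4.hk, e14] at h5
      have hR5 := hR4.setTemp (d := 1) (by omega) (i * k)
      set σ5 := σ4.setReg 1 (i * k) with hσ5
      have e15 : σ5.reg 1 = i * k := by simp [hσ5, Store.setReg]
      have e25 : σ5.reg 2 = j := by rw [hσ5]; simp [Store.setReg, e24]
      have h6 := Exec.add (W := W) σ5 1 1 2 (by rw [e15, e25]; omega)
      rw [e15, e25] at h6
      have hR6 := hR5.setTemp (d := 1) (by omega) (i * k + j)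
      set σ6 := σ5.setReg 1 (i * k + j) with hσ6
      have e16 : σ6.reg 1 = i * k + j := by simp [hσ6, Store.setReg]
      have h7 := Exec.const (W := W) σ6 3 3 (by omega)
      have hR7 := hR6.setTemp (d := 3) (by omega) 3
      set σ7 := σ6.setReg 3 3 with hσ7
      have e17 : σ7.reg 1 = i * k + j := by rw [hσ7]; simp [Store.setReg, e16]
      have e37 : σ7.reg 3 = 3 := by simp [hσ7, Store.setReg]
      have h8 := Exec.add (W := W) σ7 1 1 3 (by rw [e17, e37]; omega)
      rw [e17, e37] at h8
      have hR8 := hR7.setTemp (d := 1) (by omega) (i * k + j + 3)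
      set σ8 := σ7.setReg 1 (i * k + j + 3) with hσ8
      have e18 : σ8.reg 1 = i * k + j + 3 := by simp [hσ8, Store.setReg]
      have h9 := Exec.load (W := W) σ8 (reg x) 1 (by rw [e18, hR8.tab i j hin hjk]; exact hTB i j)
      rw [e18, hR8.tab i j hin hjk] at h9
      exact ⟨_, _, .seq h1 <| .seq h2 <| .seq h3 <| .cond_true (by simp [hσ3, Store.setReg]; omega) <|
        .seq h4 <| .cond_true (by simp [hσ4, Store.setReg]; omega) <| .seq h5 <| .seq h6 <|
        .seq h7 <| .seq h8 h9, by omega, hR8.setVar x _⟩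
    · refine ⟨_, _, .seq h1 <| .seq h2 <| .seq h3 <| .cond_true (by simp [hσ3, Store.setReg]; omega) <|
        .seq h4 <| .cond_false (by simp [hσ4, Store.setReg]; omega) <| .const _ _ 0 (by omega),
        by omega, ?_⟩
      rw [hT i j (by omega)]
      exact hR4.setVar x _
  · refine ⟨_, _, .seq h1 <| .seq h2 <| .seq h3 <| .cond_false (by simp [hσ3, Store.setReg]; omega) <|
      .const _ _ 0 (by omega), by omega, ?_⟩
    rw [hT i j (by omega)]
    exact hR3.setVar x _

end

theorem Opd.val_of_wf {s s' : St} {o : Opd} (h : ∀ y, o = .var y → s'.v y = s.v y) :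
    o.val s' = o.val s := by
  cases o with
  | var x => exact h x rfl
  | lit c => rfl

/-- Compilation is correct, and costs a constant factor. -/
theorem exec_comp {n k : ℕ} {T : ℕ → ℕ → ℕ} {B E W : ℕ}
    (hT : ∀ i j, ¬ (i < n ∧ j < k) → T i j = 0) (hTB : ∀ i j, T i j ≤ B) (hB : n ≤ B ∧ k ≤ B)
    (hW : (4 * (B + E) * (B + E) + (B + E)) * 20 + 20 + (3 + n * k) + 2 * (B + E) < W)
    (c : Cmd) (hwf : c.wf = true) (hlit : c.litLe B = true) (s : St) (σ : Store)
    (hR : Rep n k T s σ) (hb : Bounded B s) (hE : (ev T c s).t ≤ E) :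
    ∃ σ' τ, Exec W (comp c) σ σ' τ ∧ Rep n k T (ev T c s) σ' ∧ τ + 12 * s.t ≤ 12 * (ev T c s).t ∧
      Bounded B (ev T c s) := by
  have hnk : n * k + n + k + 3 < W := by omega
  induction c generalizing s σ with
  | skip =>
    exact ⟨σ, 1, .skip σ, hR.tick, by simp only [ev, St.tick_t]; omega, hb.tick⟩
  | set x o =>
    have ho := hb.val hlit
    simp only [ev, St.tick_t, St.setV_t] at hE
    exact ⟨_, 1, exec_load hR (by omega) _, (hR.setVar x _).tick,
      by simp only [ev, St.tick_t, St.setV_t]; omega, hb.setV (by omega)⟩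
  | inc x =>
    have hx := hb.v x
    simp only [ev, St.tick_t, St.setV_t] at hE
    have hR1 := hR.setTemp (d := 1) (by omega) 1
    have h2 := Exec.add (W := W) (σ.setReg 1 1) (reg x) (reg x) 1
    rw [hR1.v] at h2
    rw [show (σ.setReg 1 1).reg 1 = 1 by simp [Store.setReg]] at h2
    exact ⟨_, _, .seq (.const σ 1 1 (by omega)) (h2 (by omega)), (hR1.setVar x _).tick,
      by simp only [ev, St.tick_t, St.setV_t]; omega, hb.setV (by omega)⟩
  | dec x =>
    have hx := hb.v x
    simp only [ev, St.tick_t, St.setV_t] at hE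
    have hR1 := hR.setTemp (d := 1) (by omega) 1
    have h2 := Exec.sub (W := W) (σ.setReg 1 1) (reg x) (reg x) 1
    rw [hR1.v] at h2
    rw [show (σ.setReg 1 1).reg 1 = 1 by simp [Store.setReg]] at h2
    exact ⟨_, _, .seq (.const σ 1 1 (by omega)) (h2 (by omega)), (hR1.setVar x _).tick,
      by simp only [ev, St.tick_t, St.setV_t]; omega, hb.setV (by omega)⟩
  | get x r o p =>
    simp only [Cmd.litLe, Bool.and_eq_true] at hlit
    have ho := hb.val hlit.1
    have hp := hb.val hlit.2
    have ha := hb.a r (o.val s) (p.val s)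
    simp only [ev, St.tick_t, St.setV_t] at hE
    obtain ⟨σ', h1, h2, h3⟩ := exec_addr (D := B + E) hR r (o := o) (p := p) (by omega) (by omega) hW
    have h4 := Exec.load (W := W) σ' (reg x) 1
    rw [h2, h3.a] at h4
    exact ⟨_, _, .seq h1 (h4 (by omega)), (h3.setVar x _).tick,
      by simp only [ev, St.tick_t, St.setV_t]; omega, hb.setV (by omega)⟩
  | put r o p o' =>
    simp only [Cmd.litLe, Bool.and_eq_true] at hlit
    have ho := hb.val hlit.1.1
    have hp := hb.val hlit.1.2
    have ho' := hb.val hlit.2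
    simp only [ev, St.tick_t, St.setA_t] at hE
    obtain ⟨σ', h1, h2, h3⟩ := exec_addr (D := B + E) hR r (o := o) (p := p) (by omega) (by omega) hW
    have h4 := exec_load (W := W) h3 (o := o') (by omega) 2
    have h5 := Exec.store (W := W) (σ'.setReg 2 (o'.val s)) 1 2
    have e1 : (σ'.setReg 2 (o'.val s)).reg 1 = pos (3 + n * k) r (o.val s) (p.val s) := by
      rw [← h2]; simp [Store.setReg]
    rw [e1, show (σ'.setReg 2 (o'.val s)).reg 2 = o'.val s by simp [Store.setReg]] at h5
    exact ⟨_, _, .seq h1 (.seq h4 (h5 (by omega))),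
      ((h3.setTemp (d := 2) (by omega) _).setMem r _ _ _).tick,
      by simp only [ev, St.tick_t, St.setA_t]; omega, hb.setA (by omega)⟩
  | tab x o p =>
    simp only [Cmd.litLe, Bool.and_eq_true] at hlit
    have ho := hb.val hlit.1
    have hp := hb.val hlit.2
    have ha := hTB (o.val s) (p.val s)
    simp only [ev, St.tick_t, St.setV_t] at hE
    obtain ⟨σ', τ, h1, h2, h3⟩ := exec_tab hR x (o := o) (p := p) (W := W) (by omega) (by omega) hT
      (fun i j => (hTB i j).trans_lt (by omega)) hnk
    exact ⟨σ', τ, h1, h3.tick, by simp only [ev, St.tick_t, St.setV_t]; omega, hb.setV (by omega)⟩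
  | emit o =>
    have ho := hb.val (o := o) hlit
    simp only [ev, St.tick_t, St.emit_t] at hE
    have h1 := exec_load (W := W) hR (o := o) (by omega) 1
    have h2 := Exec.emit (W := W) (σ.setReg 1 (o.val s)) 1
    rw [show (σ.setReg 1 (o.val s)).reg 1 = o.val s by simp [Store.setReg]] at h2
    exact ⟨_, _, .seq h1 h2, ((hR.setTemp (d := 1) (by omega) _).emit _).tick,
      by simp only [ev, St.tick_t, St.emit_t]; omega,
      ⟨fun x => (hb.v x).trans (by simp [ev]), fun r i j => (hb.a r i j).trans (by simp [ev])⟩⟩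
  | seq c d ihc ihd =>
    simp only [Cmd.litLe, Cmd.wf, Bool.and_eq_true] at hlit hwf
    have hd := le_ev_t (T := T) d (ev T c s)
    simp only [ev] at hE
    obtain ⟨σ1, τ1, h1, hR1, ht1, hb1⟩ := ihc hwf.1 hlit.1 s σ hR hb (by omega)
    obtain ⟨σ2, τ2, h2, hR2, ht2, hb2⟩ := ihd hwf.2 hlit.2 _ σ1 hR1 hb1 hE
    exact ⟨σ2, _, .seq h1 h2, hR2, by simp only [ev]; omega, hb2⟩
  | ifnz x c d ihc ihd =>
    simp only [Cmd.litLe, Cmd.wf, Bool.and_eq_true] at hlit hwf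
    by_cases hx : s.v x ≠ 0
    · simp only [ev, if_pos hx] at hE ⊢
      obtain ⟨σ1, τ1, h1, hR1, ht1, hb1⟩ := ihc hwf.1 hlit.1 s.tick σ hR.tick hb.tick hE
      exact ⟨σ1, _, .cond_true (by rw [hR.v]; exact hx) h1, hR1,
        by simp only [St.tick_t] at ht1; omega, hb1⟩
    · simp only [ev, if_neg hx] at hE ⊢
      obtain ⟨σ1, τ1, h1, hR1, ht1, hb1⟩ := ihd hwf.2 hlit.2 s.tick σ hR.tick hb.tick hE
      exact ⟨σ1, _, .cond_false (by rw [hR.v]; exact not_not.mp hx) h1, hR1,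
        by simp only [St.tick_t] at ht1; omega, hb1⟩
  | ifeq o p c d ihc ihd =>
    simp only [Cmd.litLe, Cmd.wf, Bool.and_eq_true] at hlit hwf
    have ho := hb.val hlit.1.1.1
    have hp := hb.val hlit.1.1.2
    have hst : s.t ≤ E := (le_ev_t _ s).trans hE
    have h1 := exec_load (W := W) hR (o := o) (by omega) 1
    have hR1 := hR.setTemp (d := 1) (by omega) (o.val s)
    have h2 := exec_load (W := W) hR1 (o := p) (by omega) 2
    have hR2 := hR1.setTemp (d := 2) (by omega) (p.val s)
    set σ2 := (σ.setReg 1 (o.val s)).setReg 2 (p.val s) with hσ2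
    have e1 : σ2.reg 1 = o.val s := by simp [hσ2, Store.setReg]
    have e2 : σ2.reg 2 = p.val s := by simp [hσ2, Store.setReg]
    have h3 := Exec.sub (W := W) σ2 3 1 2 (by rw [e1, e2]; omega)
    rw [e1, e2] at h3
    have hR3 := hR2.setTemp (d := 3) (by omega) (o.val s - p.val s)
    set σ3 := σ2.setReg 3 (o.val s - p.val s) with hσ3
    have e13 : σ3.reg 1 = o.val s := by rw [hσ3]; simp [Store.setReg, e1]
    have e23 : σ3.reg 2 = p.val s := by rw [hσ3]; simp [Store.setReg, e2]
    have e33 : σ3.reg 3 = o.val s - p.val s := by simp [hσ3, Store.setReg]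
    have h4 := Exec.sub (W := W) σ3 4 2 1 (by rw [e13, e23]; omega)
    rw [e13, e23] at h4
    have hR4 := hR3.setTemp (d := 4) (by omega) (p.val s - o.val s)
    set σ4 := σ3.setReg 4 (p.val s - o.val s) with hσ4
    have e34 : σ4.reg 3 = o.val s - p.val s := by rw [hσ4]; simp [Store.setReg, e33]
    have e44 : σ4.reg 4 = p.val s - o.val s := by simp [hσ4, Store.setReg]
    have h5 := Exec.add (W := W) σ4 3 3 4 (by rw [e34, e44]; omega)
    rw [e34, e44] at h5
    have hR5 := hR4.setTemp (d := 3) (by omega) (o.val s - p.val s + (p.val s - o.val s))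
    have e35 : (σ4.setReg 3 (o.val s - p.val s + (p.val s - o.val s))).reg 3 =
      o.val s - p.val s + (p.val s - o.val s) := by simp [Store.setReg]
    by_cases hx : o.val s = p.val s
    · simp only [ev, if_pos hx] at hE ⊢
      obtain ⟨σ1, τ1, h6, hR6, ht6, hb6⟩ := ihc hwf.1 hlit.1.2 s.tick _ hR5.tick hb.tick hE
      exact ⟨σ1, _, .seq h1 <| .seq h2 <| .seq h3 <| .seq h4 <| .seq h5 <|
        .cond_false (by rw [e35]; omega) h6, hR6, by simp only [St.tick_t] at ht6; omega, hb6⟩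
    · simp only [ev, if_neg hx] at hE ⊢
      obtain ⟨σ1, τ1, h6, hR6, ht6, hb6⟩ := ihd hwf.2 hlit.2 s.tick _ hR5.tick hb.tick hE
      exact ⟨σ1, _, .seq h1 <| .seq h2 <| .seq h3 <| .seq h4 <| .seq h5 <|
        .cond_true (by rw [e35]; omega) h6, hR6, by simp only [St.tick_t] at ht6; omega, hb6⟩
  | loop x o c ih =>
    obtain ⟨hox, hxc, hoc, hwfc⟩ : (∀ y, o = .var y → y ≠ x) ∧ c.modV x = false ∧
        (∀ y, o = .var y → c.modV y = false) ∧ c.wf = true := by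
      cases o with
      | var y =>
        simp only [Cmd.wf, Bool.and_eq_true, Bool.not_eq_true', decide_eq_false_iff_not] at hwf
        refine ⟨?_, hwf.1.1.2, ?_, hwf.2⟩
        · rintro _ ⟨⟩; exact Ne.symm hwf.1.1.1
        · rintro _ ⟨⟩; exact hwf.1.2
      | lit m =>
        simp only [Cmd.wf, Bool.and_eq_true, Bool.not_eq_true'] at hwf
        exact ⟨fun _ h => by simp at h, hwf.1, fun _ h => by simp at h, hwf.2⟩
    simp only [Cmd.litLe, Bool.and_eq_true] at hlit
    have ho := hb.val hlit.1
    set N := o.val s with hN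
    set J : ℕ → St := fun i => iter (ev T c) x i s.tick with hJ
    have hmono : ∀ i j, i ≤ j → (J i).t ≤ (J j).t := by
      intro i j hij
      induction hij with
      | refl => exact le_rfl
      | @step j _ ih' =>
        refine ih'.trans ((Nat.le_succ _).trans ?_)
        exact le_ev_t (T := T) c ((J j).setV x j).tick
    have hEt : (J N).t + 1 ≤ E := by
      simp only [ev, St.tick_t, St.setV_t] at hE
      exact hE
    have hs0 : s.t + 1 ≤ (J 0).t := le_rfl
    have hoJ : ∀ i, o.val (J i) = N := by
      intro i
      refine Opd.val_of_wf fun y hy => ?_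
      induction i with
      | zero => rfl
      | succ i ih' =>
        simp only [hJ, iter]
        rw [ev_v (hoc y hy)]
        simp only [St.tick_v, St.setV_v, if_neg (hox y hy)]
        exact ih'
    have hoJ' : ∀ i m, o.val ((J i).setV x m) = N := by
      intro i m
      rw [← hoJ i]
      refine Opd.val_of_wf fun y hy => ?_
      simp [hox y hy]
    -- the loop, entered with `i` iterations done
    have key : ∀ d i σ, i + d = N → Rep n k T ((J i).setV x i) σ → σ.reg 3 = N - i →
        Bounded B (J i) →
        ∃ σ' τ, Exec W (.loop 3 (.seq (comp c) <| .seq (.const 1 1) <| .seq (.add (reg x) (reg x) 1) <|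
          .seq (load 1 o) (.sub 3 1 (reg x)))) σ σ' τ ∧ Rep n k T ((J N).setV x N) σ' ∧
          τ + 12 * (J i).t ≤ 12 * (J N).t + 1 ∧ Bounded B (J N) := by
      intro d
      induction d with
      | zero =>
        intro i σ hi hR hr hb
        obtain rfl : i = N := by omega
        exact ⟨σ, 1, .loop_false (by omega), hR, by omega, hb⟩
      | succ d ihd =>
        intro i σ hi hR hr hb
        have hle := hmono (i + 1) N (by omega)
        have hle' := hmono 0 i (by omega)
        have hb1 : Bounded B ((J i).setV x i).tick := hb.setV (by omega)
        obtain ⟨σ1, τ1, h1, hR1, ht1, hb1⟩ := ih hwfc hlit.2 ((J i).setV x i).tick σ hR.tick hb1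
          (by have : (J (i + 1)).t ≤ E := by omega
              exact this)
        change Rep n k T (J (i + 1)) σ1 at hR1
        change Bounded B (J (i + 1)) at hb1
        change τ1 + 12 * ((J i).t + 1) ≤ 12 * (J (i + 1)).t at ht1
        have hx : (J (i + 1)).v x = i := by
          simp only [hJ, iter]
          rw [ev_v hxc]
          simp
        have hR2 := hR1.setTemp (d := 1) (by omega) 1
        have h3 := Exec.add (W := W) (σ1.setReg 1 1) (reg x) (reg x) 1
        rw [hR2.v, show (σ1.setReg 1 1).reg 1 = 1 by simp [Store.setReg], hx] at h3
        have hR3 := hR2.setVar x (i + 1)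
        set σ3 := (σ1.setReg 1 1).setReg (reg x) (i + 1)
        have h4 := exec_load (W := W) hR3 (o := o) (by rw [hoJ']; omega) 1
        have hR4 := hR3.setTemp (d := 1) (by omega) (o.val ((J (i + 1)).setV x (i + 1)))
        rw [hoJ'] at h4 hR4
        have h5 := Exec.sub (W := W) (σ3.setReg 1 N) 3 1 (reg x)
        rw [hR4.v, show (σ3.setReg 1 N).reg 1 = N by simp [Store.setReg],
          show ((J (i + 1)).setV x (i + 1)).v x = i + 1 by simp] at h5
        have hR5 := hR4.setTemp (d := 3) (by omega) (N - (i + 1))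
        obtain ⟨σ', τ', h6, hR6, ht6, hb6⟩ := ihd (i + 1) _ (by omega) hR5
          (by simp [Store.setReg]) hb1
        exact ⟨σ', _, .loop_true (by omega) (.seq h1 <| .seq (.const _ _ _ (by omega)) <|
          .seq (h3 (by omega)) <| .seq h4 (h5 (by omega))) h6, hR6, by omega, hb6⟩
    have hst := hmono 0 N (by omega)
    have hR1 := (hR.setVar x 0)
    set σ1 := σ.setReg (reg x) 0
    have h2 := exec_load (W := W) hR1 (o := o)
      (by have := hoJ' 0 0; change o.val (s.setV x 0) = N at this; rw [this]; omega) 1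
    have hR2 := hR1.setTemp (d := 1) (by omega) (o.val (s.setV x 0))
    rw [show o.val (s.setV x 0) = N from hoJ' 0 0] at h2 hR2
    have h3 := Exec.sub (W := W) (σ1.setReg 1 N) 3 1 (reg x)
    rw [hR2.v, show (σ1.setReg 1 N).reg 1 = N by simp [Store.setReg],
      show (s.setV x 0).v x = 0 by simp, Nat.sub_zero] at h3
    have hR3 := hR2.setTemp (d := 3) (by omega) N
    obtain ⟨σ', τ', h6, hR6, ht6, hb6⟩ := key N 0 _ (by omega) hR3.tick
      (by simp [Store.setReg]) hb.tick
    refine ⟨σ', _, .seq (.const _ _ _ (by omega)) <| .seq h2 <| .seq (h3 (by omega)) h6, hR6.tick, ?_,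
      hb6.setV (by omega)⟩
    change _ ≤ 12 * ((J N).t + 1)
    change τ' + 12 * (s.t + 1) ≤ _ at ht6
    omega

end Imp

namespace Imp

infixr:60 ";;" => Cmd.seq
prefix:max "§" => Opd.var

variable {T : ℕ → ℕ → ℕ}

/-! ### Running times -/

/-- An upper bound for an operand. -/
def Opd.bound (b : Var → ℕ) : Opd → ℕ
  | .var y => b y
  | .lit c => c

/-- A bound for the running time, where `b` bounds the bounds of loops. -/
def Cmd.cost (b : Var → ℕ) : Cmd → ℕ
  | .seq c d => c.cost b + d.cost b
  | .ifnz _ c d | .ifeq _ _ c d => 1 + c.cost b + d.cost b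
  | .loop x o c => 2 + o.bound b * (1 + c.cost (Function.update b x (o.bound b)))
  | _ => 1

/-- The variables in `L` do not change, and loops are bounded by them and by loop counters. -/
def Cmd.safe (L : List Var) : Cmd → Bool
  | .set x _ | .inc x | .dec x | .get x _ _ _ | .tab x _ _ => x ∉ L
  | .seq c d | .ifnz _ c d | .ifeq _ _ c d => c.safe L && d.safe L
  | .loop x (.var y) c => (y ∈ L : Bool) && (x ∉ L : Bool) && c.safe (x :: L)
  | .loop x (.lit _) c => (x ∉ L : Bool) && c.safe (x :: L)
  | _ => true

/-- Loops are bounded by protected variables or by counters of enclosing loops. So costs multiply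
along the nesting, and a counter may be replaced by the bound of its loop; hence the updated `b` in
the cost of a body. -/
theorem ev_t_le {c : Cmd} {L : List Var} (h : c.safe L = true) {b : Var → ℕ} {s : St}
    (hb : ∀ y ∈ L, s.v y ≤ b y) :
    (ev T c s).t ≤ s.t + c.cost b ∧ ∀ y ∈ L, (ev T c s).v y = s.v y := by
  induction c generalizing L b s with
  | skip | put | emit => exact ⟨le_rfl, fun _ _ => rfl⟩
  | set x o | inc x | dec x | get x | tab x =>
    simp only [Cmd.safe, decide_eq_true_eq] at h
    refine ⟨le_rfl, fun y hy => ?_⟩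
    have : y ≠ x := fun h' => h (h' ▸ hy)
    simp [ev, this]
  | seq c d ihc ihd =>
    simp only [Cmd.safe, Bool.and_eq_true] at h
    obtain ⟨h1, h2⟩ := ihc h.1 hb
    obtain ⟨h3, h4⟩ := ihd h.2 (s := ev T c s) (b := b) fun y hy => by rw [h2 y hy]; exact hb y hy
    refine ⟨by simp only [ev, Cmd.cost]; omega, fun y hy => ?_⟩
    simp only [ev]
    rw [h4 y hy, h2 y hy]
  | ifnz x c d ihc ihd | ifeq o p c d ihc ihd =>
    simp only [Cmd.safe, Bool.and_eq_true] at h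
    simp only [ev]
    split
    · obtain ⟨h1, h2⟩ := ihc h.1 (s := s.tick) hb
      exact ⟨by simp only [Cmd.cost, St.tick_t] at *; omega, h2⟩
    · obtain ⟨h1, h2⟩ := ihd h.2 (s := s.tick) hb
      exact ⟨by simp only [Cmd.cost, St.tick_t] at *; omega, h2⟩
  | loop x o c ih =>
    obtain ⟨ho, hx, hc⟩ : o.val s ≤ o.bound b ∧ x ∉ L ∧ c.safe (x :: L) = true := by
      cases o with
      | var y =>
        simp only [Cmd.safe, Bool.and_eq_true, decide_eq_true_eq] at h
        exact ⟨hb y h.1.1, h.1.2, h.2⟩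
      | lit m =>
        simp only [Cmd.safe, Bool.and_eq_true, decide_eq_true_eq] at h
        exact ⟨le_rfl, h.1, h.2⟩
    set b' := Function.update b x (o.bound b)
    have key : ∀ i ≤ o.val s, (iter (ev T c) x i s.tick).t ≤ s.t + 1 + i * (1 + c.cost b') ∧
        ∀ y ∈ L, (iter (ev T c) x i s.tick).v y = s.v y := by
      intro i hi
      induction i with
      | zero => exact ⟨by simp [iter], fun _ _ => rfl⟩
      | succ i ih' =>
        obtain ⟨h1, h2⟩ := ih' (by omega)
        set s' := iter (ev T c) x i s.tick
        obtain ⟨h3, h4⟩ := ih hc (s := (s'.setV x i).tick) (b := b') (by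
          intro y hy
          simp only [St.tick_v, St.setV_v, b', Function.update_apply]
          split
          · omega
          · rename_i hne
            have hy : y ∈ L := by simpa [hne] using hy
            rw [h2 y hy]; exact hb y hy)
        refine ⟨?_, fun y hy => ?_⟩
        · change (ev T c (s'.setV x i).tick).t ≤ _
          simp only [St.tick_t, St.setV_t] at h3
          rw [add_mul]
          omega
        · simp only [iter]
          have : y ≠ x := fun h' => hx (h' ▸ hy)
          rw [h4 y (List.mem_cons_of_mem _ hy), ← h2 y hy]
          simp [this]
    obtain ⟨h1, h2⟩ := key _ le_rfl
    have h3 : o.val s * (1 + c.cost b') ≤ o.bound b * (1 + c.cost b') := Nat.mul_le_mul_right _ ho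
    refine ⟨?_, fun y hy => ?_⟩
    · change (iter (ev T c) x (o.val s) s.tick).t + 1 ≤ s.t + (2 + o.bound b * (1 + c.cost b'))
      omega
    · have : y ≠ x := fun h' => hx (h' ▸ hy)
      rw [← h2 y hy]
      simp [ev, this]

/-! ### Loops -/

/-- The states agree on everything that the command does not change. -/
structure Frame (c : Cmd) (s s' : St) : Prop where
  v : ∀ y, c.modV y = false → s'.v y = s.v y
  a : ∀ r, c.modA r = false → s'.a r = s.a r

/-- The frame part supplies everything that the body cannot change, so that invariants need mention
only what it does change. -/
theorem loop_rule (T : ℕ → ℕ → ℕ) (x : Var) (o : Opd) (c : Cmd) (s : St) (I : ℕ → St → Prop)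
    (h0 : I 0 s.tick)
    (h1 : ∀ i s', i < o.val s → Frame (.loop x o c) s s' → I i s' →
      I (i + 1) (ev T c (s'.setV x i).tick)) :
    ∃ s', Frame (.loop x o c) s s' ∧ I (o.val s) s' ∧
      ev T (.loop x o c) s = (s'.setV x (o.val s)).tick := by
  refine ⟨_, ?_, iter_rule (f := ev T c) (x := x) (s := s.tick)
    (fun i s' => Frame (.loop x o c) s s' ∧ I i s') ⟨⟨fun _ _ => rfl, fun _ _ => rfl⟩, h0⟩ ?_ |>.2, rfl⟩
  · exact (iter_rule (f := ev T c) (x := x) (s := s.tick) (N := o.val s)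
      (fun i s' => Frame (.loop x o c) s s') ⟨fun _ _ => rfl, fun _ _ => rfl⟩ fun i s' _ h =>
      ⟨fun y hy => by
        have hy' := hy
        simp only [Cmd.modV, Bool.or_eq_false_iff, decide_eq_false_iff_not] at hy'
        rw [ev_v hy'.2, ← h.v y hy]
        simp [Ne.symm hy'.1], fun r hr => by
        rw [ev_a (c := c) hr, ← h.a r hr]; rfl⟩)
  · intro i s' hi h
    refine ⟨⟨fun y hy => by
        have hy' := hy
        simp only [Cmd.modV, Bool.or_eq_false_iff, decide_eq_false_iff_not] at hy'
        rw [ev_v hy'.2, ← h.1.v y hy]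
        simp [Ne.symm hy'.1], fun r hr => by
        rw [ev_a (c := c) hr, ← h.1.a r hr]; rfl⟩, h1 i s' hi h.1 h.2⟩

@[simp] theorem Opd.val_var (s : St) (x : Var) : Opd.val s (.var x) = s.v x := rfl
@[simp] theorem Opd.val_lit (s : St) (c : ℕ) : Opd.val s (.lit c) = c := rfl

/-- Set the first `n` entries of an array to `0`. -/
def clr (r : Arr) : Cmd := .loop .z §.n (.put r §.z (.lit 0) (.lit 0))

theorem clr_spec (r : Arr) (s : St) {i : ℕ} (hi : i < s.v .n) : (ev T (clr r) s).a r i 0 = 0 := by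
  obtain ⟨s', -, h, he⟩ := loop_rule T .z §.n (.put r §.z (.lit 0) (.lit 0)) s
    (fun i s' => ∀ l < i, s'.a r l 0 = 0) (by simp) (by
      intro i s' hi _ h l hl
      simp only [ev, Opd.val_var, Opd.val_lit, St.tick_a, St.setA_a, St.tick_v, St.setV_v, St.setV_a,
        if_true, and_true, true_and]
      split
      · rfl
      · exact h l (by omega))
  rw [clr, he]
  exact h i hi

end Imp

/-! ### Frames, and loops that fill arrays. -/

namespace Imp

section

variable {T : ℕ → ℕ → ℕ}

theorem Frame.setV {c : Cmd} {s s' : St} (h : Frame c s s') {x : Var} (hx : c.modV x = true) (m : ℕ) :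
    Frame c s (s'.setV x m) :=
  ⟨fun y hy => by
    have : y ≠ x := by rintro rfl; simp [hx] at hy
    simp [this, h.v y hy], fun r hr => h.a r hr⟩

theorem Frame.tick {c : Cmd} {s s' : St} (h : Frame c s s') : Frame c s s'.tick := ⟨h.v, h.a⟩

theorem frame_ev (c : Cmd) (s : St) : Frame c s (ev T c s) :=
  ⟨fun _ h => ev_v h s, fun _ h => ev_a h s⟩

theorem Frame.trans {c : Cmd} {s s' s'' : St} (h : Frame c s s') (h' : Frame c s' s'') :
    Frame c s s'' :=
  ⟨fun y hy => (h'.v y hy).trans (h.v y hy), fun r hr => (h'.a r hr).trans (h.a r hr)⟩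

theorem Frame.mono {c d : Cmd} {s s' : St} (h : Frame c s s')
    (hv : ∀ y, d.modV y = false → c.modV y = false) (ha : ∀ r, d.modA r = false → c.modA r = false) :
    Frame d s s' := ⟨fun y hy => h.v y (hv y hy), fun r hr => h.a r (ha r hr)⟩

/-- A loop that fills distinct entries of an array. -/
theorem fill_one {x : Var} {o : Opd} {c : Cmd} {s : St} (A : Arr) (f g : ℕ → ℕ) (P : ℕ → ℕ → Prop)
    (hfg : ∀ i j, i < o.val s → j < i → f i ≠ f j ∨ g i ≠ g j)
    (h : ∀ i s', i < o.val s → Frame (.loop x o c) s s' → s'.v x = i →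
      P i ((ev T c s').a A (f i) (g i)) ∧
        ∀ i' j', (i' ≠ f i ∨ j' ≠ g i) → (ev T c s').a A i' j' = s'.a A i' j') :
    (∀ i < o.val s, P i ((ev T (.loop x o c) s).a A (f i) (g i))) ∧
      ∀ i' j', (∀ i < o.val s, i' ≠ f i ∨ j' ≠ g i) →
        (ev T (.loop x o c) s).a A i' j' = s.a A i' j' := by
  obtain ⟨s', -, hI, he⟩ := loop_rule T x o c s (fun i s' => (∀ j < i, P j (s'.a A (f j) (g j))) ∧
    ∀ i' j', (∀ j < i, i' ≠ f j ∨ j' ≠ g j) → s'.a A i' j' = s.a A i' j') ⟨by simp, by simp⟩ (by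
      intro i s' hi hf ⟨h1, h2⟩
      obtain ⟨h3, h4⟩ := h i (s'.setV x i).tick hi (hf.setV (by simp [Cmd.modV]) i).tick (by simp)
      refine ⟨fun j hj => ?_, fun i' j' hj => ?_⟩
      · rcases Nat.lt_succ_iff_lt_or_eq.mp hj with hj | rfl
        · rw [h4 _ _ ((hfg i j hi hj).imp Ne.symm Ne.symm)]
          exact h1 j hj
        · exact h3
      · rw [h4 _ _ (hj i (by omega))]
        exact h2 _ _ fun j hji => hj j (by omega))
  rw [he]
  exact hI

/-- A double loop that fills a matrix. -/
theorem fill_two {x y : Var} {o p : Opd} {c : Cmd} {s : St} (A : Arr) (P : ℕ → ℕ → ℕ → Prop)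
    (hxy : x ≠ y) (hcx : c.modV x = false)
    (hp : ∀ s', Frame (.loop x o (.loop y p c)) s s' → p.val s' = p.val s)
    (h : ∀ i j s', i < o.val s → j < p.val s → Frame (.loop x o (.loop y p c)) s s' → s'.v x = i →
      s'.v y = j → P i j ((ev T c s').a A i j) ∧
        ∀ i' j', (i' ≠ i ∨ j' ≠ j) → (ev T c s').a A i' j' = s'.a A i' j') :
    ∀ i < o.val s, ∀ j < p.val s, P i j ((ev T (.loop x o (.loop y p c)) s).a A i j) := by
  obtain ⟨s', -, hI, he⟩ := loop_rule T x o (.loop y p c) s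
    (fun i s' => ∀ i' < i, ∀ j < p.val s, P i' j (s'.a A i' j)) (by simp) (by
      intro i s' hi hf h1
      have hf' := (hf.setV (x := x) (by simp [Cmd.modV]) i).tick
      obtain ⟨h2, h3⟩ := fill_one (T := T) (x := y) (o := p) (c := c) (s := (s'.setV x i).tick) A
        (fun _ => i) (fun j => j) (fun j => P i j) (fun i j _ hj => .inr (by omega)) (by
          intro j s'' hj hf2 hy
          rw [hp _ hf'] at hj
          have hf3 : Frame (.loop x o (.loop y p c)) s s'' := hf'.trans (hf2.mono (by
              intro z hz
              simp only [Cmd.modV, Bool.or_eq_false_iff] at hz ⊢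
              exact hz.2) (fun r hr => hr))
          exact h i j s'' hi hj hf3 (by
            rw [hf2.v x (by simp [Cmd.modV, hcx, Ne.symm hxy])]; simp) hy)
      rw [hp _ hf'] at h2 h3
      intro i' hi' j hj
      rcases Nat.lt_succ_iff_lt_or_eq.mp hi' with hi' | rfl
      · rw [h3 _ _ (fun _ _ => .inl (by omega))]
        exact h1 i' hi' j hj
      · exact h2 j hj)
  rw [he]
  exact hI

end

/-! ### The transition table -/

/-- The number of a state, plus `1`; undefined is `0`. -/
def enc {n : ℕ} (o : Option (Fin n)) : ℕ := o.elim 0 fun v => v.val + 1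

@[simp] theorem enc_none {n : ℕ} : enc (none : Option (Fin n)) = 0 := rfl
@[simp] theorem enc_some {n : ℕ} (v : Fin n) : enc (some v) = v.val + 1 := rfl

theorem enc_injective {n : ℕ} : Function.Injective (enc (n := n)) := by
  rintro (_ | a) (_ | b) h <;> simp [enc, Fin.ext_iff] at h ⊢
  exact h

/-- The transition table, `0` outside its range. -/
def table {n k : ℕ} (Z : FSM (Fin n) (Fin k)) (i j : ℕ) : ℕ :=
  if h : i < n ∧ j < k then enc (Z.δ ⟨i, h.1⟩ ⟨j, h.2⟩) else 0

variable {n k : ℕ} {Z : FSM (Fin n) (Fin k)}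

@[simp] theorem table_fin (u : Fin n) (x : Fin k) : table Z u x = enc (Z.δ u x) := by
  simp [table]

/-! ### States on cycles -/

/-- Variable `c` holds the current state plus 1, or 0 once the walk has become undefined; `d` holds
`w + 1`. -/
def cycStep : Cmd :=
  .ifnz .c (.dec .c ;; .tab .c §.c §.x ;; .ifeq §.c §.d (.put .cy §.w §.x (.lit 1)) .skip) .skip

def cycWalk : Cmd := .loop .i §.n cycStep

def cycAt : Cmd := .put .cy §.w §.x (.lit 0) ;; .set .c §.w ;; .inc .c ;; .set .d §.c ;; cycWalk

/-- Find the states on `x`-cycles. -/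
def cyc : Cmd := .loop .w §.n (.loop .x §.k cycAt)

theorem orb_le_card {x : Fin k} {u q : Fin n} {j : ℕ} (hq : Z.orb x u j = some q)
    (hinj : ∀ i i', i < i' → i' ≤ j → Z.orb x u i ≠ Z.orb x u i') : j < n := by
  have h1 := FSM.exists_orb_of_le hq
  choose f hf using h1
  let g : Fin (j + 1) → Fin n := fun i => f i (by omega)
  have hg : Function.Injective g := by
    intro a b hab
    by_contra hne
    have h2 : Z.orb x u a = Z.orb x u b := by
      rw [hf a (by omega), hf b (by omega)]; exact congrArg some hab
    rcases lt_or_gt_of_ne (fun h => hne (Fin.ext h)) with h | h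
    · exact hinj a b h (by omega) h2
    · exact hinj b a h (by omega) h2.symm
  have := Fintype.card_le_of_injective g hg
  simp at this
  omega

theorem exists_orbEnd_lt (Z : FSM (Fin n) (Fin k)) (x : Fin k) (u : Fin n) :
    ∃ j < n, Z.OrbEnd x u j := by
  obtain ⟨j, hj⟩ := Z.exists_orbEnd x u
  obtain ⟨q, hq⟩ := hj.isSome
  exact ⟨j, orb_le_card hq hj.inj, hj⟩

/-- The walk from the successor of `w` has met all its states in fewer than `n` steps, so `n`
iterations detect a return to `w`. -/
theorem onCycle_iff {x : Fin k} {w : Fin n} :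
    Z.OnCycle x w ↔ ∃ j < n, Z.orb x w (j + 1) = some w := by
  refine ⟨fun ⟨j, hj⟩ => ?_, fun ⟨j, _, hj⟩ => ⟨j, hj⟩⟩
  cases h : Z.δ w x with
  | none =>
    have := FSM.exists_orb_of_le hj 1 (by omega)
    simp [FSM.orb, h] at this
  | some v =>
    rw [FSM.orb_succ' h] at hj
    obtain ⟨l, hl, hv⟩ := exists_orbEnd_lt Z x v
    obtain ⟨i, hi, hiw⟩ := hv.exists_le ⟨j, hj⟩
    exact ⟨i, by omega, by rw [FSM.orb_succ' h, hiw]⟩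

theorem cycAt_spec {s : St} (hn : s.v .n = n) {w : Fin n} {x : Fin k} (hw : s.v .w = w)
    (hx : s.v .x = x) :
    ((ev (table Z) cycAt s).a .cy w x ≠ 0 ↔ Z.OnCycle x w) ∧
      ∀ i j : ℕ, (i ≠ w ∨ j ≠ x) → (ev (table Z) cycAt s).a .cy i j = s.a .cy i j := by
  set s1 := ev (table Z) (.put .cy §.w §.x (.lit 0) ;; .set .c §.w ;; .inc .c ;; .set .d §.c) s with hs1
  obtain ⟨s', hf, ⟨-, h1, h2⟩, he⟩ := loop_rule (table Z) .i §.n cycStep s1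
    (fun i s' => s'.v .c = enc (Z.orb x w i) ∧
      (s'.a .cy w x ≠ 0 ↔ ∃ j < i, Z.orb x w (j + 1) = some w) ∧
      ∀ i j : ℕ, (i ≠ w ∨ j ≠ x) → s'.a .cy i j = s.a .cy i j) (by
        simp only [hs1, ev]
        simp [hw, hx, FSM.orb]
        intro i j hij h1 h2
        omega) (by
        intro i s' hi hf ⟨h1, h2, h3⟩
        have ed : s'.v .d = w.val + 1 := by rw [hf.v .d rfl]; simp [hs1, ev, hw]
        have ew : s'.v .w = w.val := by rw [hf.v .w rfl]; simp [hs1, ev, hw]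
        have ex : s'.v .x = x.val := by rw [hf.v .x rfl]; simp [hs1, ev, hx]
        cases ho : Z.orb x w i with
        | none =>
          rw [ho, enc_none] at h1
          have ho' : Z.orb x w (i + 1) = none := by simp [FSM.orb, ho]
          simp only [cycStep, ev]
          simp only [St.tick_v, St.setV_v, reduceCtorEq, if_false, h1, ne_eq, not_true_eq_false,
            St.tick_a, St.setV_a, ho', enc_none, true_and]
          refine ⟨h2.trans ⟨fun ⟨j, hj, e⟩ => ⟨j, by omega, e⟩, fun ⟨j, hj, e⟩ => ⟨j, ?_, e⟩⟩, h3⟩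
          rcases Nat.lt_succ_iff_lt_or_eq.mp hj with hj | rfl
          · exact hj
          · simp [ho'] at e
        | some p =>
          rw [ho, enc_some] at h1
          have ho' : Z.orb x w (i + 1) = Z.δ p x := by simp [FSM.orb, ho]
          simp only [cycStep, ev]
          by_cases hd : enc (Z.orb x w (i + 1)) = w.val + 1
          · have hd' : Z.orb x w (i + 1) = some w := enc_injective hd
            simp [h1, ← ho', ed, hd, ew, ex]
            refine ⟨⟨i, by omega, hd'⟩, fun i j hij => ?_⟩
            rw [if_neg (by omega)]
            exact h3 i j hij
          · simp [h1, ← ho', ed, hd, ex]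
            refine ⟨?_, h3⟩
            rw [← ne_eq, h2]
            refine ⟨fun ⟨j, hj, e⟩ => ⟨j, by omega, e⟩, fun ⟨j, hj, e⟩ => ⟨j, ?_, e⟩⟩
            rcases Nat.lt_or_eq_of_le hj with hj | rfl
            · exact hj
            · exact absurd (by rw [e]; rfl) hd)
  have e1 : s1.v .n = n := by simp [hs1, ev, hn]
  have : ev (table Z) cycAt s = (s'.setV .i (Opd.val s1 §.n)).tick := by
    rw [← he]; rfl
  rw [this]
  refine ⟨?_, h2⟩
  rw [onCycle_iff]
  simp only [Opd.val_var, e1] at h1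
  exact h1

theorem cyc_spec {s : St} (hn : s.v .n = n) (hk : s.v .k = k) (w : Fin n) (x : Fin k) :
    (ev (table Z) cyc s).a .cy w x ≠ 0 ↔ Z.OnCycle x w := by
  have := fill_two (T := table Z) (x := .w) (y := .x) (o := §.n) (p := §.k) (c := cycAt) (s := s) .cy
    (fun i j c => ∀ (w : Fin n) (x : Fin k), w.val = i → x.val = j → (c ≠ 0 ↔ Z.OnCycle x w))
    (by simp) rfl (fun s' hf => hf.v .k rfl) (by
      intro i j s' hi hj hf hw hx
      simp only [Opd.val_var, hn, hk] at hi hj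
      obtain ⟨h1, h2⟩ := cycAt_spec (Z := Z) (s := s') (hf.v .n rfl |>.trans hn) (w := ⟨i, hi⟩)
        (x := ⟨j, hj⟩) hw hx
      refine ⟨?_, h2⟩
      rintro w x rfl rfl
      exact h1)
  exact this w (by simp [hn]) x (by simp [hk]) w x rfl rfl

end Imp

namespace Imp

variable {n k : ℕ} {Z : FSM (Fin n) (Fin k)}

/-! ### The walk from a state along the arcs with one label -/

def walkStep : Cmd :=
  .tab .y §.cur §.x ;;
  .ifnz .y (.dec .y ;; .get .t .ip §.y (.lit 0) ;;
    .ifnz .t .skip (.put .ip §.y (.lit 0) (.lit 1) ;; .put .pp §.y (.lit 0) §.cur ;; .set .cur §.y)) .skip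

def walkInit : Cmd := clr .ip ;; .put .ip §.u (.lit 0) (.lit 1) ;; .set .cur §.u

/-- Mark the states on the walk from `u` along `x`-arcs, and find the predecessors on this walk. -/
def walk : Cmd := walkInit ;; .loop .i §.n walkStep

structure Walked (Z : FSM (Fin n) (Fin k)) (x : Fin k) (u : Fin n) (s : St) : Prop where
  last : ∃ l : Fin n, s.v .cur = l ∧ Z.OrbLast x u l
  mem : ∀ w : Fin n, s.a .ip w 0 ≠ 0 ↔ Z.OnOrb x u w
  pred : ∀ p y : Fin n, Z.OrbPred x u p y → s.a .pp y 0 = p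

theorem orbPred_lt {x : Fin k} {u y : Fin n} {j l : ℕ} (h1 : Z.orb x u j = some y)
    (h2 : ∀ i ≤ l, Z.orb x u i ≠ some y) : l < j := by
  by_contra hlt
  exact h2 j (by omega) h1

/-- Invariant: `j` steps to pairwise distinct states have been recorded, and either the walk has met
its last new state or it has advanced in every iteration, so that `j = i`. After `n` iterations the
latter would give `n + 1` distinct states. -/
theorem walk_spec {s : St} (hn : s.v .n = n) {u : Fin n} {x : Fin k} (hu : s.v .u = u)
    (hx : s.v .x = x) : Walked Z x u (ev (table Z) walk s) := by
  set s0 := ev (table Z) (clr .ip) s with hs0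
  set s1 := ev (table Z) walkInit s with hs1
  have f0 : Frame (clr .ip) s s0 := frame_ev _ _
  have e0 : ∀ w : Fin n, s0.a .ip w 0 = 0 := fun w => clr_spec .ip s (by omega)
  have e1 : s1 = ((s0.setA .ip u 0 1).tick.setV .cur u).tick := by
    simp [hs1, walkInit, ev, ← hs0, f0.v .u rfl, hu]
  obtain ⟨s', hf, ⟨j, ⟨l, hl, hol⟩, hinj, hip, hpp, hor⟩, he⟩ := loop_rule (table Z) .i §.n walkStep s1
    (fun i s' => ∃ j, (∃ l : Fin n, s'.v .cur = l ∧ Z.orb x u j = some l) ∧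
      (∀ i i', i < i' → i' ≤ j → Z.orb x u i ≠ Z.orb x u i') ∧
      (∀ w : Fin n, s'.a .ip w 0 ≠ 0 ↔ ∃ i ≤ j, Z.orb x u i = some w) ∧
      (∀ i < j, ∀ p y : Fin n, Z.orb x u i = some p → Z.orb x u (i + 1) = some y → s'.a .pp y 0 = p) ∧
      (Z.OrbEnd x u j ∨ j = i)) (by
      refine ⟨0, ⟨u, by simp [e1], rfl⟩, by omega, ?_, by omega, .inr rfl⟩
      intro w
      simp only [e1, St.tick_a, St.setV_a, St.setA_a, true_and, and_true, e0]
      simp [FSM.orb, Fin.ext_iff, eq_comm]) (by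
      rintro i s' hi hf ⟨j, ⟨l, hl, hol⟩, hinj, hip, hpp, hor⟩
      have ex : s'.v .x = x.val := by rw [hf.v .x rfl, e1]; simp [f0.v .x rfl, hx]
      have ho' : Z.orb x u (j + 1) = Z.δ l x := by simp [FSM.orb, hol]
      cases hd : Z.δ l x with
      | none =>
        refine ⟨j, ⟨l, ?_⟩, hinj, ?_⟩
        · simp [walkStep, ev, hl, ex, hd, hol]
        · simp only [walkStep, ev]
          simp [hl, ex, hd]
          refine ⟨by simpa using hip, hpp, .inl ⟨⟨l, hol⟩, hinj, .inl (by rw [ho', hd])⟩⟩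
      | some y =>
        by_cases hy : s'.a .ip y 0 = 0
        · have hnew : ∀ i ≤ j, Z.orb x u i ≠ some y := by
            intro i hi h
            exact (hip y).mpr ⟨i, hi, h⟩ hy
          have hji : j = i := by
            rcases hor with h | h
            · obtain ⟨i, hi, h⟩ := h.exists_le ⟨j + 1, by rw [ho', hd]⟩
              exact absurd h (hnew i hi)
            · exact h
          refine ⟨j + 1, ⟨y, ?_⟩, ?_, ?_⟩
          · simp [walkStep, ev, hl, ex, hd, hy, ho']
          · intro i i' hii' hi' h
            rcases Nat.lt_or_eq_of_le hi' with hi' | rfl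
            · exact hinj i i' hii' (by omega) h
            · rw [ho', hd] at h
              exact hnew i (by omega) h
          · simp only [walkStep, ev]
            simp [hl, ex, hd, hy]
            refine ⟨fun w => ?_, fun i hij p q hp hq => ?_, .inr hji⟩
            · by_cases hwy : w = y
              · subst hwy
                simp only [if_true, one_ne_zero, not_false_eq_true, true_iff]
                exact ⟨j + 1, le_rfl, by rw [ho', hd]⟩
              · have : w.val ≠ y.val := fun h => hwy (Fin.ext h)
                simp only [this, if_false]
                rw [← ne_eq, hip w]
                refine ⟨fun ⟨i, hi, h⟩ => ⟨i, by omega, h⟩, fun ⟨i, hi, h⟩ => ⟨i, ?_, h⟩⟩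
                rcases Nat.lt_or_eq_of_le hi with hi | rfl
                · omega
                · rw [ho', hd] at h
                  exact absurd (Option.some.inj h).symm hwy
            · rcases Nat.lt_or_eq_of_le hij with hij | rfl
              · have : q.val ≠ y.val := by
                  intro h
                  exact hnew (i + 1) hij (by rw [hq]; exact congrArg some (Fin.ext h))
                rw [if_neg this]
                exact hpp i hij p q hp hq
              · rw [ho', hd] at hq
                rw [hol] at hp
                simp only [Option.some.injEq] at hp hq
                simp [hp, hq]
        · refine ⟨j, ⟨l, ?_⟩, hinj, ?_⟩
          · simp [walkStep, ev, hl, ex, hd, hol, hy]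
          · obtain ⟨i', hi', h'⟩ := (hip y).mp hy
            simp only [walkStep, ev]
            simp [hl, ex, hd, hy]
            exact ⟨by simpa using hip, hpp, .inl ⟨⟨l, hol⟩, hinj, .inr ⟨i', hi', by rw [ho', hd, h']⟩⟩⟩)
  have e2 : s1.v .n = n := by rw [e1]; simp [f0.v .n rfl, hn]
  have hend : Z.OrbEnd x u j := by
    rcases hor with h | h
    · exact h
    · have := orb_le_card hol hinj
      simp [e2] at h
      omega
  have : ev (table Z) walk s = (s'.setV .i (Opd.val s1 §.n)).tick := by
    rw [← he]; rfl
  rw [this]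
  refine ⟨⟨l, hl, j, hend, hol⟩, fun w => ?_, fun p y ⟨i, h1, h2, h3⟩ => ?_⟩
  · refine (hip w).trans ⟨fun ⟨i, _, h⟩ => ⟨i, h⟩, fun h => hend.exists_le h⟩
  · obtain ⟨i', hi', h'⟩ := hend.exists_le ⟨i + 1, h2⟩
    have := orbPred_lt h' h3
    exact hpp i (by omega) p y h1 h2

/-! ### The adjacency lists of the digraph `Forces u` -/

/-- Append `q` to the list of `p`. -/
def push (p q : Var) : Cmd :=
  .get .c .dg §p (.lit 0) ;; .put .ad §p §.c §q ;; .inc .c ;; .put .dg §p (.lit 0) §.c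

/-- Add an arc, reversed if `rv` is not `0`. -/
def addArc (p q : Var) : Cmd := .ifnz .rv (push q p) (push p q)

/-- `q` is in the list of `p`. -/
def Adj (s : St) (p q : ℕ) : Prop := ∃ l < s.a .dg p 0, s.a .ad p l = q

/-- There is an arc, reversed if `rv` is not `0`. -/
def AdjR (s : St) (p q : ℕ) : Prop := if s.v .rv ≠ 0 then Adj s q p else Adj s p q

/-- The number of arcs. -/
def arcs (n : ℕ) (s : St) : ℕ := ∑ p ∈ Finset.range n, s.a .dg p 0

theorem push_spec {T : ℕ → ℕ → ℕ} {p q : Var} (hp : p ≠ .c) (hq : q ≠ .c) (s : St) :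
    (∀ a b, Adj (ev T (push p q) s) a b ↔ Adj s a b ∨ (a = s.v p ∧ b = s.v q)) ∧
      ∀ n, arcs n (ev T (push p q) s) ≤ arcs n s + 1 := by
  constructor
  · intro a b
    simp only [Adj, push, ev]
    simp [hp, hq]
    by_cases ha : a = s.v p
    · subst ha
      simp only [if_true, true_and]
      constructor
      · rintro ⟨l, hl, h⟩
        by_cases hl' : l = s.a .dg (s.v p) 0
        · rw [if_pos hl'] at h
          exact .inr h.symm
        · rw [if_neg hl'] at h
          exact .inl ⟨l, by omega, h⟩
      · rintro (⟨l, hl, h⟩ | rfl)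
        · exact ⟨l, by omega, by rw [if_neg (by omega)]; exact h⟩
        · exact ⟨_, Nat.lt_succ_self _, by simp⟩
    · simp [ha]
  · intro n
    simp only [arcs, push, ev]
    simp [hp]
    by_cases h : s.v p < n
    · rw [← Finset.add_sum_erase _ _ (Finset.mem_range.mpr h),
        ← Finset.add_sum_erase (Finset.range n) (fun p => s.a .dg p 0) (Finset.mem_range.mpr h)]
      rw [Finset.sum_congr rfl (g := fun p => s.a .dg p 0) (fun i hi => by
        rw [if_neg (Finset.ne_of_mem_erase hi)])]
      simp
      omega
    · refine (Finset.sum_le_sum fun i hi => ?_).trans (Nat.le_succ _)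
      rw [if_neg]
      have := Finset.mem_range.mp hi
      omega

/-- `AdjR` undoes the reversal, so the construction of the digraph is verified once for both
directions of search. -/
theorem addArc_spec {T : ℕ → ℕ → ℕ} {p q : Var} (hp : p ≠ .c) (hq : q ≠ .c) (s : St) :
    (∀ a b, AdjR (ev T (addArc p q) s) a b ↔ AdjR s a b ∨ (a = s.v p ∧ b = s.v q)) ∧
      ∀ n, arcs n (ev T (addArc p q) s) ≤ arcs n s + 1 := by
  have hrv : (ev T (addArc p q) s).v .rv = s.v .rv := ev_v (by simp [addArc, push, Cmd.modV]) s
  by_cases h : s.v .rv ≠ 0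
  · have e : ev T (addArc p q) s = ev T (push q p) s.tick := by simp [addArc, ev, h]
    obtain ⟨h1, h2⟩ := push_spec (T := T) hq hp s.tick
    refine ⟨fun a b => ?_, by rw [e]; exact h2⟩
    simp only [AdjR, hrv, if_pos h]
    rw [e, h1, and_comm]
    rfl
  · have e : ev T (addArc p q) s = ev T (push p q) s.tick := by simp [addArc, ev, not_not.mp h]
    obtain ⟨h1, h2⟩ := push_spec (T := T) hp hq s.tick
    refine ⟨fun a b => ?_, by rw [e]; exact h2⟩
    simp only [AdjR, hrv, if_neg h]
    rw [e, h1]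
    rfl

/-- The arcs of `Forces u` that come from the state `w` and the label `x`. -/
def ArcAt (Z : FSM (Fin n) (Fin k)) (u : Fin n) (x : Fin k) (w a b : Fin n) : Prop :=
  (∃ v, v ≠ u ∧ Z.δ w x = some v ∧ a = v ∧ b = w) ∨
  (¬ Z.OnOrb x u w ∧ a = w ∧
    ((Z.δ w x = none ∧ Z.OrbLast x u b) ∨ (∃ y, y ≠ u ∧ Z.δ w x = some y ∧ Z.OrbPred x u b y) ∨
      (∃ y, Z.δ w x = some y ∧ ¬ Z.OnOrb x u y ∧ b = y) ∨ (Z.OnCycle x w ∧ Z.OrbLast x u b)))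

theorem forces_iff {u a b : Fin n} : Z.Forces u a b ↔ ∃ x w, ArcAt Z u x w a b := by
  constructor
  · intro h
    cases h with
    | pred h1 h2 => exact ⟨_, b, .inl ⟨a, h1, h2, rfl, rfl⟩⟩
    | undef h1 h2 h3 => exact ⟨_, a, .inr ⟨h1, rfl, .inl ⟨h2, h3⟩⟩⟩
    | join h1 h2 h3 h4 => exact ⟨_, a, .inr ⟨h1, rfl, .inr (.inl ⟨_, h3, h2, h4⟩)⟩⟩
    | off h1 h2 h3 => exact ⟨_, a, .inr ⟨h1, rfl, .inr (.inr (.inl ⟨b, h2, h3, rfl⟩))⟩⟩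
    | cycle h1 h2 h3 => exact ⟨_, a, .inr ⟨h1, rfl, .inr (.inr (.inr ⟨h2, h3⟩))⟩⟩
  · rintro ⟨x, w, ⟨v, h1, h2, rfl, rfl⟩ | ⟨h1, rfl, ⟨h2, h3⟩ | ⟨y, h2, h3, h4⟩ | ⟨y, h2, h3, rfl⟩ | ⟨h2, h3⟩⟩⟩
    · exact .pred h1 h2
    · exact .undef h1 h2 h3
    · exact .join h1 h3 h2 h4
    · exact .off h1 h2 h3
    · exact .cycle h1 h2 h3

theorem orbLast_unique {x : Fin k} {u l l' : Fin n} (h : Z.OrbLast x u l) (h' : Z.OrbLast x u l') :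
    l = l' := by
  obtain ⟨j, hj, hl⟩ := h
  obtain ⟨j', hj', hl'⟩ := h'
  have : ∀ {j j' l'}, Z.OrbEnd x u j → Z.OrbEnd x u j' → Z.orb x u j' = some l' → j' ≤ j := by
    intro j j' l' hj hj' h
    by_contra hlt
    obtain ⟨i, hi, h2⟩ := hj.exists_le ⟨j', h⟩
    exact hj'.inj i j' (by omega) le_rfl (by rw [h, h2])
  obtain rfl : j = j' := le_antisymm (this hj' hj hl) (this hj hj' hl')
  exact Option.some.inj (hl.symm.trans hl')

end Imp

namespace Imp

variable {n k : ℕ} {Z : FSM (Fin n) (Fin k)}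

def arcsPred : Cmd := .ifeq §.y §.u .skip (addArc .y .w)

def arcsOff : Cmd :=
  .get .d .ip §.y (.lit 0) ;;
  .ifnz .d (.ifeq §.y §.u .skip (.get .d .pp §.y (.lit 0) ;; addArc .w .d))
    (addArc .w .y ;; .get .d .cy §.w §.x ;; .ifnz .d (addArc .w .cur) .skip)

/-- Add the arcs of `Forces u` that come from the state `w` and the label `x`. -/
def arcsAt : Cmd :=
  .tab .y §.w §.x ;; .get .t .ip §.w (.lit 0) ;;
  .ifnz .y (.dec .y ;; arcsPred ;; .ifnz .t .skip arcsOff) (.ifnz .t .skip (addArc .w .cur))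

theorem arcsPred_spec {T : ℕ → ℕ → ℕ} (s : St) :
    (∀ a b, AdjR (ev T arcsPred s) a b ↔ AdjR s a b ∨ (s.v .y ≠ s.v .u ∧ a = s.v .y ∧ b = s.v .w)) ∧
      ∀ n, arcs n (ev T arcsPred s) ≤ arcs n s + 1 := by
  by_cases h : s.v .y = s.v .u
  · have e : ev T arcsPred s = s.tick.tick := by simp [arcsPred, ev, h]
    rw [e]
    refine ⟨fun a b => ?_, fun n => Nat.le_succ _⟩
    simp only [h, ne_eq, not_true_eq_false, false_and, or_false]
    rfl
  · have e : ev T arcsPred s = ev T (addArc .y .w) s.tick := by simp [arcsPred, ev, h]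
    rw [e]
    obtain ⟨h1, h2⟩ := addArc_spec (T := T) (p := .y) (q := .w) (by simp) (by simp) s.tick
    refine ⟨fun a b => ?_, h2⟩
    rw [h1]
    simp only [h, ne_eq, not_false_eq_true, true_and]
    rfl

theorem AdjR_congr {s s' : St} (h1 : s'.v .rv = s.v .rv) (h2 : s'.a .dg = s.a .dg)
    (h3 : s'.a .ad = s.a .ad) (a b : ℕ) : AdjR s' a b ↔ AdjR s a b := by
  simp [AdjR, Adj, h1, h2, h3]

theorem arcs_congr {s s' : St} (h2 : s'.a .dg = s.a .dg) (n : ℕ) : arcs n s' = arcs n s := by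
  simp [arcs, h2]

/-- No more than two arcs arise. If the successor `y` is on the walk from `u`, then `w` is on no
cycle, since the cycle would continue from `y` to `w` and put `w` on the walk. So a `join` arc is
never accompanied by a `cycle` arc. -/
theorem arcsOff_spec {s : St} {u : Fin n} {x : Fin k} {w y : Fin n} (hu : s.v .u = u)
    (hx : s.v .x = x) (hw : s.v .w = w) (hy : s.v .y = y) (hwk : Walked Z x u s)
    (hcy : ∀ w x, s.a .cy (w : Fin n) (x : Fin k) ≠ 0 ↔ Z.OnCycle x w) (hd : Z.δ w x = some y)
    (hoff : ¬ Z.OnOrb x u w) :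
    (∀ a b, AdjR (ev (table Z) arcsOff s) a b ↔ AdjR s a b ∨
      ∃ b' : Fin n, a = w ∧ b = b' ∧ ((y ≠ u ∧ Z.OrbPred x u b' y) ∨
        (¬ Z.OnOrb x u y ∧ b' = y) ∨ (Z.OnCycle x w ∧ Z.OrbLast x u b'))) ∧
      arcs n (ev (table Z) arcsOff s) ≤ arcs n s + 2 := by
  obtain ⟨l, hl, hlast⟩ := hwk.last
  by_cases hyo : Z.OnOrb x u y
  · have hcyc : ¬ Z.OnCycle x w := by
      rintro ⟨j, hj⟩
      rw [FSM.orb_succ' hd] at hj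
      obtain ⟨i, hi⟩ := hyo
      exact hoff ⟨i + j, by rw [FSM.orb_add hi, hj]⟩
    have hip : s.a .ip y 0 ≠ 0 := (hwk.mem y).mpr hyo
    by_cases hyu : y = u
    · have e : ev (table Z) arcsOff s = ((s.setV .d (s.a .ip y 0)).tick).tick.tick.tick := by
        simp [arcsOff, ev, hy, show s.a .ip u 0 ≠ 0 from hyu ▸ hip, hu, hyu]
      rw [e]
      refine ⟨fun a b => ?_, Nat.le_add_right _ _⟩
      simp only [hyu, ne_eq, not_true_eq_false, false_and, hcyc, false_or, or_false]
      rw [or_iff_left (by rintro ⟨_, _, _, h, _⟩; exact h (FSM.OnOrb.self _ _))]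
      exact AdjR_congr rfl rfl rfl a b
    · obtain ⟨p, hp⟩ := FSM.exists_orbPred hyo hyu
      have hpp := hwk.pred p y hp
      have hyu' : y.val ≠ u.val := fun h => hyu (Fin.ext h)
      set s1 := (((s.setV .d (s.a .ip y 0)).tick).tick.tick.setV .d p).tick with hs1
      have e : ev (table Z) arcsOff s = ev (table Z) (addArc .w .d) s1 := by
        simp [arcsOff, ev, hy, hip, hu, hyu', hpp, hs1]
      rw [e]
      obtain ⟨h1, h2⟩ := addArc_spec (T := table Z) (p := .w) (q := .d) (by simp) (by simp) s1
      refine ⟨fun a b => ?_, (h2 n).trans (by rw [arcs_congr (s := s) (by simp [hs1])]; omega)⟩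
      rw [h1, AdjR_congr (s := s) (by simp [hs1]) (by simp [hs1]) (by simp [hs1])]
      simp only [hyu, hcyc, hyo, not_true_eq_false, false_and, or_false, ne_eq, not_false_eq_true,
        true_and]
      refine or_congr_right ⟨fun ⟨h3, h4⟩ => ⟨p, ?_, ?_, hp⟩, fun ⟨b', h3, h4, h5⟩ => ?_⟩
      · simpa [hs1, hw] using h3
      · simpa [hs1] using h4
      · have := hwk.pred b' y h5
        simp [hs1, hw, h3, h4, ← this, hpp]
  · have hip : s.a .ip y 0 = 0 := by
      by_contra h
      exact hyo ((hwk.mem y).mp h)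
    have hpr : ∀ b', ¬ Z.OrbPred x u b' y := fun b' ⟨j, _, h, _⟩ => hyo ⟨_, h⟩
    set s1 := (s.setV .d 0).tick.tick with hs1
    set s2 := ev (table Z) (addArc .w .y) s1 with hs2
    have f2 : Frame (addArc .w .y) s1 s2 := frame_ev _ _
    obtain ⟨h1, h2⟩ := addArc_spec (T := table Z) (p := .w) (q := .y) (by simp) (by simp) s1
    have e1w : s1.v .w = w := by simp [hs1, hw]
    have e1y : s1.v .y = y := by simp [hs1, hy]
    have e2w : s2.v .w = w := by rw [f2.v .w rfl, e1w]
    have e2x : s2.v .x = x := by rw [f2.v .x rfl]; simp [hs1, hx]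
    have e2l : s2.v .cur = l := by rw [f2.v .cur rfl]; simp [hs1, hl]
    have e2c : s2.a .cy = s.a .cy := by rw [f2.a .cy rfl]; simp [hs1]
    rw [← hs2] at h1 h2
    rw [e1w, e1y] at h1
    have h3 : ∀ a b, AdjR s1 a b ↔ AdjR s a b := AdjR_congr (by simp [hs1]) (by simp [hs1]) (by simp [hs1])
    have h4 : arcs n s1 = arcs n s := arcs_congr (by simp [hs1]) n
    by_cases hcyc : Z.OnCycle x w
    · have hc : s.a .cy w x ≠ 0 := (hcy w x).mpr hcyc
      set s3 := (s2.setV .d (s.a .cy w x)).tick.tick with hs3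
      have e : ev (table Z) arcsOff s = ev (table Z) (addArc .w .cur) s3 := by
        simp [arcsOff, ev, hy, hip, ← hs1, ← hs2, e2w, e2x, e2c, hc, hs3]
      rw [e]
      obtain ⟨h5, h6⟩ := addArc_spec (T := table Z) (p := .w) (q := .cur) (by simp) (by simp) s3
      refine ⟨fun a b => ?_, (h6 n).trans ?_⟩
      · rw [h5, AdjR_congr (s := s2) (by simp [hs3]) (by simp [hs3]) (by simp [hs3]), h1, h3, or_assoc]
        refine or_congr_right ⟨?_, ?_⟩
        · rintro (⟨h7, h8⟩ | ⟨h7, h8⟩)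
          · exact ⟨y, h7, h8, .inr (.inl ⟨hyo, rfl⟩)⟩
          · exact ⟨l, by simpa [hs3, e2w] using h7, by simpa [hs3, e2l] using h8, .inr (.inr ⟨hcyc, hlast⟩)⟩
        · rintro ⟨b', h7, h8, ⟨_, h9⟩ | ⟨_, h9⟩ | ⟨_, h9⟩⟩
          · exact absurd h9 (hpr b')
          · exact .inl ⟨h7, by rw [h8, h9]⟩
          · exact .inr ⟨by simp [hs3, e2w, h7], by simp [hs3, e2l, h8, orbLast_unique h9 hlast]⟩
      · rw [arcs_congr (s := s2) (by simp [hs3])]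
        have := h2 n
        omega
    · have hc : s.a .cy w x = 0 := by
        by_contra h
        exact hcyc ((hcy w x).mp h)
      have e : ev (table Z) arcsOff s = (s2.setV .d 0).tick.tick.tick := by
        simp [arcsOff, ev, hy, hip, ← hs1, ← hs2, e2w, e2x, e2c, hc]
      rw [e]
      refine ⟨fun a b => ?_, ?_⟩
      · rw [AdjR_congr (s := s2) (by simp) (by simp) (by simp), h1, h3]
        refine or_congr_right ⟨?_, ?_⟩
        · rintro ⟨h7, h8⟩
          exact ⟨y, h7, h8, .inr (.inl ⟨hyo, rfl⟩)⟩
        · rintro ⟨b', h7, h8, ⟨_, h9⟩ | ⟨_, h9⟩ | ⟨h9, _⟩⟩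
          · exact absurd h9 (hpr b')
          · exact ⟨h7, by rw [h8, h9]⟩
          · exact absurd h9 hcyc
      · rw [arcs_congr (s := s2) (by simp)]
        have := h2 n
        omega

/-- Besides the arcs that arise when `w` is off the walk, there is at most one, namely the reversal
of the transition itself. Hence the constant 3. -/
theorem arcsAt_spec {s : St} {u : Fin n} {x : Fin k} {w : Fin n} (hu : s.v .u = u)
    (hx : s.v .x = x) (hw : s.v .w = w) (hwk : Walked Z x u s)
    (hcy : ∀ w x, s.a .cy (w : Fin n) (x : Fin k) ≠ 0 ↔ Z.OnCycle x w) :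
    (∀ a b, AdjR (ev (table Z) arcsAt s) a b ↔ AdjR s a b ∨
      ∃ a' b' : Fin n, a = a' ∧ b = b' ∧ ArcAt Z u x w a' b') ∧
      arcs n (ev (table Z) arcsAt s) ≤ arcs n s + 3 := by
  obtain ⟨l, hl, hlast⟩ := hwk.last
  set t0 := s.a .ip w 0 with ht0
  have hmem := hwk.mem w
  rw [← ht0] at hmem
  cases hd : Z.δ w x with
  | none =>
    have hcyc : ¬ Z.OnCycle x w := by
      rintro ⟨j, hj⟩
      obtain ⟨r, hr⟩ := FSM.exists_orb_of_le hj 1 (by omega)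
      simp [FSM.orb, hd] at hr
    by_cases h0 : t0 = 0
    · set s1 := ((s.setV .y 0).tick.setV .t t0).tick.tick.tick with hs1
      have e : ev (table Z) arcsAt s = ev (table Z) (addArc .w .cur) s1 := by
        simp [arcsAt, ev, hw, hx, hd, ← ht0, h0, hs1]
      rw [e]
      obtain ⟨h1, h2⟩ := addArc_spec (T := table Z) (p := .w) (q := .cur) (by simp) (by simp) s1
      refine ⟨fun a b => ?_, (h2 n).trans (by rw [arcs_congr (s := s) (by simp [hs1])]; omega)⟩
      rw [h1, AdjR_congr (s := s) (by simp [hs1]) (by simp [hs1]) (by simp [hs1])]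
      refine or_congr_right ⟨fun ⟨h3, h4⟩ => ⟨w, l, ?_, ?_, ?_⟩, fun ⟨a', b', h3, h4, h5⟩ => ?_⟩
      · simpa [hs1, hw] using h3
      · simpa [hs1, hl] using h4
      · exact .inr ⟨fun h => hmem.mpr h h0, rfl, .inl ⟨hd, hlast⟩⟩
      · rcases h5 with ⟨v, _, h5, _⟩ | ⟨h5, h6, ⟨_, h7⟩ | ⟨_, _, h7, _⟩ | ⟨_, h7, _⟩ | ⟨h7, _⟩⟩
        · simp [hd] at h5
        · simp [hs1, hw, hl, h3, h4, h6, orbLast_unique h7 hlast]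
        · simp [hd] at h7
        · simp [hd] at h7
        · exact absurd h7 hcyc
    · have e : ev (table Z) arcsAt s = ((s.setV .y 0).tick.setV .t t0).tick.tick.tick.tick := by
        simp [arcsAt, ev, hw, hx, hd, ← ht0, h0]
      rw [e]
      refine ⟨fun a b => ?_, Nat.le_add_right _ _⟩
      rw [AdjR_congr (s := s) (by simp) (by simp) (by simp), or_iff_left]
      rintro ⟨a', b', h3, h4, ⟨v, _, h5, _⟩ | ⟨h5, _⟩⟩
      · simp [hd] at h5
      · exact h5 (hmem.mp h0)
  | some y =>
    set s1 := ((((s.setV .y (y + 1)).tick.setV .t t0).tick).tick.setV .y y).tick with hs1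
    set s2 := ev (table Z) arcsPred s1 with hs2
    have f2 : Frame arcsPred s1 s2 := frame_ev _ _
    obtain ⟨h1, h2⟩ := arcsPred_spec (T := table Z) s1
    rw [← hs2] at h1 h2
    have hyu : s1.v .y ≠ s1.v .u ↔ y ≠ u := by simp [hs1, hu, Fin.ext_iff]
    have h1' : ∀ a b, AdjR s2 a b ↔ AdjR s a b ∨ (y ≠ u ∧ a = y ∧ b = w) := by
      intro a b
      rw [h1, AdjR_congr (s := s) (by simp [hs1]) (by simp [hs1]) (by simp [hs1]), hyu]
      simp [hs1, hw]
    have h2' : arcs n s2 ≤ arcs n s + 1 := by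
      have := h2 n
      rwa [arcs_congr (s := s) (s' := s1) (by simp [hs1])] at this
    have e2t : s2.v .t = t0 := by rw [f2.v .t rfl]; simp [hs1]
    have e : ev (table Z) arcsAt s = ev (table Z) (.ifnz .t .skip arcsOff) s2 := by
      simp [arcsAt, ev, hw, hx, hd, ← ht0, hs2, hs1]
    rw [e]
    by_cases h0 : t0 = 0
    · have hoff : ¬ Z.OnOrb x u w := fun h => hmem.mpr h h0
      rw [show ev (table Z) (.ifnz .t .skip arcsOff) s2 = ev (table Z) arcsOff s2.tick by
        simp [ev, e2t, h0]]
      have hwk2 : Walked Z x u s2.tick := by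
        refine ⟨⟨l, ?_, hlast⟩, fun v => ?_, fun p v hp => ?_⟩
        · change s2.v .cur = l
          rw [f2.v .cur rfl]; simp [hs1, hl]
        · change s2.a .ip v 0 ≠ 0 ↔ _
          rw [f2.a .ip rfl]; exact hwk.mem v
        · change s2.a .pp v 0 = p
          rw [f2.a .pp rfl]; exact hwk.pred p v hp
      obtain ⟨h3, h4⟩ := arcsOff_spec (Z := Z) (s := s2.tick) (u := u) (x := x) (w := w) (y := y)
        (by change s2.v .u = u; rw [f2.v .u rfl]; simp [hs1, hu])
        (by change s2.v .x = x; rw [f2.v .x rfl]; simp [hs1, hx])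
        (by change s2.v .w = w; rw [f2.v .w rfl]; simp [hs1, hw])
        (by change s2.v .y = y; rw [f2.v .y rfl]; simp [hs1]) hwk2
        (by change ∀ w x, s2.a .cy _ _ ≠ 0 ↔ _; rw [f2.a .cy rfl]; exact hcy) hd hoff
      refine ⟨fun a b => ?_, h4.trans (by rw [arcs_congr (s := s2) (by simp)]; omega)⟩
      rw [h3, AdjR_congr (s := s2) (by simp) (by simp) (by simp), h1', or_assoc]
      refine or_congr_right ⟨?_, ?_⟩
      · rintro (⟨h5, h6, h7⟩ | ⟨b', h5, h6, h7⟩)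
        · exact ⟨y, w, h6, h7, .inl ⟨y, h5, hd, rfl, rfl⟩⟩
        · refine ⟨w, b', h5, h6, .inr ⟨hoff, rfl, ?_⟩⟩
          rcases h7 with ⟨h7, h8⟩ | ⟨h7, h8⟩ | h7
          · exact .inr (.inl ⟨y, h7, hd, h8⟩)
          · exact .inr (.inr (.inl ⟨y, hd, h7, h8⟩))
          · exact .inr (.inr (.inr h7))
      · rintro ⟨a', b', h5, h6, ⟨v, h7, h8, rfl, rfl⟩ | ⟨_, rfl, h7⟩⟩
        · rw [hd] at h8
          obtain rfl := Option.some.inj h8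
          exact .inl ⟨h7, h5, h6⟩
        · refine .inr ⟨b', h5, h6, ?_⟩
          rcases h7 with ⟨h7, _⟩ | ⟨v, h7, h8, h9⟩ | ⟨v, h7, h8, h9⟩ | h7
          · simp [hd] at h7
          · rw [hd] at h8
            obtain rfl := Option.some.inj h8
            exact .inl ⟨h7, h9⟩
          · rw [hd] at h7
            obtain rfl := Option.some.inj h7
            exact .inr (.inl ⟨h8, h9⟩)
          · exact .inr (.inr h7)
    · rw [show ev (table Z) (.ifnz .t .skip arcsOff) s2 = s2.tick.tick by simp [ev, e2t, h0]]
      refine ⟨fun a b => ?_, by change arcs n s2 ≤ _; omega⟩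
      rw [AdjR_congr (s := s2) (by simp) (by simp) (by simp), h1']
      refine or_congr_right ⟨?_, ?_⟩
      · rintro ⟨h5, h6, h7⟩
        exact ⟨y, w, h6, h7, .inl ⟨y, h5, hd, rfl, rfl⟩⟩
      · rintro ⟨a', b', h5, h6, ⟨v, h7, h8, rfl, rfl⟩ | ⟨h7, _⟩⟩
        · rw [hd] at h8
          obtain rfl := Option.some.inj h8
          exact ⟨h7, h5, h6⟩
        · exact absurd (hmem.mp h0) h7

/-- Build the digraph `Forces u`. -/
def build : Cmd := clr .dg ;; .loop .x §.k (walk ;; .loop .w §.n arcsAt)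

/-- Three arcs per state and symbol bound the total degree by `3 * n * k`. This bound is what fixes
the number of iterations of the search. -/
theorem build_spec {s : St} (hn : s.v .n = n) (hk : s.v .k = k) {u : Fin n} (hu : s.v .u = u)
    (hcy : ∀ w x, s.a .cy (w : Fin n) (x : Fin k) ≠ 0 ↔ Z.OnCycle x w) :
    (∀ a < n, ∀ b < n, AdjR (ev (table Z) build s) a b ↔
      ∃ a' b' : Fin n, a = a' ∧ b = b' ∧ Z.Forces u a' b') ∧
      (∀ a < n, ∀ b, Adj (ev (table Z) build s) a b → b < n) ∧
      arcs n (ev (table Z) build s) ≤ 3 * n * k := by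
  set s0 := ev (table Z) (clr .dg) s with hs0
  have f0 : Frame (clr .dg) s s0 := frame_ev _ _
  have e0 : ∀ a < n, ∀ b, ¬ Adj s0 a b := by
    rintro a ha b ⟨l, hl, -⟩
    have := clr_spec (T := table Z) .dg s (i := a) (by omega)
    rw [← hs0] at this
    omega
  obtain ⟨s', hf, ⟨hadj, harc⟩, he⟩ := loop_rule (table Z) .x §.k (walk ;; .loop .w §.n arcsAt) s0
    (fun i s' => (∀ a b, AdjR s' a b ↔ AdjR s0 a b ∨ ∃ a' b' : Fin n, a = a' ∧ b = b' ∧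
      ∃ x w, x.val < i ∧ ArcAt Z u x w a' b') ∧ arcs n s' ≤ 3 * n * i) (by
      refine ⟨fun a b => ?_, ?_⟩
      · rw [or_iff_left (by rintro ⟨_, _, _, _, _, _, h, _⟩; omega)]
        rfl
      · refine (Finset.sum_eq_zero fun a ha => ?_).le
        exact clr_spec (T := table Z) .dg s (i := a) (by rw [hn]; exact Finset.mem_range.mp ha)) (by
      rintro i s' hi hf ⟨h1, h2⟩
      simp only [Opd.val_var, f0.v .k rfl, hk] at hi
      set s1 := (s'.setV .x i).tick with hs1
      set s2 := ev (table Z) walk s1 with hs2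
      have f2 : Frame walk s1 s2 := frame_ev _ _
      have e1n : s1.v .n = n := by simp [hs1, hf.v .n rfl, f0.v .n rfl, hn]
      have e1u : s1.v .u = u := by simp [hs1, hf.v .u rfl, f0.v .u rfl, hu]
      have e1cy : s1.a .cy = s.a .cy := by simp [hs1, hf.a .cy rfl, f0.a .cy rfl]
      have hwk : Walked Z ⟨i, hi⟩ u s2 := walk_spec e1n e1u (by simp [hs1])
      obtain ⟨s3, f3, ⟨h3, h4⟩, he⟩ := loop_rule (table Z) .w §.n arcsAt s2
        (fun j s' => (∀ a b, AdjR s' a b ↔ AdjR s2 a b ∨ ∃ a' b' : Fin n, a = a' ∧ b = b' ∧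
          ∃ w, w.val < j ∧ ArcAt Z u ⟨i, hi⟩ w a' b') ∧ arcs n s' ≤ arcs n s2 + 3 * j) (by
          refine ⟨fun a b => ?_, le_rfl⟩
          rw [or_iff_left (by rintro ⟨_, _, _, _, _, h, _⟩; omega)]
          rfl) (by
          rintro j s3 hj f3 ⟨h3, h4⟩
          simp only [Opd.val_var, f2.v .n rfl, e1n] at hj
          have hwk3 : Walked Z ⟨i, hi⟩ u (s3.setV .w j).tick := by
            obtain ⟨l, hl, hlast⟩ := hwk.last
            refine ⟨⟨l, ?_, hlast⟩, fun v => ?_, fun p v hp => ?_⟩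
            · simp [f3.v .cur rfl, hl]
            · simpa [f3.a .ip rfl] using hwk.mem v
            · simpa [f3.a .pp rfl] using hwk.pred p v hp
          obtain ⟨h5, h6⟩ := arcsAt_spec (Z := Z) (s := (s3.setV .w j).tick) (u := u) (x := ⟨i, hi⟩)
            (w := ⟨j, hj⟩) (by simp [f3.v .u rfl, f2.v .u rfl, e1u])
            (by simp [f3.v .x rfl, f2.v .x rfl, hs1]) (by simp) hwk3
            (by simpa [f3.a .cy rfl, f2.a .cy rfl, e1cy] using hcy)
          refine ⟨fun a b => ?_, ?_⟩
          · rw [h5, AdjR_congr (s := s3) (by simp) (by simp) (by simp), h3, or_assoc]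
            refine or_congr_right ⟨?_, ?_⟩
            · rintro (⟨a', b', ha, hb, w, hw, h⟩ | ⟨a', b', ha, hb, h⟩)
              · exact ⟨a', b', ha, hb, w, by omega, h⟩
              · exact ⟨a', b', ha, hb, ⟨j, hj⟩, Nat.lt_succ_self _, h⟩
            · rintro ⟨a', b', ha, hb, w, hw, h⟩
              rcases Nat.lt_succ_iff_lt_or_eq.mp hw with hw | hw
              · exact .inl ⟨a', b', ha, hb, w, hw, h⟩
              · obtain rfl : w = ⟨j, hj⟩ := Fin.ext hw
                exact .inr ⟨a', b', ha, hb, h⟩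
          · rw [arcs_congr (s := s3) (s' := (s3.setV .w j).tick) (by simp)] at h6
            omega)
      have e2n : Opd.val s2 §.n = n := by simp [f2.v .n rfl, e1n]
      have : ev (table Z) (walk ;; .loop .w §.n arcsAt) s1 = (s3.setV .w n).tick := by
        rw [e2n] at he; exact he
      rw [this]
      rw [e2n] at h3 h4
      have h21 : ∀ a b, AdjR s2 a b ↔ AdjR s' a b :=
        AdjR_congr (by simp [f2.v .rv rfl, hs1]) (by simp [f2.a .dg rfl, hs1])
          (by simp [f2.a .ad rfl, hs1])
      refine ⟨fun a b => ?_, ?_⟩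
      · rw [AdjR_congr (s := s3) (by simp) (by simp) (by simp), h3, h21, h1, or_assoc]
        refine or_congr_right ⟨?_, ?_⟩
        · rintro (⟨a', b', ha, hb, x, w, hw, h⟩ | ⟨a', b', ha, hb, w, _, h⟩)
          · exact ⟨a', b', ha, hb, x, w, by omega, h⟩
          · exact ⟨a', b', ha, hb, ⟨i, hi⟩, w, Nat.lt_succ_self _, h⟩
        · rintro ⟨a', b', ha, hb, x, w, hx, h⟩
          rcases Nat.lt_succ_iff_lt_or_eq.mp hx with hx | hx
          · exact .inl ⟨a', b', ha, hb, x, w, hx, h⟩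
          · obtain rfl : x = ⟨i, hi⟩ := Fin.ext hx
            exact .inr ⟨a', b', ha, hb, w, w.2, h⟩
      · rw [arcs_congr (s := s3) (by simp)]
        rw [arcs_congr (s := s') (s' := s2) (by simp [f2.a .dg rfl, hs1])] at h4
        rw [Nat.mul_succ]
        omega)
  have e1 : Opd.val s0 §.k = k := by simp [f0.v .k rfl, hk]
  have : ev (table Z) build s = (s'.setV .x k).tick := by
    rw [e1] at he; exact he
  rw [e1] at hadj harc
  rw [this]
  have hadj' : ∀ a b, AdjR (s'.setV .x k).tick a b ↔ AdjR s0 a b ∨ ∃ a' b' : Fin n, a = a' ∧ b = b' ∧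
      Z.Forces u a' b' := by
    intro a b
    rw [AdjR_congr (s := s') (by simp) (by simp) (by simp), hadj]
    simp only [forces_iff, Fin.is_lt, true_and]
  refine ⟨fun a ha b hb => ?_, fun a ha b hab => ?_, harc⟩
  · rw [hadj', or_iff_right]
    simp only [AdjR]
    split
    · exact e0 b hb a
    · exact e0 a ha b
  · have hrv : (s'.setV .x k).tick.v .rv = s0.v .rv := by simp [hf.v .rv rfl]
    by_cases hr : s0.v .rv ≠ 0
    · have h1 := hadj' b a
      simp only [AdjR, hrv, if_pos hr] at h1
      obtain ⟨a', b', h2, -⟩ := (h1.mp hab).resolve_left (e0 a ha b)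
      omega
    · have h1 := hadj' a b
      simp only [AdjR, hrv, if_neg hr] at h1
      obtain ⟨a', b', -, h2, -⟩ := (h1.mp hab).resolve_left (e0 a ha b)
      omega

end Imp

namespace Imp

open Relation

variable {T : ℕ → ℕ → ℕ}

/-! ### Breadth-first search -/

def searchInit : Cmd :=
  clr .vi ;; .put .vi §.root (.lit 0) (.lit 1) ;; .put .qu (.lit 0) (.lit 0) §.root ;;
  .set .ql (.lit 1) ;; .set .qi (.lit 0) ;; .set .e (.lit 0)

def searchArc : Cmd :=
  .get .y .ad §.a §.e ;; .inc .e ;; .get .t .vi §.y (.lit 0) ;;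
  .ifnz .t .skip (.put .vi §.y (.lit 0) (.lit 1) ;; .put .qu §.ql (.lit 0) §.y ;; .inc .ql)

def searchStep : Cmd :=
  .ifeq §.qi §.ql .skip (.get .a .qu §.qi (.lit 0) ;; .get .d .dg §.a (.lit 0) ;;
    .ifeq §.e §.d (.inc .qi ;; .set .e (.lit 0)) searchArc)

/-- Mark everything that can be reached from `root`. -/
def search : Cmd := searchInit ;; .loop .z §.bn searchStep

/-- The state of a search for the vertices that can be reached from `r` in a digraph `D`, after `i`
steps. -/
structure Searching (n : ℕ) (s0 : St) (r i : ℕ) (s : St) : Prop where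
  first : 0 < s.v .ql ∧ s.a .qu 0 0 = r
  le : s.v .qi ≤ s.v .ql
  lt : ∀ l < s.v .ql, s.a .qu l 0 < n
  inj : ∀ l l', l < l' → l' < s.v .ql → s.a .qu l 0 ≠ s.a .qu l' 0
  vi : ∀ w < n, s.a .vi w 0 ≠ 0 ↔ ∃ l < s.v .ql, s.a .qu l 0 = w
  reach : ∀ l < s.v .ql, ReflTransGen (Adj s0) r (s.a .qu l 0)
  closed : ∀ l < s.v .qi, ∀ y, Adj s0 (s.a .qu l 0) y → s.a .vi y 0 ≠ 0
  part : s.v .qi < s.v .ql → s.v .e ≤ s0.a .dg (s.a .qu (s.v .qi) 0) 0 ∧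
    ∀ j < s.v .e, s.a .vi (s0.a .ad (s.a .qu (s.v .qi) 0) j) 0 ≠ 0
  progress : s.v .qi = s.v .ql ∨
    i = (∑ l ∈ Finset.range (s.v .qi), (s0.a .dg (s.a .qu l 0) 0 + 1)) + s.v .e

/-- A step either examines one arc of the vertex at the front of the queue or retires this vertex.
The clause `progress` says that no step is wasted while the queue is nonempty. -/
theorem searchStep_spec {n r i : ℕ} {s0 s : St} (hdg : s.a .dg = s0.a .dg) (had : s.a .ad = s0.a .ad)
    (hadj : ∀ a < n, ∀ b, Adj s0 a b → b < n) (h : Searching n s0 r i s) :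
    Searching n s0 r (i + 1) (ev T searchStep s) := by
  by_cases h1 : s.v .qi = s.v .ql
  · have e : ev T searchStep s = s.tick.tick := by simp [searchStep, ev, h1]
    rw [e]
    exact ⟨h.first, h.le, h.lt, h.inj, h.vi, h.reach, h.closed, h.part, .inl h1⟩
  have hlt : s.v .qi < s.v .ql := lt_of_le_of_ne h.le h1
  have hpart := h.part hlt
  set p := s.a .qu (s.v .qi) 0 with hp
  have hpr := h.progress.resolve_left h1
  by_cases h2 : s.v .e = s0.a .dg p 0
  · set s1 := ((((s.tick.setV .a p).tick.setV .d (s0.a .dg p 0)).tick.tick.setV .qi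
      (s.v .qi + 1)).tick.setV .e 0).tick with hs1
    have e : ev T searchStep s = s1 := by
      simp [searchStep, ev, h1, ← hp, hdg, h2, hs1]
    rw [e]
    have eql : s1.v .ql = s.v .ql := by simp [hs1]
    have eqi : s1.v .qi = s.v .qi + 1 := by simp [hs1]
    have ee : s1.v .e = 0 := by simp [hs1]
    have ea : s1.a = s.a := by simp [hs1]
    refine ⟨by rw [eql, ea]; exact h.first, by rw [eql, eqi]; omega, by rw [eql, ea]; exact h.lt,
      by rw [eql, ea]; exact h.inj, by rw [eql, ea]; exact h.vi, by rw [eql, ea]; exact h.reach, ?_, ?_, ?_⟩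
    · rw [eqi, ea]
      rintro l hl y ⟨j, hj, hy⟩
      rcases Nat.lt_succ_iff_lt_or_eq.mp hl with hl | rfl
      · exact h.closed l hl y ⟨j, hj, hy⟩
      · rw [← hp] at hj hy
        rw [← hy]
        exact hpart.2 j (by omega)
    · intro _
      rw [ee]
      exact ⟨Nat.zero_le _, by omega⟩
    · right
      rw [eqi, ee, ea, Finset.sum_range_succ, ← hp]
      omega
  have hpn : p < n := h.lt _ hlt
  have hey : s.v .e < s0.a .dg p 0 := by omega
  set y := s0.a .ad p (s.v .e) with hy
  have hyn : y < n := hadj p hpn y ⟨_, hey, rfl⟩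
  by_cases h3 : s.a .vi y 0 = 0
  · set s1 := ((((((((s.tick.setV .a p).tick.setV .d (s0.a .dg p 0)).tick.tick.setV .y y).tick.setV .e
      (s.v .e + 1)).tick.setV .t 0).tick.tick.setA .vi y 0 1).tick.setA .qu (s.v .ql) 0 y).tick.setV .ql
      (s.v .ql + 1)).tick with hs1
    have e : ev T searchStep s = s1 := by
      simp [searchStep, searchArc, ev, h1, ← hp, hdg, had, h2, hs1, ← hy, h3]
    rw [e]
    have eql : s1.v .ql = s.v .ql + 1 := by simp [hs1]
    have eqi : s1.v .qi = s.v .qi := by simp [hs1]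
    have ee : s1.v .e = s.v .e + 1 := by simp [hs1]
    have evi : ∀ w, s1.a .vi w 0 = if w = y then 1 else s.a .vi w 0 := by simp [hs1]
    have equ : ∀ l, s1.a .qu l 0 = if l = s.v .ql then y else s.a .qu l 0 := by simp [hs1]
    have equ' : ∀ l < s.v .ql, s1.a .qu l 0 = s.a .qu l 0 := by
      intro l hl; rw [equ, if_neg (by omega)]
    have equq : s1.a .qu (s.v .ql) 0 = y := by rw [equ, if_pos rfl]
    have evi' : ∀ w, s.a .vi w 0 ≠ 0 → s1.a .vi w 0 ≠ 0 := by
      intro w hw; rw [evi]; split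
      · omega
      · exact hw
    have hfresh : ∀ l < s.v .ql, s.a .qu l 0 ≠ y := fun l hl hly => (h.vi y hyn).mpr ⟨l, hl, hly⟩ h3
    refine ⟨⟨by omega, by rw [equ' 0 h.first.1]; exact h.first.2⟩, by omega, ?_, ?_, ?_, ?_, ?_, ?_, ?_⟩
    · intro l hl
      rw [equ]
      split
      · exact hyn
      · exact h.lt l (by omega)
    · intro l l' hl hl'
      rw [eql] at hl'
      rw [equ' l (by omega)]
      rcases Nat.lt_succ_iff_lt_or_eq.mp hl' with hl' | rfl
      · rw [equ' l' hl']; exact h.inj l l' hl hl'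
      · rw [equq]; exact hfresh l hl
    · intro w hw
      rw [eql]
      by_cases hwy : w = y
      · rw [evi, if_pos hwy]
        simp only [ne_eq, one_ne_zero, not_false_eq_true, true_iff]
        exact ⟨s.v .ql, Nat.lt_succ_self _, by rw [equq, hwy]⟩
      · rw [evi, if_neg hwy, h.vi w hw]
        constructor
        · rintro ⟨l, hl, hlw⟩
          exact ⟨l, by omega, by rw [equ' l hl, hlw]⟩
        · rintro ⟨l, hl, hlw⟩
          rcases Nat.lt_succ_iff_lt_or_eq.mp hl with hl | rfl
          · exact ⟨l, hl, by rw [← equ' l hl, hlw]⟩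
          · exact absurd (hlw.symm.trans equq) hwy
    · intro l hl
      rw [eql] at hl
      rcases Nat.lt_succ_iff_lt_or_eq.mp hl with hl | rfl
      · rw [equ' l hl]; exact h.reach l hl
      · rw [equq]; exact (h.reach _ hlt).tail ⟨_, hey, rfl⟩
    · intro l hl y' hy'
      rw [eqi] at hl
      rw [equ' l (by omega)] at hy'
      exact evi' _ (h.closed l hl y' hy')
    · intro _
      rw [eqi, ee, equ' _ hlt, ← hp]
      refine ⟨hey, fun j hj => ?_⟩
      rcases Nat.lt_succ_iff_lt_or_eq.mp hj with hj | rfl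
      · exact evi' _ (hpart.2 j hj)
      · rw [← hy, evi, if_pos rfl]; exact one_ne_zero
    · right
      rw [eqi, ee, Finset.sum_congr rfl (fun l hl => by
        rw [equ' l (by have := Finset.mem_range.mp hl; omega)])]
      omega
  · set s1 := (((((s.tick.setV .a p).tick.setV .d (s0.a .dg p 0)).tick.tick.setV .y y).tick.setV .e
      (s.v .e + 1)).tick.setV .t (s.a .vi y 0)).tick.tick.tick with hs1
    have e : ev T searchStep s = s1 := by
      simp [searchStep, searchArc, ev, h1, ← hp, hdg, had, h2, hs1, ← hy, h3]
    rw [e]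
    have eql : s1.v .ql = s.v .ql := by simp [hs1]
    have eqi : s1.v .qi = s.v .qi := by simp [hs1]
    have ee : s1.v .e = s.v .e + 1 := by simp [hs1]
    have ea : s1.a = s.a := by simp [hs1]
    refine ⟨by rw [eql, ea]; exact h.first, by rw [eql, eqi]; omega, by rw [eql, ea]; exact h.lt,
      by rw [eql, ea]; exact h.inj, by rw [eql, ea]; exact h.vi, by rw [eql, ea]; exact h.reach,
      by rw [eqi, ea]; exact h.closed, ?_, ?_⟩
    · intro _
      rw [eqi, ee, ea, ← hp]
      refine ⟨hey, fun j hj => ?_⟩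
      rcases Nat.lt_succ_iff_lt_or_eq.mp hj with hj | rfl
      · exact hpart.2 j hj
      · exact h3
    · right
      rw [eqi, ee, ea]
      omega

/-- The queue is exhausted in time: each vertex enters it at most once and costs its degree plus 1,
so an unfinished search would have made fewer than `arcs n s + n` steps. -/
theorem search_spec {n : ℕ} {s : St} (hn : s.v .n = n) (hroot : s.v .root < n)
    (hadj : ∀ a < n, ∀ b, Adj s a b → b < n) (hbn : arcs n s + n ≤ s.v .bn) :
    ∀ w < n, (ev T search s).a .vi w 0 ≠ 0 ↔ ReflTransGen (Adj s) (s.v .root) w := by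
  set s1 := ev T (clr .vi) s with hs1
  have f1 : Frame (clr .vi) s s1 := frame_ev _ _
  have e1 : ∀ w < n, s1.a .vi w 0 = 0 := fun w hw => clr_spec .vi s (by omega)
  set s2 := ev T searchInit s with hs2
  have f2 : Frame searchInit s s2 := frame_ev _ _
  have e2 : s2 = (((((s1.setA .vi (s.v .root) 0 1).tick.setA .qu 0 0 (s.v .root)).tick.setV .ql 1).tick.setV
      .qi 0).tick.setV .e 0).tick := by
    simp [hs2, searchInit, ev, ← hs1, f1.v .root rfl]
  have e2n : s2.v .bn = s.v .bn := f2.v .bn rfl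
  obtain ⟨s', hf, h, he⟩ := loop_rule T .z §.bn searchStep s2 (Searching n s (s.v .root)) (by
      have eql : s2.v .ql = 1 := by simp [e2]
      have eqi : s2.v .qi = 0 := by simp [e2]
      have ee : s2.v .e = 0 := by simp [e2]
      have equ : s2.a .qu 0 0 = s.v .root := by simp [e2]
      refine ⟨⟨by simp [eql], by simpa using equ⟩, by simp [eql, eqi], ?_, ?_, ?_, ?_, ?_, ?_, ?_⟩
      · intro l hl
        simp only [St.tick_v, eql] at hl
        obtain rfl : l = 0 := by omega
        simpa [equ] using hroot
      · intro l l' hl hl'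
        simp only [St.tick_v, eql] at hl'
        omega
      · intro w hw
        simp only [St.tick_v, eql, St.tick_a]
        have : s2.a .vi w 0 = if w = s.v .root then 1 else 0 := by simp [e2, e1 w hw]
        rw [this]
        simp [equ, eq_comm]
      · intro l hl
        simp only [St.tick_v, eql] at hl
        obtain rfl : l = 0 := by omega
        simp only [St.tick_a, equ]
        exact .refl
      · intro l hl
        simp [eqi] at hl
      · intro _
        simp [ee]
      · right
        simp [eqi, ee]) (by
      intro i s' hi hf h
      refine searchStep_spec ?_ ?_ hadj ⟨by simpa using h.first, by simpa using h.le, by simpa using h.lt,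
        by simpa using h.inj, by simpa using h.vi, by simpa using h.reach, by simpa using h.closed,
        by simpa using h.part, by simpa using h.progress⟩
      · simp [hf.a .dg rfl, f2.a .dg rfl]
      · simp [hf.a .ad rfl, f2.a .ad rfl])
  have hfin : s'.v .qi = s'.v .ql := by
    by_contra hne
    have h1 := h.progress.resolve_left hne
    have hlt : s'.v .qi < s'.v .ql := lt_of_le_of_ne h.le hne
    have h2 := (h.part hlt).1
    -- The queue entries are distinct vertices, so their degrees may be summed over all vertices
    -- instead.
    have h3 : ∑ l ∈ Finset.range (s'.v .qi + 1), (s.a .dg (s'.a .qu l 0) 0 + 1) ≤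
        ∑ p ∈ Finset.range n, (s.a .dg p 0 + 1) := by
      have hinj : Set.InjOn (fun l => s'.a .qu l 0) (Finset.range (s'.v .qi + 1) : Set ℕ) := by
        intro l hl l' hl' hll
        simp only [Finset.coe_range, Set.mem_Iio] at hl hl'
        by_contra hne
        rcases lt_or_gt_of_ne hne with hlt | hlt
        · exact h.inj l l' hlt (by omega) hll
        · exact h.inj l' l hlt (by omega) hll.symm
      rw [← Finset.sum_image (f := fun p => s.a .dg p 0 + 1) hinj]
      refine Finset.sum_le_sum_of_subset fun p hp => ?_
      obtain ⟨l, hl, rfl⟩ := Finset.mem_image.mp hp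
      exact Finset.mem_range.mpr (h.lt l (by have := Finset.mem_range.mp hl; omega))
    rw [Finset.sum_range_succ, Finset.sum_add_distrib (s := Finset.range n)] at h3
    simp only [Finset.sum_const, Finset.card_range, smul_eq_mul, mul_one] at h3
    simp only [Opd.val_var, e2n] at h1
    unfold arcs at hbn
    omega
  have : ev T search s = (s'.setV .z (Opd.val s2 §.bn)).tick := by
    rw [← he]; rfl
  rw [this]
  intro w hw
  change s'.a .vi w 0 ≠ 0 ↔ _
  constructor
  · intro hv
    obtain ⟨l, hl, rfl⟩ := (h.vi w hw).mp hv
    exact h.reach l hl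
  · intro hr
    have : ∀ w, ReflTransGen (Adj s) (s.v .root) w → w < n ∧ s'.a .vi w 0 ≠ 0 := by
      intro w hr
      induction hr with
      | refl => exact ⟨hroot, (h.vi _ hroot).mpr ⟨0, h.first.1, h.first.2⟩⟩
      | @tail b c _ hbc ih =>
        obtain ⟨l, hl, rfl⟩ := (h.vi b ih.1).mp ih.2
        exact ⟨hadj _ ih.1 _ hbc, h.closed l (by omega) c hbc⟩
    exact (this w hr).2

end Imp

/-! ### Searching in the forcing digraph, forwards and backwards. -/

namespace Imp

open Relation

variable {n k : ℕ} {Z : FSM (Fin n) (Fin k)}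

/-- The values that all parts of the program rely on. -/
structure Ctx (Z : FSM (Fin n) (Fin k)) (s : St) : Prop where
  hn : s.v .n = n
  hk : s.v .k = k
  hs : s.v .s = Z.start
  hm : s.v .m = 3 * n
  hbn : s.v .bn = 3 * n * k + n
  cy : ∀ w x, s.a .cy (w : Fin n) (x : Fin k) ≠ 0 ↔ Z.OnCycle x w

/-- The command does not change the context. -/
def Cmd.keeps (c : Cmd) : Bool :=
  !c.modV .n && !c.modV .k && !c.modV .s && !c.modV .m && !c.modV .bn && !c.modA .cy

theorem Ctx.of_frame {s s' : St} {c : Cmd} (h : Ctx Z s) (hf : Frame c s s') (hc : c.keeps = true) :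
    Ctx Z s' := by
  simp only [Cmd.keeps, Bool.and_eq_true, Bool.not_eq_true'] at hc
  exact ⟨by rw [hf.v _ hc.1.1.1.1.1, h.hn], by rw [hf.v _ hc.1.1.1.1.2, h.hk],
    by rw [hf.v _ hc.1.1.1.2, h.hs], by rw [hf.v _ hc.1.1.2, h.hm], by rw [hf.v _ hc.1.2, h.hbn],
    by rw [hf.a _ hc.2]; exact h.cy⟩

theorem Ctx.setV {s : St} (h : Ctx Z s) (x : Var) (c : ℕ)
    (hx : x ≠ .n ∧ x ≠ .k ∧ x ≠ .s ∧ x ≠ .m ∧ x ≠ .bn) : Ctx Z (s.setV x c) :=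
  ⟨by simp [hx.1.symm, h.hn], by simp [hx.2.1.symm, h.hk], by simp [hx.2.2.1.symm, h.hs],
    by simp [hx.2.2.2.1.symm, h.hm], by simp [hx.2.2.2.2.symm, h.hbn], h.cy⟩

theorem Ctx.tick {s : St} (h : Ctx Z s) : Ctx Z s.tick := ⟨h.hn, h.hk, h.hs, h.hm, h.hbn, h.cy⟩

theorem reflTransGen_fin {R : Fin n → Fin n → Prop} {E : ℕ → ℕ → Prop}
    (hE : ∀ a : Fin n, ∀ b, E a b ↔ ∃ b' : Fin n, b = b' ∧ R a b') (a b : Fin n) :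
    ReflTransGen E a b ↔ ReflTransGen R a b := by
  constructor
  · intro h
    have : ∀ c, ReflTransGen E a c → ∃ c' : Fin n, c = c' ∧ ReflTransGen R a c' := by
      intro c hc
      induction hc with
      | refl => exact ⟨a, rfl, .refl⟩
      | tail _ hbc ih =>
        obtain ⟨b', rfl, h1⟩ := ih
        obtain ⟨c', rfl, h2⟩ := (hE _ _).mp hbc
        exact ⟨c', rfl, h1.tail h2⟩
    obtain ⟨c', h1, h2⟩ := this b h
    rwa [Fin.ext h1]
  · intro h
    induction h with
    | refl => exact .refl
    | tail _ hbc ih => exact ih.tail ((hE _ _).mpr ⟨_, rfl, hbc⟩)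

/-- Search in the digraph `Forces u`. -/
def reach : Cmd := build ;; search

/-- With the arcs stored in reverse, the same search finds everything from which `root` can be
reached, instead of everything that `root` reaches. -/
theorem reach_spec {s : St} (h : Ctx Z s) {u r : Fin n} (hu : s.v .u = u) (hr : s.v .root = r) :
    (s.v .rv = 0 → ∀ w : Fin n, (ev (table Z) reach s).a .vi w 0 ≠ 0 ↔
      ReflTransGen (Z.Forces u) r w) ∧
    (s.v .rv ≠ 0 → ∀ w : Fin n, (ev (table Z) reach s).a .vi w 0 ≠ 0 ↔
      ReflTransGen (Z.Forces u) w r) := by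
  obtain ⟨h1, h2, h3⟩ := build_spec h.hn h.hk hu h.cy
  set s1 := ev (table Z) build s with hs1
  have f1 : Frame build s s1 := frame_ev _ _
  have c1 := h.of_frame f1 rfl
  have e1 : s1.v .root = r := by rw [f1.v .root rfl, hr]
  have h4 := search_spec (T := table Z) c1.hn (by rw [e1]; exact r.2) h2 (by rw [c1.hbn]; omega)
  rw [e1] at h4
  have hrv : s1.v .rv = s.v .rv := f1.v .rv rfl
  constructor
  · intro hz w
    refine (h4 w w.2).trans (reflTransGen_fin (fun a b => ?_) r w)
    constructor
    · intro hab
      have hb := h2 a a.2 b hab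
      have := h1 a a.2 b hb
      simp only [AdjR, hrv, hz, ne_eq, not_true_eq_false, if_false] at this
      obtain ⟨a', b', h5, h6, h7⟩ := this.mp hab
      rw [Fin.ext h5]
      exact ⟨b', h6, h7⟩
    · rintro ⟨b', rfl, h7⟩
      have := h1 a a.2 b' b'.2
      simp only [AdjR, hrv, hz, ne_eq, not_true_eq_false, if_false] at this
      exact this.mpr ⟨a, b', rfl, rfl, h7⟩
  · intro hz w
    rw [← reflTransGen_swap]
    refine (h4 w w.2).trans (reflTransGen_fin (fun a b => ?_) r w)
    constructor
    · intro hab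
      have hb := h2 a a.2 b hab
      have := h1 b hb a a.2
      simp only [AdjR, hrv, hz, ne_eq, not_false_eq_true, if_true] at this
      obtain ⟨a', b', h5, h6, h7⟩ := this.mp hab
      rw [Fin.ext h6]
      exact ⟨a', h5, h7⟩
    · rintro ⟨b', rfl, h7⟩
      have := h1 b' b'.2 a a.2
      simp only [AdjR, hrv, hz, ne_eq, not_false_eq_true, if_true] at this
      exact this.mpr ⟨b', a, rfl, rfl, h7⟩

/-! ### The relation `Admits` -/

def admitsRow : Cmd :=
  .loop .w §.n (.get .t .vi §.w (.lit 0) ;;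
    .ifnz .t (.put .va §.u §.w (.lit 0)) (.put .va §.u §.w (.lit 1)))

/-- A backward search from the start marks all `w` that force the start into a module entered at
`u`, so a single search decides `Admits u w` for every `w`. If `u` is the start, nothing is to be
excluded and the marks are cleared. -/
def admitsAt : Cmd := .ifeq §.u §.s (clr .vi) reach ;; admitsRow

/-- Compute the relation `Admits`. -/
def admits : Cmd := .set .rv (.lit 1) ;; .set .root §.s ;; .loop .u §.n admitsAt

theorem admits_spec {s : St} (h : Ctx Z s) (u w : Fin n) :
    (ev (table Z) admits s).a .va u w ≠ 0 ↔ Z.Admits u w := by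
  set s0 := ((s.setV .rv 1).tick.setV .root (s.v .s)).tick with hs0
  have c0 : Ctx Z s0 := ((h.setV .rv 1 (by simp)).tick.setV .root _ (by simp)).tick
  obtain ⟨s', hf, h1, he⟩ := loop_rule (table Z) .u §.n admitsAt s0
    (fun i s' => ∀ u w : Fin n, u.val < i → (s'.a .va u w ≠ 0 ↔ Z.Admits u w)) (by simp) (by
      intro i s' hi hf h1
      simp only [Opd.val_var, c0.hn] at hi
      have c1 := ((c0.of_frame hf rfl).setV .u i (by simp)).tick
      set s1 := (s'.setV .u i).tick with hs1
      set s2 := ev (table Z) (.ifeq §.u §.s (clr .vi) reach) s1 with hs2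
      have f2 : Frame (.ifeq §.u §.s (clr .vi) reach) s1 s2 := frame_ev _ _
      have c2 := c1.of_frame f2 rfl
      have e1u : s1.v .u = i := by simp [hs1]
      have e2u : s2.v .u = i := by rw [f2.v .u rfl, e1u]
      have hvi : ∀ w : Fin n, s2.a .vi w 0 = 0 ↔ Z.Admits ⟨i, hi⟩ w := by
        intro w
        by_cases his : i = Z.start
        · have : s2 = ev (table Z) (clr .vi) s1.tick := by simp [hs2, ev, e1u, c1.hs, his]
          rw [this, clr_spec .vi s1.tick (by simp [c1.hn])]
          exact ⟨fun _ => .inl (Fin.ext his), fun _ => rfl⟩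
        · have : s2 = ev (table Z) reach s1.tick := by simp [hs2, ev, e1u, c1.hs, his]
          have h3 := (reach_spec (Z := Z) (s := s1.tick) c1.tick (u := ⟨i, hi⟩) (r := Z.start)
            (by simp [e1u]) (by simp [hs1, hf.v .root rfl, hs0, h.hs])).2
            (by simp [hs1, hf.v .rv rfl, hs0]) w
          rw [← this] at h3
          rw [FSM.Admits, ← h3, not_not, or_iff_right]
          intro h4
          exact his (congrArg Fin.val h4)
      obtain ⟨h3, h4⟩ := fill_one (T := table Z) (x := .w) (o := §.n)
        (c := .get .t .vi §.w (.lit 0) ;; .ifnz .t (.put .va §.u §.w (.lit 0)) (.put .va §.u §.w (.lit 1)))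
        (s := s2) .va (fun _ => i) (fun j => j) (fun j c => c ≠ 0 ↔ s2.a .vi j 0 = 0)
        (fun i j _ hj => .inr (by omega)) (by
          intro j s3 hj f3 hw
          have e3u : s3.v .u = i := by rw [f3.v .u rfl, e2u]
          simp only [ev]
          simp only [Opd.val_var, Opd.val_lit, St.tick_v, St.setV_v, if_true, hw, f3.a .vi rfl]
          split <;> rename_i h5
          · refine ⟨by simp [e3u, h5], fun i' j' hij => ?_⟩
            simp [e3u]
            omega
          · refine ⟨by simpa [e3u, hw] using h5, fun i' j' hij => ?_⟩
            simp [e3u]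
            omega)
      change ∀ u w : Fin n, u.val < i + 1 → ((ev (table Z) admitsRow s2).a .va u w ≠ 0 ↔ _)
      intro u w hu
      rcases Nat.lt_succ_iff_lt_or_eq.mp hu with hu | hu
      · have := h4 u w (fun _ _ => .inl (by omega))
        rw [admitsRow, this, f2.a .va rfl]
        exact h1 u w hu
      · have := h3 w (by simp [c2.hn])
        obtain rfl : u = ⟨i, hi⟩ := Fin.ext hu
        rw [admitsRow, ← hvi w]
        exact this)
  have : ev (table Z) admits s = (s'.setV .u (Opd.val s0 §.n)).tick := by
    rw [← he]; rfl
  rw [this]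
  exact h1 u w (by simp [c0.hn])

end Imp

namespace Imp

open Relation

variable {n k : ℕ} {Z : FSM (Fin n) (Fin k)}

/-! ### The table of candidates for the indecomposable thin modules -/

/-- A row of the table: a set, its entry, its exits, and a flag. -/
structure Row where
  ro : ℕ → ℕ
  en : ℕ → ℕ
  ex : ℕ → ℕ
  ok : ℕ → ℕ

def St.row (s : St) (r : ℕ) : Row := ⟨s.a .ro r, s.a .en r, s.a .ex r, s.a .ok r⟩

theorem Frame.row {c : Cmd} {s s' : St} (h : Frame c s s') (h1 : c.modA .ro = false)
    (h2 : c.modA .en = false) (h3 : c.modA .ex = false) (h4 : c.modA .ok = false) (r : ℕ) :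
    s'.row r = s.row r := by
  simp only [St.row, h.a _ h1, h.a _ h2, h.a _ h3, h.a _ h4]

/-- The row describes `hull u v`. -/
structure IsRow (Z : FSM (Fin n) (Fin k)) (R : Row) (u v : Fin n) : Prop where
  mem : ∀ q : Fin n, R.ro q ≠ 0 ↔ q ∈ Z.hull u v
  entry : R.en 0 = u
  no_exit : ∀ x : Fin k, R.ex x = 0 → ∀ e, ¬ Z.IsExit (Z.hull u v) x e
  exit : ∀ x : Fin k, R.ex x ≠ 0 → ∃ e : Fin n, R.ex x = e + 1 ∧ Z.IsExit (Z.hull u v) x e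

def copyStep : Cmd := .get .t .vi §.q (.lit 0) ;; .put .ro §.r §.q §.t

def exitStep : Cmd :=
  .get .d .ro §.r §.q ;;
  .ifnz .d (.tab .y §.q §.x ;;
    .ifnz .y (.set .d §.y ;; .dec .d ;; .get .d .ro §.r §.d ;; .ifnz .d .skip (.set .t §.y)) .skip) .skip

def exitAt : Cmd := .set .t (.lit 0) ;; .loop .q §.n exitStep ;; .put .ex §.r §.x §.t

def mkSet : Cmd := reach ;; .loop .q §.n copyStep ;; .put .ro §.r §.u (.lit 1) ;; .put .en §.r (.lit 0) §.u

/-- Fill row `r` with `hull u root`. -/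
def mkRow : Cmd := mkSet ;; .loop .x §.k exitAt

/-- The search starts at `v` and need not meet the entry `u`, which is therefore added separately.
-/
theorem mkSet_spec {s : St} (h : Ctx Z s) {u v : Fin n} {r : ℕ} (hu : s.v .u = u)
    (hv : s.v .root = v) (hr : s.v .r = r) (hrv : s.v .rv = 0) :
    (∀ q : Fin n, (ev (table Z) mkSet s).a .ro r q ≠ 0 ↔ q ∈ Z.hull u v) ∧
    (ev (table Z) mkSet s).a .en r 0 = u ∧
    ∀ r' ≠ r, (ev (table Z) mkSet s).row r' = s.row r' := by
  have h1 := (reach_spec h hu hv).1 hrv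
  set s1 := ev (table Z) reach s with hs1
  have f1 : Frame reach s s1 := frame_ev _ _
  have c1 := h.of_frame f1 rfl
  obtain ⟨h2, h3⟩ := fill_one (T := table Z) (x := .q) (o := §.n) (c := copyStep) (s := s1) .ro
    (fun _ => r) (fun j => j) (fun j c => c = s1.a .vi j 0) (fun i j _ hj => .inr (by omega)) (by
      intro j s2 hj f2 hq
      have e2r : s2.v .r = r := by rw [f2.v .r rfl, f1.v .r rfl, hr]
      simp only [copyStep, ev]
      refine ⟨?_, fun i' j' hij => ?_⟩
      · simp [e2r, hq, f2.a .vi rfl]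
      · simp [e2r, hq]
        omega)
  set s2 := ev (table Z) (.loop .q §.n copyStep) s1 with hs2
  have f2 : Frame (.loop .q §.n copyStep) s1 s2 := frame_ev _ _
  have e2r : s2.v .r = r := by rw [f2.v .r rfl, f1.v .r rfl, hr]
  have e2u : s2.v .u = u := by rw [f2.v .u rfl, f1.v .u rfl, hu]
  have e : ev (table Z) mkSet s = ((s2.setA .ro r u 1).tick.setA .en r 0 u).tick := by
    have : ev (table Z) mkSet s =
      ev (table Z) (.put .ro §.r §.u (.lit 1) ;; .put .en §.r (.lit 0) §.u) s2 := rfl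
    rw [this]
    simp [ev, e2r, e2u]
  rw [e]
  refine ⟨fun q => ?_, by simp, fun r' hr' => ?_⟩
  · have h4 := h2 q (by simp [c1.hn])
    simp only [St.tick_a, St.setA_a, reduceCtorEq, false_and, if_false, true_and, h4]
    by_cases hq : q = u
    · simp [hq, FSM.hull]
    · have : q.val ≠ u.val := fun h => hq (Fin.ext h)
      simp only [this, if_false, h1 q]
      simp [FSM.hull, hq]
  · have e0 : s1.row r' = s.row r' := f1.row rfl rfl rfl rfl r'
    rw [← e0]
    simp only [St.row, Row.mk.injEq]
    refine ⟨funext fun j => ?_, funext fun j => ?_, funext fun j => ?_, funext fun j => ?_⟩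
    · simp [hr']
      exact h3 r' j (fun _ _ => .inl hr')
    · simp [hr', f2.a .en rfl]
    · simp [f2.a .ex rfl]
    · simp [f2.a .ok rfl]

/-- Each symbol gets its exit plus 1, or 0 if the set is closed under it. A later exit overwrites an
earlier one; for a thin module they are equal anyway. -/
theorem mkRow_spec {s : St} (h : Ctx Z s) {u v : Fin n} {r : ℕ} (hu : s.v .u = u)
    (hv : s.v .root = v) (hr : s.v .r = r) (hrv : s.v .rv = 0) :
    IsRow Z ((ev (table Z) mkRow s).row r) u v ∧
    ∀ r' ≠ r, (ev (table Z) mkRow s).row r' = s.row r' := by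
  obtain ⟨h1, h2, h3⟩ := mkSet_spec h hu hv hr hrv
  set s1 := ev (table Z) mkSet s with hs1
  have f1 : Frame mkSet s s1 := frame_ev _ _
  have c1 := h.of_frame f1 rfl
  set M := Z.hull u v with hM
  obtain ⟨h4, h5⟩ := fill_one (T := table Z) (x := .x) (o := §.k) (c := exitAt) (s := s1) .ex
    (fun _ => r) (fun j => j) (fun j c => ∀ x : Fin k, x.val = j → (c = 0 → ∀ e, ¬ Z.IsExit M x e) ∧
      (c ≠ 0 → ∃ e : Fin n, c = e + 1 ∧ Z.IsExit M x e)) (fun i j _ hj => .inr (by omega)) (by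
      intro j s2 hj f2 hx
      simp only [Opd.val_var, c1.hk] at hj
      set x : Fin k := ⟨j, hj⟩
      have c2 := c1.of_frame f2 rfl
      have e2r : s2.v .r = r := by rw [f2.v .r rfl, f1.v .r rfl, hr]
      set s3 := (s2.setV .t 0).tick with hs3
      have c3 : Ctx Z s3 := (c2.setV .t 0 (by simp)).tick
      have e3r : s3.v .r = r := by simp [hs3, e2r]
      have e3x : s3.v .x = x := by simp [hs3, hx, x]
      obtain ⟨s4, f4, ⟨h6, h7⟩, he⟩ := loop_rule (table Z) .q §.n exitStep s3
        (fun i s' => (s'.v .t = 0 → ∀ q e : Fin n, q.val < i → q ∈ M → Z.δ q x = some e → e ∈ M) ∧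
          (s'.v .t ≠ 0 → ∃ e : Fin n, s'.v .t = e + 1 ∧ Z.IsExit M x e)) (by simp [hs3]) (by
          intro i s4 hi f4 ⟨h6, h7⟩
          simp only [Opd.val_var, c3.hn] at hi
          have e4r : s4.v .r = r := by rw [f4.v .r rfl, e3r]
          have e4x : s4.v .x = x := by rw [f4.v .x rfl, e3x]
          have e4ro : s4.a .ro = s1.a .ro := by
            rw [f4.a .ro rfl]; simp [hs3, f2.a .ro rfl]
          set q : Fin n := ⟨i, hi⟩ with hq
          have skip : ∀ s' : St, s'.v .t = s4.v .t → (q ∈ M → ∀ e, Z.δ q x = some e → e ∈ M) →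
              (s'.v .t = 0 → ∀ q e : Fin n, q.val < i + 1 → q ∈ M → Z.δ q x = some e → e ∈ M) ∧
              (s'.v .t ≠ 0 → ∃ e : Fin n, s'.v .t = e + 1 ∧ Z.IsExit M x e) := by
            intro s' e1 e2
            rw [e1]
            refine ⟨fun h0 p e hp hpM hpe => ?_, h7⟩
            rcases Nat.lt_succ_iff_lt_or_eq.mp hp with hp | hp
            · exact h6 h0 p e hp hpM hpe
            · obtain rfl : p = q := Fin.ext hp
              exact e2 hpM e hpe
          by_cases hqM : q ∈ M
          · have hro : s1.a .ro r i ≠ 0 := (h1 q).mpr hqM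
            cases hd : Z.δ q x with
            | none =>
              refine skip _ ?_ (by simp [hd])
              have ht : table Z i x = 0 := by rw [show i = q.val from rfl, table_fin, hd]; rfl
              simp [exitStep, ev, e4r, e4x, e4ro, hro, ht]
            | some e =>
              have ht : table Z i x = e + 1 := by rw [show i = q.val from rfl, table_fin, hd]; rfl
              by_cases heM : e ∈ M
              · refine skip _ ?_ (fun _ e' he' => by
                  rw [hd] at he'; obtain rfl := Option.some.inj he'; exact heM)
                have hro' : s1.a .ro r e ≠ 0 := (h1 e).mpr heM
                simp [exitStep, ev, e4r, e4x, e4ro, hro, ht, hro']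
              · have hro' : s1.a .ro r e = 0 := by
                  by_contra hne; exact heM ((h1 e).mp hne)
                have : (ev (table Z) exitStep (s4.setV .q i).tick).v .t = e + 1 := by
                  simp [exitStep, ev, e4r, e4x, e4ro, hro, ht, hro']
                rw [this]
                exact ⟨fun h0 => by omega, fun _ => ⟨e, rfl, heM, q, hqM, hd⟩⟩
          · have hro : s1.a .ro r i = 0 := by
              by_contra hne; exact hqM ((h1 q).mp hne)
            refine skip _ ?_ (fun h0 => absurd h0 hqM)
            simp [exitStep, ev, e4r, e4ro, hro])
      have e4r : s4.v .r = r := by rw [f4.v .r rfl, e3r]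
      have e4x : s4.v .x = x := by rw [f4.v .x rfl, e3x]
      have e : ev (table Z) exitAt s2 = ((s4.setV .q n).tick.setA .ex r x (s4.v .t)).tick := by
        have : ev (table Z) exitAt s2 =
          ev (table Z) (.put .ex §.r §.x §.t) (ev (table Z) (.loop .q §.n exitStep) s3) := rfl
        rw [this, he]
        simp [ev, e4r, e4x, c3.hn]
      rw [e]
      refine ⟨fun x' hx' => ?_, fun i' j' hij => ?_⟩
      · obtain rfl : x' = x := Fin.ext hx'
        have : ((s4.setV .q n).tick.setA .ex r x (s4.v .t)).tick.a .ex r j = s4.v .t := by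
          rw [← hx']; simp
        rw [this]
        refine ⟨fun h0 e ⟨he, p, hp, hd⟩ => ?_, h7⟩
        exact he (h6 h0 p e (by simp [c3.hn]) hp hd)
      · have : ¬ (i' = r ∧ j' = x.val) := by
          rintro ⟨rfl, rfl⟩; simp at hij
        simp [this, f4.a .ex rfl, hs3])
  have f5 : Frame (.loop .x §.k exitAt) s1 (ev (table Z) mkRow s) := by
    rw [hs1]; exact frame_ev _ _
  have he : ev (table Z) mkRow s = ev (table Z) (.loop .x §.k exitAt) s1 := rfl
  rw [← he] at h4 h5
  simp only [Opd.val_var, c1.hk] at h4 h5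
  refine ⟨⟨fun q => ?_, ?_, fun x => (h4 x x.2 x rfl).1, fun x => (h4 x x.2 x rfl).2⟩, fun r' hr' => ?_⟩
  · simp only [St.row]
    rw [f5.a .ro rfl]
    exact h1 q
  · simp only [St.row]
    rw [f5.a .en rfl]
    exact h2
  · rw [← h3 r' hr']
    simp only [St.row, Row.mk.injEq]
    exact ⟨by rw [f5.a .ro rfl], by rw [f5.a .en rfl], funext fun j => h5 r' j fun _ _ => .inl hr',
      by rw [f5.a .ok rfl]⟩

end Imp

/-! ### Nearest admitting states and nearest exits. -/

namespace Imp

open Relation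

variable {n k : ℕ} {Z : FSM (Fin n) (Fin k)}

/-- The matrix `va` holds the relation `Admits`. -/
def HasAdmits (Z : FSM (Fin n) (Fin k)) (s : St) : Prop :=
  ∀ u w : Fin n, s.a .va u w ≠ 0 ↔ Z.Admits u w

/-- Replace `b` by the candidate `u` if the latter is nearer; `b` is `0` if there is none yet. -/
def update : Cmd :=
  .set .y §.u ;; .inc .y ;;
  .ifnz .b (.set .d §.b ;; .dec .d ;; .get .d .va §.d §.u ;; .ifnz .d (.set .b §.y) .skip) (.set .b §.y)

/-- `b` is the nearest one among the candidates `C`. -/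
def Best (Z : FSM (Fin n) (Fin k)) (b : ℕ) (C : Fin n → Prop) : Prop :=
  (b = 0 ∧ ∀ c, ¬ C c) ∨ ∃ c : Fin n, b = c + 1 ∧ C c ∧ ∀ d, C d → Z.Admits d c

theorem update_spec (hZ : Z.Accessible) {s : St} (hva : HasAdmits Z s) {u v : Fin n} (hu : s.v .u = u)
    {C : Fin n → Prop} (huv : Z.Admits u v) (hC : ∀ c, C c → Z.Admits c v) (h : Best Z (s.v .b) C) :
    Best Z ((ev (table Z) update s).v .b) fun c => C c ∨ c = u := by
  rcases h with ⟨hb, h⟩ | ⟨b, hb, h1, h2⟩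
  · have e : (ev (table Z) update s).v .b = u + 1 := by simp [update, ev, hb, hu]
    rw [e]
    refine .inr ⟨u, rfl, .inr rfl, fun d hd => ?_⟩
    rw [hd.resolve_left (h d)]
    exact .refl u
  · by_cases hbu : Z.Admits b u
    · have hv : s.a .va b u ≠ 0 := (hva b u).mpr hbu
      have e : (ev (table Z) update s).v .b = u + 1 := by simp [update, ev, hb, hu, hv]
      rw [e]
      refine .inr ⟨u, rfl, .inr rfl, fun d hd => ?_⟩
      rcases hd with hd | rfl
      · exact (h2 d hd).trans hbu
      · exact .refl d
    · have hv : s.a .va b u = 0 := by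
        by_contra hne; exact hbu ((hva b u).mp hne)
      have e : (ev (table Z) update s).v .b = b + 1 := by simp [update, ev, hb, hu, hv]
      rw [e]
      refine .inr ⟨b, rfl, .inl h1, fun d hd => ?_⟩
      rcases hd with hd | rfl
      · exact h2 d hd
      · exact ((hC b h1).total hZ huv).resolve_left hbu

theorem Best.congr {b : ℕ} {C D : Fin n → Prop} (h : Best Z b C) (hCD : ∀ c, C c ↔ D c) :
    Best Z b D := by
  have : C = D := funext fun c => propext (hCD c)
  rwa [← this]

def nearStep : Cmd := .ifeq §.u §.v .skip (.get .t .va §.u §.v ;; .ifnz .t update .skip)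

/-- Find the nearest state, other than `v`, that admits `v`. -/
def near : Cmd := .set .b (.lit 0) ;; .loop .u §.n nearStep

/-- For `v` different from the start, the start itself is a candidate, so the result is not 0. -/
theorem near_spec (hZ : Z.Accessible) {s : St} (h : Ctx Z s) (hva : HasAdmits Z s) {v : Fin n}
    (hv : s.v .v = v) (hvs : v ≠ Z.start) :
    ∃ b : Fin n, Z.Near v b ∧ (ev (table Z) near s).v .b = b + 1 := by
  set s1 := (s.setV .b 0).tick with hs1
  obtain ⟨s', hf, h1, he⟩ := loop_rule (table Z) .u §.n nearStep s1
    (fun i s' => Best Z (s'.v .b) fun c => c.val < i ∧ c ≠ v ∧ Z.Admits c v) (by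
      refine .inl ⟨by simp [hs1], by simp⟩) (by
      intro i s' hi hf h1
      simp only [Opd.val_var, hs1, St.tick_v, St.setV_v, reduceCtorEq, if_false, h.hn] at hi
      set s2 := (s'.setV .u i).tick with hs2
      have e2u : s2.v .u = i := by simp [hs2]
      have e2v : s2.v .v = v := by simp [hs2, hf.v .v rfl, hs1, hv]
      have hva2 : HasAdmits Z s2 := by
        intro a b; simpa [hs2, hf.a .va rfl, hs1] using hva a b
      have skip : ∀ b', b' = s'.v .b → (¬ (i ≠ v ∧ Z.Admits ⟨i, hi⟩ v)) →
          Best Z b' fun c => c.val < i + 1 ∧ c ≠ v ∧ Z.Admits c v := by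
        rintro b' rfl hno
        refine h1.congr fun c => ⟨fun ⟨h2, h3⟩ => ⟨by omega, h3⟩, fun ⟨h2, h3, h4⟩ => ⟨?_, h3, h4⟩⟩
        by_contra hlt
        obtain rfl : c = ⟨i, hi⟩ := Fin.ext ((Nat.lt_succ_iff_lt_or_eq.mp h2).resolve_left hlt)
        exact hno ⟨fun h => h3 (Fin.ext h), h4⟩
      by_cases hiv : i = v
      · exact skip _ (by simp [nearStep, ev, e2u, e2v, hiv]; simp [hs2]) (fun h => h.1 hiv)
      by_cases hadm : Z.Admits ⟨i, hi⟩ v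
      · have hne : s2.a .va i v ≠ 0 := (hva2 ⟨i, hi⟩ v).mpr hadm
        set s3 := (s2.tick.setV .t (s2.a .va i v)).tick.tick with hs3
        have e : ev (table Z) nearStep s2 = ev (table Z) update s3 := by
          simp [nearStep, ev, e2u, e2v, hiv, hne, hs3]
        have h3 := update_spec hZ (s := s3) (u := ⟨i, hi⟩) (v := v)
          (C := fun c => c.val < i ∧ c ≠ v ∧ Z.Admits c v)
          (by intro a b; simpa [hs3] using hva2 a b) (by simp [hs3, e2u]) hadm (fun c hc => hc.2.2)
          (by simpa [hs3, hs2] using h1)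
        rw [e]
        refine h3.congr fun c => ⟨?_, ?_⟩
        · rintro (⟨h4, h5⟩ | rfl)
          · exact ⟨by omega, h5⟩
          · exact ⟨Nat.lt_succ_self i, fun h => hiv (congrArg Fin.val h), hadm⟩
        · rintro ⟨h4, h5⟩
          rcases Nat.lt_succ_iff_lt_or_eq.mp h4 with h4 | h4
          · exact .inl ⟨h4, h5⟩
          · exact .inr (Fin.ext h4)
      · have hz : s2.a .va i v = 0 := by
          by_contra hne; exact hadm ((hva2 ⟨i, hi⟩ v).mp hne)
        exact skip _ (by simp [nearStep, ev, e2u, e2v, hiv, hz]; simp [hs2]) (fun h => hadm h.2))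
  have e1 : Opd.val s1 §.n = n := by simp [hs1, h.hn]
  have : ev (table Z) near s = (s'.setV .u (Opd.val s1 §.n)).tick := by rw [← he]; rfl
  rw [this]
  rw [e1] at h1
  rcases h1 with ⟨-, h1⟩ | ⟨b, hb, ⟨-, h2, h3⟩, h4⟩
  · exact absurd ⟨Z.start.2, Ne.symm hvs, .inl rfl⟩ (h1 Z.start)
  · exact ⟨b, ⟨h2, h3, fun c hc hcv => h4 c ⟨c.2, hc, hcv⟩⟩, by simpa using hb⟩

def nearExitStep : Cmd :=
  .get .u .ex §.r1 §.x ;;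
  .ifnz .u (.dec .u ;; .get .t .va §.u §.v ;; .ifnz .t update .skip) .skip

/-- Find the nearest exit of row `r1` that admits `v`. -/
def nearExit : Cmd := .set .b (.lit 0) ;; .loop .x §.k nearExitStep

theorem nearExit_spec (hZ : Z.Accessible) {s : St} (h : Ctx Z s) (hva : HasAdmits Z s) {v b : Fin n}
    (hv : s.v .v = v) (hadm : Z.Admits b v) (hrow : IsRow Z (s.row (s.v .r1)) b v) :
    ((ev (table Z) nearExit s).v .b = 0 ∧ ∀ u, ¬ Z.NearExit v b u) ∨
      ∃ u : Fin n, Z.NearExit v b u ∧ (ev (table Z) nearExit s).v .b = u + 1 := by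
  set s1 := (s.setV .b 0).tick with hs1
  set r1 := s.v .r1 with hr1
  obtain ⟨s', hf, h1, he⟩ := loop_rule (table Z) .x §.k nearExitStep s1
    (fun i s' => Best Z (s'.v .b) fun c => (∃ x : Fin k, x.val < i ∧ Z.IsExit (Z.hull b v) x c) ∧
      Z.Admits c v) (by
      refine .inl ⟨by simp [hs1], by simp⟩) (by
      intro i s' hi hf h1
      simp only [Opd.val_var, hs1, St.tick_v, St.setV_v, reduceCtorEq, if_false, h.hk] at hi
      set x : Fin k := ⟨i, hi⟩ with hx
      set s2 := (s'.setV .x i).tick with hs2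
      have e2x : s2.v .x = x := by simp [hs2, hx]
      have e2v : s2.v .v = v := by simp [hs2, hf.v .v rfl, hs1, hv]
      have e2r : s2.v .r1 = r1 := by simp [hs2, hf.v .r1 rfl, hs1, hr1]
      have e2e : s2.a .ex = s.a .ex := by simp [hs2, hf.a .ex rfl, hs1]
      have e2b : s2.v .b = s'.v .b := by simp [hs2]
      have hva2 : HasAdmits Z s2 := by
        intro a b; simpa [hs2, hf.a .va rfl, hs1] using hva a b
      have skip : ∀ b', b' = s2.v .b → (∀ c, Z.IsExit (Z.hull b v) x c → ¬ Z.Admits c v) →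
          Best Z b' fun c => (∃ x : Fin k, x.val < i + 1 ∧ Z.IsExit (Z.hull b v) x c) ∧
            Z.Admits c v := by
        rintro b' rfl hno
        rw [e2b]
        refine h1.congr fun c => ⟨fun ⟨⟨y, hy, h2⟩, h3⟩ => ⟨⟨y, by omega, h2⟩, h3⟩,
          fun ⟨⟨y, hy, h2⟩, h3⟩ => ⟨⟨y, ?_, h2⟩, h3⟩⟩
        by_contra hlt
        obtain rfl : y = x := Fin.ext (by have := Nat.lt_succ_iff_lt_or_eq.mp hy; simp [hx]; omega)
        exact hno c h2 h3
      -- A thin hull has one exit per symbol, so the single value stored in the row accounts for all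
      -- its exits with the symbol `x`.
      have huniq : ∀ c c', Z.IsExit (Z.hull b v) x c → Z.IsExit (Z.hull b v) x c' → c = c' :=
        fun c c' h h' => hadm.thinAt.exit_unique h h'
      by_cases h0 : s.a .ex r1 x = 0
      · exact skip _ (by simp [nearExitStep, ev, e2x, e2r, e2e, h0])
          (fun c hc => absurd hc (hrow.no_exit x h0 c))
      obtain ⟨u, hu, hux⟩ := hrow.exit x h0
      change s.a .ex r1 x = u + 1 at hu
      by_cases huv : Z.Admits u v
      · have hne : s2.a .va u v ≠ 0 := (hva2 u v).mpr huv
        set s3 := ((((s2.setV .u (u + 1)).tick.tick.setV .u u).tick).setV .t (s2.a .va u v)).tick.tick with hs3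
        have e : ev (table Z) nearExitStep s2 = ev (table Z) update s3 := by
          simp [nearExitStep, ev, e2x, e2r, e2e, e2v, hu, hne, hs3]
        have h3 := update_spec hZ (s := s3) (u := u) (v := v)
          (C := fun c => (∃ x : Fin k, x.val < i ∧ Z.IsExit (Z.hull b v) x c) ∧ Z.Admits c v)
          (by intro a b; simpa [hs3] using hva2 a b) (by simp [hs3]) huv (fun c hc => hc.2)
          (by simpa [hs3, e2b] using h1)
        rw [e]
        refine h3.congr fun c => ⟨?_, ?_⟩
        · rintro (⟨⟨y, h4, h5⟩, h6⟩ | rfl)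
          · exact ⟨⟨y, by omega, h5⟩, h6⟩
          · exact ⟨⟨x, Nat.lt_succ_self i, hux⟩, huv⟩
        · rintro ⟨⟨y, h4, h5⟩, h6⟩
          rcases Nat.lt_succ_iff_lt_or_eq.mp h4 with h4 | h4
          · exact .inl ⟨⟨y, h4, h5⟩, h6⟩
          · obtain rfl : y = x := Fin.ext h4
            exact .inr (huniq _ _ h5 hux)
      · have hz : s2.a .va u v = 0 := by
          by_contra hne; exact huv ((hva2 u v).mp hne)
        exact skip _ (by simp [nearExitStep, ev, e2x, e2r, e2e, e2v, hu, hz])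
          (fun c hc => by rw [huniq c u hc hux]; exact huv))
  have e1 : Opd.val s1 §.k = k := by simp [hs1, h.hk]
  have : ev (table Z) nearExit s = (s'.setV .x (Opd.val s1 §.k)).tick := by rw [← he]; rfl
  rw [this]
  rw [e1] at h1
  rcases h1 with ⟨h0, h1⟩ | ⟨u, hb, ⟨⟨x, -, h2⟩, h3⟩, h4⟩
  · exact .inl ⟨by simpa using h0, fun u hu => by
      obtain ⟨x, hx⟩ := hu.exit
      exact h1 u ⟨⟨x, x.2, hx⟩, hu.admits⟩⟩
  · exact .inr ⟨u, ⟨⟨x, h2⟩, h3, fun c ⟨y, hy⟩ hc => h4 c ⟨⟨y, y.2, hy⟩, hc⟩⟩, by simpa using hb⟩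

end Imp

/-! ### The three blocks of the table: singletons, nearest hulls, nearest-exit hulls. -/

namespace Imp

open Relation

variable {n k : ℕ} {Z : FSM (Fin n) (Fin k)}

def singleAt : Cmd :=
  .set .u §.v ;; .set .root §.v ;; mkRow ;; .put .ok §.r (.lit 0) (.lit 1) ;; .inc .r

/-- The rows `0, …, n - 1`: singletons. -/
def singles : Cmd := .set .rv (.lit 0) ;; .set .r (.lit 0) ;; .loop .v §.n singleAt

/-- Fill row `r` with `hull u v`, where `b` is `u + 1`. -/
def hullRow : Cmd := .set .u §.b ;; .dec .u ;; .set .root §.v ;; mkRow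

def nearAt : Cmd :=
  .put .ok §.r (.lit 0) (.lit 0) ;;
  .ifeq §.v §.s .skip (near ;; hullRow ;; .put .ok §.r (.lit 0) (.lit 1)) ;; .inc .r

/-- The rows `n, …, 2 * n - 1`. -/
def nears : Cmd := .loop .v §.n nearAt

def notSubStep : Cmd :=
  .get .t .ro §.r1 §.q ;; .ifnz .t (.get .t .ro §.r §.q ;; .ifnz .t .skip (.set .f (.lit 1))) .skip

def notSub : Cmd := .set .f (.lit 0) ;; .loop .q §.n notSubStep

def exitRow : Cmd := hullRow ;; notSub ;; .put .ok §.r (.lit 0) §.f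

def exitRowAt : Cmd :=
  .put .ok §.r (.lit 0) (.lit 0) ;;
  .ifeq §.v §.s .skip (nearExit ;; .ifnz .b exitRow .skip) ;; .inc .r ;; .inc .r1

/-- The rows `2 * n, …, 3 * n - 1`. -/
def exitRows : Cmd := .set .r1 §.n ;; .loop .v §.n exitRowAt

theorem row_setV (s : St) (x : Var) (c r : ℕ) : (s.setV x c).row r = s.row r := rfl

theorem row_tick (s : St) (r : ℕ) : s.tick.row r = s.row r := rfl

theorem row_setOk_of_ne (s : St) {r r' c : ℕ} (h : r' ≠ r) : (s.setA .ok r 0 c).row r' = s.row r' := by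
  simp [St.row, h, funext_iff]

theorem IsRow.congr {R R' : Row} {u v : Fin n} (h : IsRow Z R u v) (h1 : R'.ro = R.ro) (h2 : R'.en = R.en)
    (h3 : R'.ex = R.ex) : IsRow Z R' u v :=
  ⟨by rw [h1]; exact h.mem, by rw [h2]; exact h.entry, by rw [h3]; exact h.no_exit,
    by rw [h3]; exact h.exit⟩

theorem isRow_setOk {s : St} {r c r' : ℕ} {u v : Fin n} (h : IsRow Z (s.row r') u v) :
    IsRow Z ((s.setA .ok r 0 c).row r') u v :=
  h.congr (by simp [St.row, funext_iff]) (by simp [St.row, funext_iff]) (by simp [St.row, funext_iff])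

theorem singles_spec {s : St} (h : Ctx Z s) :
    (ev (table Z) singles s).v .r = n ∧
    ∀ v : Fin n, ((ev (table Z) singles s).row v).ok 0 ≠ 0 ∧
      IsRow Z ((ev (table Z) singles s).row v) v v := by
  set s0 := ((s.setV .rv 0).tick.setV .r 0).tick with hs0
  have c0 : Ctx Z s0 := ((h.setV .rv 0 (by simp)).tick.setV .r 0 (by simp)).tick
  obtain ⟨s', hf, ⟨h1, h2⟩, he⟩ := loop_rule (table Z) .v §.n singleAt s0
    (fun i s' => s'.v .r = i ∧ ∀ v : Fin n, v.val < i → (s'.row v).ok 0 ≠ 0 ∧ IsRow Z (s'.row v) v v)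
    (by simp [hs0]) (by
      rintro i s' hi hf ⟨h1, h2⟩
      simp only [Opd.val_var, c0.hn] at hi
      set v : Fin n := ⟨i, hi⟩
      set s1 := ((((s'.setV .v i).tick).setV .u i).tick.setV .root i).tick with hs1
      have c1 : Ctx Z s1 := ((((c0.of_frame hf rfl).setV .v i (by simp)).tick.setV .u i (by simp)).tick.setV
        .root i (by simp)).tick
      obtain ⟨h3, h4⟩ := mkRow_spec (s := s1) (u := v) (v := v) (r := i) c1 (by simp [hs1, v])
        (by simp [hs1, v]) (by simp [hs1, h1]) (by simp [hs1, hf.v .rv rfl, hs0])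
      set s2 := ev (table Z) mkRow s1 with hs2
      have f2 : Frame mkRow s1 s2 := frame_ev _ _
      have e2r : s2.v .r = i := by rw [f2.v .r rfl]; simp [hs1, h1]
      have e : ev (table Z) singleAt (s'.setV .v i).tick =
          ((s2.setA .ok i 0 1).tick.setV .r (i + 1)).tick := by
        have : ev (table Z) singleAt (s'.setV .v i).tick =
            ev (table Z) (.put .ok §.r (.lit 0) (.lit 1) ;; .inc .r) s2 := by
          rw [hs2, hs1]
          simp [singleAt, ev]
        rw [this]
        simp [ev, e2r]
      rw [e]
      refine ⟨by simp, fun w hw => ?_⟩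
      rw [row_tick, row_setV, row_tick]
      rcases Nat.lt_succ_iff_lt_or_eq.mp hw with hw | hw
      · rw [row_setOk_of_ne _ (by omega), h4 w (by omega)]
        exact h2 w hw
      · obtain rfl : w = v := Fin.ext hw
        exact ⟨by simp [St.row, hw], isRow_setOk (hw ▸ h3)⟩)
  have e1 : Opd.val s0 §.n = n := by simp [c0.hn]
  have : ev (table Z) singles s = (s'.setV .v (Opd.val s0 §.n)).tick := by rw [← he]; rfl
  rw [this]
  rw [e1] at h1 h2
  refine ⟨by simpa using h1, fun v => ?_⟩
  rw [row_tick, row_setV]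
  exact h2 v v.2

theorem hullRow_spec {s : St} (h : Ctx Z s) {u v : Fin n} {r : ℕ} (hb : s.v .b = u + 1)
    (hv : s.v .v = v) (hr : s.v .r = r) (hrv : s.v .rv = 0) :
    IsRow Z ((ev (table Z) hullRow s).row r) u v ∧
    ∀ r' ≠ r, (ev (table Z) hullRow s).row r' = s.row r' := by
  set s1 := (((s.setV .u (u + 1)).tick.setV .u u).tick.setV .root v).tick with hs1
  have c1 : Ctx Z s1 := (((h.setV .u _ (by simp)).tick.setV .u u (by simp)).tick.setV .root v (by simp)).tick
  have e : ev (table Z) hullRow s = ev (table Z) mkRow s1 := by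
    rw [hs1]
    simp [hullRow, ev, hb, hv]
  rw [e]
  exact mkRow_spec c1 (by simp [hs1]) (by simp [hs1]) (by simp [hs1, hr]) (by simp [hs1, hrv])

/-- Row `r` is as required for the state `v`. -/
def NearRow (Z : FSM (Fin n) (Fin k)) (R : Row) (v : Fin n) : Prop :=
  (v = Z.start → R.ok 0 = 0) ∧
    (v ≠ Z.start → R.ok 0 ≠ 0 ∧ ∃ b, Z.Near v b ∧ IsRow Z R b v)

theorem nearAt_spec (hZ : Z.Accessible) {s : St} (h : Ctx Z s) (hva : HasAdmits Z s) {v : Fin n} {r : ℕ}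
    (hv : s.v .v = v) (hr : s.v .r = r) (hrv : s.v .rv = 0) :
    (ev (table Z) nearAt s).v .r = r + 1 ∧ NearRow Z ((ev (table Z) nearAt s).row r) v ∧
      ∀ r' ≠ r, (ev (table Z) nearAt s).row r' = s.row r' := by
  set s1 := (s.setA .ok r 0 0).tick with hs1
  have f1 : Frame nearAt s s1 := ⟨fun _ _ => rfl, fun a ha => by
    have : a ≠ .ok := by rintro rfl; simp [nearAt, Cmd.modA] at ha
    simp [hs1, this, funext_iff]⟩
  have c1 := h.of_frame f1 rfl
  have e1r : ∀ r' ≠ r, s1.row r' = s.row r' := fun r' hr' => row_setOk_of_ne s hr'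
  by_cases hvs : v = Z.start
  · have e : ev (table Z) nearAt s = ((s1.tick.tick).setV .r (r + 1)).tick := by
      simp [nearAt, ev, hr, hv, h.hs, hvs, hs1]
    rw [e]
    refine ⟨by simp, ⟨fun _ => by simp [St.row, hs1], fun h => absurd hvs h⟩, fun r' hr' => ?_⟩
    exact e1r r' hr'
  · have hvs' : v.val ≠ Z.start.val := fun h => hvs (Fin.ext h)
    obtain ⟨b, hb, h2⟩ := near_spec hZ (s := s1.tick) c1.tick (by simpa [HasAdmits, hs1] using hva) hv hvs
    set s2 := ev (table Z) near s1.tick with hs2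
    have f2 : Frame near s1.tick s2 := frame_ev _ _
    have c2 := c1.tick.of_frame f2 rfl
    have e2r : s2.v .r = r := by rw [f2.v .r rfl]; simp [hs1, hr]
    obtain ⟨h3, h4⟩ := hullRow_spec (s := s2) c2 h2 (v := v) (r := r)
      (by rw [f2.v .v rfl]; simp [hs1, hv]) e2r (by rw [f2.v .rv rfl]; simp [hs1, hrv])
    set s3 := ev (table Z) hullRow s2 with hs3
    have f3 : Frame hullRow s2 s3 := frame_ev _ _
    have e3r : s3.v .r = r := by rw [f3.v .r rfl, e2r]
    have e : ev (table Z) nearAt s = ((s3.setA .ok r 0 1).tick.setV .r (r + 1)).tick := by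
      have : ev (table Z) nearAt s = ev (table Z) (.put .ok §.r (.lit 0) (.lit 1) ;; .inc .r) s3 := by
        rw [hs3, hs2, hs1]
        simp [nearAt, ev, hr, hv, h.hs, hvs']
      rw [this]
      simp [ev, e3r]
    rw [e]
    refine ⟨by simp, ⟨fun h => absurd h hvs, fun _ => ⟨by simp [St.row], b, hb, ?_⟩⟩, fun r' hr' => ?_⟩
    · rw [row_tick, row_setV, row_tick]
      exact isRow_setOk h3
    · rw [row_tick, row_setV, row_tick, row_setOk_of_ne _ hr', h4 r' hr',
        f2.row rfl rfl rfl rfl r']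
      exact e1r r' hr'

theorem nears_spec (hZ : Z.Accessible) {s : St} (h : Ctx Z s) (hva : HasAdmits Z s) (hr : s.v .r = n)
    (hrv : s.v .rv = 0) :
    (ev (table Z) nears s).v .r = 2 * n ∧
    (∀ v : Fin n, NearRow Z ((ev (table Z) nears s).row (n + v)) v) ∧
      ∀ r < n, (ev (table Z) nears s).row r = s.row r := by
  obtain ⟨s', hf, ⟨h1, h2, h3⟩, he⟩ := loop_rule (table Z) .v §.n nearAt s
    (fun i s' => s'.v .r = n + i ∧ (∀ v : Fin n, v.val < i → NearRow Z (s'.row (n + v)) v) ∧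
      ∀ r < n, s'.row r = s.row r) ⟨by simp [hr], by simp, fun _ _ => rfl⟩ (by
      rintro i s' hi hf ⟨h1, h2, h3⟩
      simp only [Opd.val_var, h.hn] at hi
      obtain ⟨h4, h5, h6⟩ := nearAt_spec hZ (s := (s'.setV .v i).tick) (v := ⟨i, hi⟩) (r := n + i)
        ((h.of_frame hf rfl).setV .v i (by simp)).tick
        (by intro a b; simpa [hf.a .va rfl] using hva a b) (by simp) (by simp [h1])
        (by simp [hf.v .rv rfl, hrv])
      refine ⟨by rw [h4]; omega, fun v hv => ?_, fun r hr => ?_⟩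
      · rcases Nat.lt_succ_iff_lt_or_eq.mp hv with hv | hv
        · rw [h6 _ (by omega)]
          exact h2 v hv
        · obtain rfl : v = ⟨i, hi⟩ := Fin.ext hv
          exact h5
      · rw [h6 _ (by omega)]
        exact h3 r hr)
  have e1 : Opd.val s §.n = n := by simp [h.hn]
  have : ev (table Z) nears s = (s'.setV .v (Opd.val s §.n)).tick := by rw [← he]; rfl
  rw [this]
  rw [e1] at h1 h2
  exact ⟨by simp; omega, fun v => h2 v v.2, h3⟩

/-- This test enters the `ok` flag of a row in the third block. A direct comparison in O(n) time
suffices, as it is made at most once per state. -/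
theorem notSub_spec {s : St} (h : Ctx Z s) {R S : Set (Fin n)} {r r1 : ℕ} (hr : s.v .r = r)
    (hr1 : s.v .r1 = r1) (hR : ∀ q : Fin n, s.a .ro r q ≠ 0 ↔ q ∈ R)
    (hS : ∀ q : Fin n, s.a .ro r1 q ≠ 0 ↔ q ∈ S) :
    (ev (table Z) notSub s).v .f ≠ 0 ↔ ¬ S ⊆ R := by
  set s1 := (s.setV .f 0).tick with hs1
  obtain ⟨s', hf, h1, he⟩ := loop_rule (table Z) .q §.n notSubStep s1
    (fun i s' => s'.v .f ≠ 0 ↔ ∃ q : Fin n, q.val < i ∧ q ∈ S ∧ q ∉ R) (by simp [hs1]) (by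
      intro i s' hi hf h1
      simp only [Opd.val_var, hs1, St.tick_v, St.setV_v, reduceCtorEq, if_false, h.hn] at hi
      set q : Fin n := ⟨i, hi⟩ with hq
      have er : s'.v .r = r := by rw [hf.v .r rfl]; simp [hs1, hr]
      have er1 : s'.v .r1 = r1 := by rw [hf.v .r1 rfl]; simp [hs1, hr1]
      have ero : s'.a .ro = s.a .ro := by rw [hf.a .ro rfl]; simp [hs1]
      have skip : ∀ f', f' = s'.v .f → ¬ (q ∈ S ∧ q ∉ R) →
          (f' ≠ 0 ↔ ∃ q : Fin n, q.val < i + 1 ∧ q ∈ S ∧ q ∉ R) := by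
        rintro f' rfl hno
        rw [h1]
        refine ⟨fun ⟨p, hp, h2⟩ => ⟨p, by omega, h2⟩, fun ⟨p, hp, h2⟩ => ⟨p, ?_, h2⟩⟩
        rcases Nat.lt_succ_iff_lt_or_eq.mp hp with hp | hp
        · exact hp
        · obtain rfl : p = q := Fin.ext hp
          exact absurd h2 hno
      by_cases hqS : q ∈ S
      · have h2 : s.a .ro r1 i ≠ 0 := (hS q).mpr hqS
        by_cases hqR : q ∈ R
        · have h3 : s.a .ro r i ≠ 0 := (hR q).mpr hqR
          exact skip _ (by simp [notSubStep, ev, er, er1, ero, h2, h3]) (fun h => h.2 hqR)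
        · have h3 : s.a .ro r i = 0 := by
            by_contra hne; exact hqR ((hR q).mp hne)
          have : (ev (table Z) notSubStep (s'.setV .q i).tick).v .f = 1 := by
            simp [notSubStep, ev, er, er1, ero, h2, h3]
          rw [this]
          exact ⟨fun _ => ⟨q, Nat.lt_succ_self i, hqS, hqR⟩, fun _ => one_ne_zero⟩
      · have h2 : s.a .ro r1 i = 0 := by
          by_contra hne; exact hqS ((hS q).mp hne)
        exact skip _ (by simp [notSubStep, ev, er1, ero, h2]) (fun h => hqS h.1))
  have e1 : Opd.val s1 §.n = n := by simp [hs1, h.hn]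
  have : ev (table Z) notSub s = (s'.setV .q (Opd.val s1 §.n)).tick := by rw [← he]; rfl
  rw [this]
  rw [e1] at h1
  simp only [St.tick_v, St.setV_v, reduceCtorEq, if_false]
  rw [h1, Set.not_subset]
  exact ⟨fun ⟨q, _, h2, h3⟩ => ⟨q, h2, h3⟩, fun ⟨q, h2, h3⟩ => ⟨q, q.2, h2, h3⟩⟩

/-- Row `r` is as required for the state `v`. -/
def ExitRow (Z : FSM (Fin n) (Fin k)) (R : Row) (v : Fin n) : Prop :=
  (R.ok 0 ≠ 0 → ∃ b u, Z.Near v b ∧ Z.NearExit v b u ∧ ¬ Z.hull b v ⊆ Z.hull u v ∧ IsRow Z R u v) ∧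
  ∀ b u, Z.Near v b → Z.NearExit v b u → ¬ Z.hull b v ⊆ Z.hull u v → R.ok 0 ≠ 0 ∧ IsRow Z R u v

theorem exitRowAt_spec (hZ : Z.Accessible) {s : St} (h : Ctx Z s) (hva : HasAdmits Z s) {v : Fin n}
    {r r1 : ℕ} (hv : s.v .v = v) (hr : s.v .r = r) (hr1 : s.v .r1 = r1) (hrr : r1 ≠ r)
    (hrv : s.v .rv = 0) (hrow : NearRow Z (s.row r1) v) :
    (ev (table Z) exitRowAt s).v .r = r + 1 ∧ (ev (table Z) exitRowAt s).v .r1 = r1 + 1 ∧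
      ExitRow Z ((ev (table Z) exitRowAt s).row r) v ∧
      ∀ r' ≠ r, (ev (table Z) exitRowAt s).row r' = s.row r' := by
  set s1 := (s.setA .ok r 0 0).tick with hs1
  have f1 : Frame exitRowAt s s1 := ⟨fun _ _ => rfl, fun a ha => by
    have : a ≠ .ok := by rintro rfl; simp [exitRowAt, Cmd.modA] at ha
    simp [hs1, this, funext_iff]⟩
  have c1 := h.of_frame f1 rfl
  have e1r : ∀ r' ≠ r, s1.row r' = s.row r' := fun r' hr' => row_setOk_of_ne s hr'
  by_cases hvs : v = Z.start
  · have e : ev (table Z) exitRowAt s = (((s1.tick.tick).setV .r (r + 1)).tick.setV .r1 (r1 + 1)).tick := by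
      simp [exitRowAt, ev, hr, hr1, hv, h.hs, hvs, hs1]
    rw [e]
    refine ⟨by simp, by simp, ⟨fun h => ?_, fun b u hb => ?_⟩, fun r' hr' => e1r r' hr'⟩
    · simp [St.row, hs1] at h
    · exact absurd (hb.admits.antisymm hZ (.inl hvs)) hb.ne
  have hvs' : v.val ≠ Z.start.val := fun h => hvs (Fin.ext h)
  obtain ⟨-, b, hb, hbrow⟩ := hrow.2 hvs
  -- By antisymmetry the nearest state is unique, so the one found for row `r1` is the only one the
  -- specification can speak of.
  have hbu : ∀ b', Z.Near v b' → b' = b := fun b' hb' =>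
    (hb.nearest b' hb'.ne hb'.admits).antisymm hZ (hb'.nearest b hb.ne hb.admits)
  have hb1 : IsRow Z (s1.tick.row (s1.tick.v .r1)) b v := by
    rw [row_tick, show s1.tick.v .r1 = r1 from hr1, e1r r1 hrr]
    exact hbrow
  have h2 := nearExit_spec hZ (s := s1.tick) c1.tick (by simpa [HasAdmits, hs1] using hva) hv hb.admits hb1
  set s2 := ev (table Z) nearExit s1.tick with hs2
  have f2 : Frame nearExit s1.tick s2 := frame_ev _ _
  have c2 := c1.tick.of_frame f2 rfl
  have e2r : s2.v .r = r := by rw [f2.v .r rfl]; simp [hs1, hr]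
  have e2r1 : s2.v .r1 = r1 := by rw [f2.v .r1 rfl]; simp [hs1, hr1]
  have e2row : ∀ r', s2.row r' = s1.row r' := f2.row rfl rfl rfl rfl
  have e : ev (table Z) exitRowAt s = ev (table Z) (.inc .r ;; .inc .r1)
      (ev (table Z) (.ifnz .b exitRow .skip) s2) := by
    rw [hs2, hs1]
    simp [exitRowAt, ev, hr, hv, h.hs, hvs']
  rcases h2 with ⟨h2, h3⟩ | ⟨u, hu, h2⟩
  · have e' : ev (table Z) exitRowAt s = (((s2.tick.tick).setV .r (r + 1)).tick.setV .r1 (r1 + 1)).tick := by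
      rw [e]
      simp [ev, h2, e2r, e2r1]
    rw [e']
    refine ⟨by simp, by simp, ⟨fun h => ?_, fun b' u hb' hu => ?_⟩, fun r' hr' => ?_⟩
    · have : s2.a .ok r 0 = 0 := by rw [f2.a .ok rfl]; simp [hs1]
      simp [St.row, this] at h
    · rw [hbu b' hb'] at hu
      exact absurd hu (h3 u)
    · exact (e2row r').trans (e1r r' hr')
  · have hne : s2.v .b ≠ 0 := by omega
    obtain ⟨h3, h4⟩ := hullRow_spec (s := s2.tick) c2.tick h2 (v := v) (r := r)
      (by simp only [St.tick_v]; rw [f2.v .v rfl]; simp [hs1, hv]) e2r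
      (by simp only [St.tick_v]; rw [f2.v .rv rfl]; simp [hs1, hrv])
    set s3 := ev (table Z) hullRow s2.tick with hs3
    have f3 : Frame hullRow s2.tick s3 := frame_ev _ _
    have c3 := c2.tick.of_frame f3 rfl
    have e3r : s3.v .r = r := by rw [f3.v .r rfl]; exact e2r
    have e3r1 : s3.v .r1 = r1 := by rw [f3.v .r1 rfl]; exact e2r1
    have e3row : IsRow Z (s3.row r1) b v := by
      rw [h4 r1 hrr, row_tick, e2row, e1r r1 hrr]
      exact hbrow
    have h5 := notSub_spec (s := s3) c3 e3r e3r1 h3.mem e3row.mem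
    set s4 := ev (table Z) notSub s3 with hs4
    have f4 : Frame notSub s3 s4 := frame_ev _ _
    have e4r : s4.v .r = r := by rw [f4.v .r rfl, e3r]
    have e4r1 : s4.v .r1 = r1 := by rw [f4.v .r1 rfl, e3r1]
    have e' : ev (table Z) exitRowAt s =
        (((s4.setA .ok r 0 (s4.v .f)).tick.setV .r (r + 1)).tick.setV .r1 (r1 + 1)).tick := by
      have : ev (table Z) (.ifnz .b exitRow .skip) s2 = (s4.setA .ok r 0 (s4.v .f)).tick := by
        have : ev (table Z) (.ifnz .b exitRow .skip) s2 = ev (table Z) (.put .ok §.r (.lit 0) §.f) s4 := by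
          rw [hs4, hs3]
          simp [ev, hne, exitRow]
        rw [this]
        simp [ev, e4r]
      rw [e, this]
      simp [ev, e4r, e4r1]
    rw [e']
    have h6 : IsRow Z ((((s4.setA .ok r 0 (s4.v .f)).tick.setV .r (r + 1)).tick.setV .r1
        (r1 + 1)).tick.row r) u v := by
      rw [row_tick, row_setV, row_tick, row_setV, row_tick]
      refine isRow_setOk ?_
      rw [f4.row rfl rfl rfl rfl]
      exact h3
    have h7 : ((((s4.setA .ok r 0 (s4.v .f)).tick.setV .r (r + 1)).tick.setV .r1
        (r1 + 1)).tick.row r).ok 0 = s4.v .f := by simp [St.row]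
    refine ⟨by simp, by simp, ⟨fun h => ⟨b, u, hb, hu, ?_, h6⟩, fun b' u' hb' hu' hsub => ?_⟩, fun r' hr' => ?_⟩
    · rw [h7, h5] at h
      exact h
    · rw [hbu b' hb'] at hu' hsub
      obtain rfl : u' = u := (hu.nearest u' hu'.exit hu'.admits).antisymm hZ
        (hu'.nearest u hu.exit hu.admits)
      rw [h7]
      exact ⟨h5.mpr hsub, h6⟩
    · rw [row_tick, row_setV, row_tick, row_setV, row_tick, row_setOk_of_ne _ hr',
        f4.row rfl rfl rfl rfl, h4 r' hr']
      exact (e2row r').trans (e1r r' hr')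

theorem exitRows_spec (hZ : Z.Accessible) {s : St} (h : Ctx Z s) (hva : HasAdmits Z s)
    (hr : s.v .r = 2 * n) (hrv : s.v .rv = 0) (hrow : ∀ v : Fin n, NearRow Z (s.row (n + v)) v) :
    (∀ v : Fin n, ExitRow Z ((ev (table Z) exitRows s).row (2 * n + v)) v) ∧
      ∀ r < 2 * n, (ev (table Z) exitRows s).row r = s.row r := by
  set s0 := (s.setV .r1 n).tick with hs0
  have c0 : Ctx Z s0 := (h.setV .r1 n (by simp)).tick
  obtain ⟨s', hf, ⟨-, -, h2, h3⟩, he⟩ := loop_rule (table Z) .v §.n exitRowAt s0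
    (fun i s' => s'.v .r = 2 * n + i ∧ s'.v .r1 = n + i ∧
      (∀ v : Fin n, v.val < i → ExitRow Z (s'.row (2 * n + v)) v) ∧
      ∀ r < 2 * n, s'.row r = s.row r) ⟨by simp [hr, hs0], by simp [hs0], by simp, fun _ _ => rfl⟩ (by
      rintro i s' hi hf ⟨h1, h1', h2, h3⟩
      simp only [Opd.val_var, c0.hn] at hi
      obtain ⟨h4, h4', h5, h6⟩ := exitRowAt_spec hZ (s := (s'.setV .v i).tick) (v := ⟨i, hi⟩)
        (r := 2 * n + i) (r1 := n + i) ((c0.of_frame hf rfl).setV .v i (by simp)).tick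
        (by intro a b; simpa [hf.a .va rfl, hs0] using hva a b) (by simp) (by simp [h1]) (by simp [h1'])
        (by omega) (by simp [hf.v .rv rfl, hs0, hrv])
        (by rw [row_tick, row_setV, h3 _ (by omega)]; exact hrow ⟨i, hi⟩)
      refine ⟨by rw [h4]; omega, by rw [h4']; omega, fun v hv => ?_, fun r hr => ?_⟩
      · rcases Nat.lt_succ_iff_lt_or_eq.mp hv with hv | hv
        · rw [h6 _ (by omega)]
          exact h2 v hv
        · obtain rfl : v = ⟨i, hi⟩ := Fin.ext hv
          exact h5
      · rw [h6 _ (by omega)]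
        exact h3 r hr)
  have e1 : Opd.val s0 §.n = n := by simp [c0.hn]
  have : ev (table Z) exitRows s = (s'.setV .v (Opd.val s0 §.n)).tick := by
    rw [← he]
    simp [exitRows, ev, h.hn, hs0]
  rw [this]
  rw [e1] at h2
  exact ⟨fun v => h2 v v.2, h3⟩

/-- Fill the table. -/
def rows : Cmd := singles ;; nears ;; exitRows

/-- The table lists the indecomposable thin modules, starting with the singletons. -/
structure Table (Z : FSM (Fin n) (Fin k)) (s : St) : Prop where
  sound : ∀ r < 3 * n, (s.row r).ok 0 ≠ 0 →
    ∃ u v, IsRow Z (s.row r) u v ∧ Z.Admits u v ∧ Z.hull u v ∈ Z.Ind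
  complete : ∀ K ∈ Z.Ind, ∃ r < 3 * n, (s.row r).ok 0 ≠ 0 ∧
    ∃ u v, IsRow Z (s.row r) u v ∧ K = Z.hull u v
  single : ∀ q : Fin n, (s.row q).ok 0 ≠ 0 ∧ IsRow Z (s.row q) q q

/-- The three blocks realize the three cases of `mem_ind_iff`. Different rows may still hold the
same set. -/
theorem rows_spec (hZ : Z.Accessible) {s : St} (h : Ctx Z s) (hva : HasAdmits Z s) :
    Table Z (ev (table Z) rows s) := by
  obtain ⟨h1, h2⟩ := singles_spec h
  set s1 := ev (table Z) singles s with hs1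
  have f1 : Frame singles s s1 := frame_ev _ _
  have c1 := h.of_frame f1 rfl
  have a1 : HasAdmits Z s1 := by intro a b; simpa [f1.a .va rfl] using hva a b
  have e1 : s1.v .rv = 0 := by
    rw [hs1]
    simp only [singles, ev]
    rw [show ∀ s : St, (((iter (ev (table Z) singleAt) .v (Opd.val s §.n) s.tick).setV .v
      (Opd.val s §.n)).tick).v .rv = (ev (table Z) (.loop .v §.n singleAt) s).v .rv from fun _ => rfl]
    rw [ev_v rfl]
    simp
  obtain ⟨h3, h4, h5⟩ := nears_spec hZ c1 a1 h1 e1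
  set s2 := ev (table Z) nears s1 with hs2
  have f2 : Frame nears s1 s2 := frame_ev _ _
  have c2 := c1.of_frame f2 rfl
  have a2 : HasAdmits Z s2 := by intro a b; simpa [f2.a .va rfl] using a1 a b
  obtain ⟨h6, h7⟩ := exitRows_spec hZ c2 a2 h3 (by rw [f2.v .rv rfl, e1]) h4
  set s3 := ev (table Z) exitRows s2 with hs3
  change Table Z s3
  have hA : ∀ q : Fin n, s3.row q = s1.row q := fun q => (h7 q (by omega)).trans (h5 q q.2)
  have hB : ∀ v : Fin n, NearRow Z (s3.row (n + v)) v := fun v => by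
    rw [h7 _ (by omega)]; exact h4 v
  refine ⟨fun r hr hok => ?_, fun K hK => ?_, fun q => by rw [hA]; exact h2 q⟩
  · by_cases hr1 : r < n
    · have := (h2 ⟨r, hr1⟩).2
      rw [← hA] at this
      exact ⟨_, _, this, .refl _, by rw [FSM.hull_self]; exact FSM.singleton_mem_ind hZ _⟩
    by_cases hr2 : r < 2 * n
    · have h8 := hB ⟨r - n, by omega⟩
      rw [show n + (⟨r - n, by omega⟩ : Fin n).val = r by simp; omega] at h8
      have hne : (⟨r - n, by omega⟩ : Fin n) ≠ Z.start := fun h => hok (h8.1 h)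
      obtain ⟨-, b, hb, hrow⟩ := h8.2 hne
      exact ⟨b, _, hrow, hb.admits, FSM.hull_near_mem_ind hZ hb⟩
    · have h8 := h6 ⟨r - 2 * n, by omega⟩
      rw [show 2 * n + (⟨r - 2 * n, by omega⟩ : Fin n).val = r by simp; omega] at h8
      obtain ⟨b, u, hb, hu, hsub, hrow⟩ := h8.1 hok
      exact ⟨u, _, hrow, hu.admits, FSM.hull_nearExit_mem_ind hZ hb hu hsub⟩
  · rcases (FSM.mem_ind_iff hZ).mp hK with ⟨q, rfl⟩ | ⟨v, b, hb, rfl⟩ | ⟨v, b, u, hb, hu, rfl, hsub⟩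
    · have := h2 q
      rw [← hA] at this
      exact ⟨q, by omega, this.1, q, q, this.2, (FSM.hull_self q).symm⟩
    · have hvs : v ≠ Z.start := fun h => hb.ne (hb.admits.antisymm hZ (.inl h))
      obtain ⟨hok, b', hb', hrow⟩ := (hB v).2 hvs
      obtain rfl : b' = b := (hb.nearest b' hb'.ne hb'.admits).antisymm hZ
        (hb'.nearest b hb.ne hb.admits)
      exact ⟨n + v, by omega, hok, b', v, hrow, rfl⟩
    · obtain ⟨hok, hrow⟩ := (h6 v).2 b u hb hu hsub
      exact ⟨2 * n + v, by omega, hok, u, v, hrow, rfl⟩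

end Imp

namespace Imp

open Relation

variable {n k : ℕ} {Z : FSM (Fin n) (Fin k)}

/-! ### Containment -/

/-- The set in row `r`. -/
def St.set (n : ℕ) (s : St) (r : ℕ) : Set (Fin n) := {q | s.a .ro r q ≠ 0}

theorem IsRow.set_eq {s : St} {r : ℕ} {u v : Fin n} (h : IsRow Z (s.row r) u v) :
    s.set n r = Z.hull u v := Set.ext h.mem

def subStep : Cmd :=
  .get .t .ex §.K §.x ;;
  .ifnz .t (.dec .t ;; .get .t .ro §.M §.t ;; .ifnz .t (.set .f (.lit 0)) .skip) .skip

def subTest : Cmd :=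
  .get .t .en §.M (.lit 0) ;; .get .f .ro §.K §.t ;; .loop .x §.k subStep

def subAt : Cmd :=
  .set .f (.lit 0) ;; .get .t .ok §.K (.lit 0) ;;
  .ifnz .t (.get .t .ok §.M (.lit 0) ;; .ifnz .t subTest .skip) .skip ;; .put .su §.K §.M §.f

/-- Compute the containment relation. -/
def subs : Cmd := .loop .K §.m (.loop .M §.m subAt)

/-- A thin module whose entry lies in a set can fail to be contained in it only by containing an
exit of the set, and an exit is never in the set. So O(k) lookups decide containment, and all `9 * n
^ 2` pairs of rows fit into the time bound. -/
theorem subTest_spec (hZ : Z.Accessible) {s : St} (h : Ctx Z s) {K M : ℕ} (hK : s.v .K = K)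
    (hM : s.v .M = M) {u v u' v' : Fin n} (hrK : IsRow Z (s.row K) u v) (huv : Z.Admits u v)
    (hrM : IsRow Z (s.row M) u' v') (huv' : Z.Admits u' v') :
    (ev (table Z) subTest s).v .f ≠ 0 ↔ Z.hull u' v' ⊆ Z.hull u v := by
  set s1 := ((s.setV .t u').tick.setV .f (s.a .ro K u')).tick with hs1
  obtain ⟨s', hf, h1, he⟩ := loop_rule (table Z) .x §.k subStep s1
    (fun i s' => s'.v .f ≠ 0 ↔ u' ∈ Z.hull u v ∧
      ∀ x : Fin k, x.val < i → ∀ e, Z.IsExit (Z.hull u v) x e → e ∉ Z.hull u' v') (by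
      simp only [hs1, St.tick_v, St.setV_v, if_true]
      simp only [not_lt_zero, IsEmpty.forall_iff, implies_true, and_true]
      exact hrK.mem u') (by
      intro i s' hi hf h1
      simp only [Opd.val_var, hs1, St.tick_v, St.setV_v, reduceCtorEq, if_false, h.hk] at hi
      set x : Fin k := ⟨i, hi⟩ with hx
      have eK : s'.v .K = K := by rw [hf.v .K rfl]; simp [hs1, hK]
      have eM : s'.v .M = M := by rw [hf.v .M rfl]; simp [hs1, hM]
      have ero : s'.a .ro = s.a .ro := by rw [hf.a .ro rfl]; simp [hs1]
      have eex : s'.a .ex = s.a .ex := by rw [hf.a .ex rfl]; simp [hs1]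
      have skip : ∀ f', f' = s'.v .f → (∀ e, Z.IsExit (Z.hull u v) x e → e ∉ Z.hull u' v') →
          (f' ≠ 0 ↔ u' ∈ Z.hull u v ∧
            ∀ x : Fin k, x.val < i + 1 → ∀ e, Z.IsExit (Z.hull u v) x e → e ∉ Z.hull u' v') := by
        rintro f' rfl hno
        rw [h1]
        refine and_congr_right fun _ => ⟨fun h y hy => ?_, fun h y hy => h y (by omega)⟩
        rcases Nat.lt_succ_iff_lt_or_eq.mp hy with hy | hy
        · exact h y hy
        · obtain rfl : y = x := Fin.ext hy
          exact hno
      by_cases h0 : s.a .ex K i = 0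
      · exact skip _ (by simp [subStep, ev, eK, eex, h0])
          (fun e he => absurd he (hrK.no_exit x h0 e))
      obtain ⟨e, hex, hxe⟩ := hrK.exit x h0
      change s.a .ex K i = e + 1 at hex
      by_cases hem : e ∈ Z.hull u' v'
      · have h3 : s.a .ro M e ≠ 0 := (hrM.mem e).mpr hem
        have : (ev (table Z) subStep (s'.setV .x i).tick).v .f = 0 := by
          simp [subStep, ev, eK, eM, eex, hex, ero, h3]
        rw [this]
        exact ⟨fun h => absurd rfl h, fun h => absurd hem (h.2 x (Nat.lt_succ_self i) e hxe)⟩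
      · have h3 : s.a .ro M e = 0 := by
          by_contra hne; exact hem ((hrM.mem e).mp hne)
        exact skip _ (by simp [subStep, ev, eK, eM, eex, hex, ero, h3])
          (fun e' he' => by rw [huv.thinAt.exit_unique he' hxe]; exact hem))
  have e1 : Opd.val s1 §.k = k := by simp [hs1, h.hk]
  have een : s.a .en M 0 = u' := hrM.entry
  have : ev (table Z) subTest s = (s'.setV .x (Opd.val s1 §.k)).tick := by
    rw [← he, hs1]
    simp [subTest, ev, hM, hK, een]
  rw [this]
  rw [e1] at h1
  simp only [St.tick_v, St.setV_v, reduceCtorEq, if_false]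
  rw [h1]
  constructor
  · rintro ⟨h2, h3⟩
    by_contra hsub
    obtain ⟨x, e, he, hxe⟩ := huv'.thinAt.exists_exit_mem hZ h2 hsub
    exact h3 x x.2 e hxe he
  · intro hsub
    exact ⟨hsub (FSM.mem_hull_left _ _), fun x _ e he hem => he.1 (hsub hem)⟩

theorem subs_spec (hZ : Z.Accessible) {s : St} (h : Ctx Z s) (ht : Table Z s) :
    ∀ K < 3 * n, ∀ M < 3 * n, (ev (table Z) subs s).a .su K M ≠ 0 ↔
      s.a .ok K 0 ≠ 0 ∧ s.a .ok M 0 ≠ 0 ∧ s.set n M ⊆ s.set n K := by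
  have := fill_two (T := table Z) (x := .K) (y := .M) (o := §.m) (p := §.m) (c := subAt) (s := s) .su
    (fun K M c => c ≠ 0 ↔ s.a .ok K 0 ≠ 0 ∧ s.a .ok M 0 ≠ 0 ∧ s.set n M ⊆ s.set n K)
    (by simp) rfl (fun s' hf => hf.v .m rfl) (by
      intro K M s' hK hM hf eK eM
      simp only [Opd.val_var, h.hm] at hK hM
      have c' := h.of_frame hf rfl
      have hrow : ∀ r, s'.row r = s.row r := hf.row rfl rfl rfl rfl
      have eok : s'.a .ok = s.a .ok := hf.a .ok rfl
      set body : Cmd := .ifnz .t (.get .t .ok §.M (.lit 0) ;; .ifnz .t subTest .skip) .skip with hbody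
      set s1 := ((s'.setV .f 0).tick.setV .t (s.a .ok K 0)).tick with hs1
      set s2 := ev (table Z) body s1 with hs2
      have f2 : Frame body s1 s2 := frame_ev _ _
      have e2K : s2.v .K = K := by rw [f2.v .K rfl]; simp [hs1, eK]
      have e2M : s2.v .M = M := by rw [f2.v .M rfl]; simp [hs1, eM]
      have e : ev (table Z) subAt s' = (s2.setA .su K M (s2.v .f)).tick := by
        have : ev (table Z) subAt s' = ev (table Z) (.put .su §.K §.M §.f) s2 := by
          rw [hs2, hs1]
          have : subAt = .set .f (.lit 0) ;; .get .t .ok §.K (.lit 0) ;; body ;; .put .su §.K §.M §.f := rfl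
          rw [this]
          simp only [ev]
          simp [eK, eok]
        rw [this]
        simp [ev, e2K, e2M]
      rw [e]
      refine ⟨?_, fun i' j' hij => ?_⟩
      · have e' : (s2.setA .su K M (s2.v .f)).tick.a .su K M = s2.v .f := by simp
        rw [e']
        by_cases h1 : s.a .ok K 0 = 0
        · have : s2.v .f = 0 := by simp [hs2, hbody, ev, hs1, h1]
          simp [this, h1]
        by_cases h2 : s.a .ok M 0 = 0
        · have : s2.v .f = 0 := by simp [hs2, hbody, ev, hs1, h1, eM, eok, h2]
          simp [this, h2]
        obtain ⟨u, v, hrK, huv, -⟩ := ht.sound K hK h1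
        obtain ⟨u', v', hrM, huv', -⟩ := ht.sound M hM h2
        have e2 : s2 = ev (table Z) subTest (s1.tick.setV .t (s.a .ok M 0)).tick.tick := by
          simp [hs2, hbody, ev, hs1, h1, eM, eok, h2]
        have h3 := subTest_spec hZ (s := (s1.tick.setV .t (s.a .ok M 0)).tick.tick) (K := K) (M := M)
          ((((c'.setV .f 0 (by simp)).tick.setV .t _ (by simp)).tick.tick.setV .t _ (by simp)).tick.tick)
          (by simp [hs1, eK]) (by simp [hs1, eM])
          (u := u) (v := v) (u' := u') (v' := v') (by rw [← hrow] at hrK; exact hrK) huv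
          (by rw [← hrow] at hrM; exact hrM) huv'
        rw [← e2] at h3
        rw [h3, hrK.set_eq, hrM.set_eq]
        simp [h1, h2]
      · have : ¬ (i' = K ∧ j' = M) := by omega
        simp [this, f2.a .su rfl, hs1])
  intro K hK M hM
  exact this K (by simpa [h.hm] using hK) M (by simpa [h.hm] using hM)

/-! ### Numbering -/

def canonStep : Cmd :=
  .get .t .su §.K §.M ;; .get .d .su §.M §.K ;; .ifnz .t (.ifnz .d (.set .f (.lit 0)) .skip) .skip

def canonAt : Cmd :=
  .get .f .ok §.K (.lit 0) ;; .loop .M §.K canonStep ;; .put .ca §.K (.lit 0) §.f ;;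
  .put .id §.K (.lit 0) §.cn ;; .ifnz .f (.inc .cn) .skip

/-- Number the distinct sets in the table. -/
def canon : Cmd := .set .cn (.lit 0) ;; .loop .K §.m canonAt

/-- Row `r` is the first one with its contents. -/
def Canon (s : St) (r : ℕ) : Prop :=
  s.a .ok r 0 ≠ 0 ∧ ∀ q < r, ¬ (s.a .su r q ≠ 0 ∧ s.a .su q r ≠ 0)

open Classical in
-- Mutual containment detects repetitions. The number of a set is the number of canonical rows
-- before its own, so the singletons, which come first, will be numbered by their states.
theorem canon_spec {s : St} {m : ℕ} (hm : s.v .m = m) :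
    (ev (table Z) canon s).v .cn = Nat.count (Canon s) m ∧
    ∀ r < m, ((ev (table Z) canon s).a .ca r 0 ≠ 0 ↔ Canon s r) ∧
      (ev (table Z) canon s).a .id r 0 = Nat.count (Canon s) r := by
  set s0 := (s.setV .cn 0).tick with hs0
  obtain ⟨s', hf, ⟨h1, h2⟩, he⟩ := loop_rule (table Z) .K §.m canonAt s0
    (fun i s' => s'.v .cn = Nat.count (Canon s) i ∧ ∀ r < i, (s'.a .ca r 0 ≠ 0 ↔ Canon s r) ∧
      s'.a .id r 0 = Nat.count (Canon s) r) (by simp [hs0]) (by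
      rintro i s' hi hf ⟨h1, h2⟩
      have eok : s'.a .ok = s.a .ok := by rw [hf.a .ok rfl]; simp [hs0]
      have esu : s'.a .su = s.a .su := by rw [hf.a .su rfl]; simp [hs0]
      set s1 := ((s'.setV .K i).tick.setV .f (s.a .ok i 0)).tick with hs1
      obtain ⟨s2, f2, h3, he⟩ := loop_rule (table Z) .M §.K canonStep s1
        (fun j s2 => s2.v .f ≠ 0 ↔ s.a .ok i 0 ≠ 0 ∧ ∀ q < j, ¬ (s.a .su i q ≠ 0 ∧ s.a .su q i ≠ 0))
        (by simp [hs1]) (by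
        intro j s2 hj f2 h3
        have e2K : s2.v .K = i := by rw [f2.v .K rfl]; simp [hs1]
        have e2su : s2.a .su = s.a .su := by rw [f2.a .su rfl]; simp [hs1, esu]
        have key : (ev (table Z) canonStep (s2.setV .M j).tick).v .f =
            if s.a .su i j ≠ 0 ∧ s.a .su j i ≠ 0 then 0 else s2.v .f := by
          simp only [canonStep, ev]
          by_cases h4 : s.a .su i j = 0 <;> by_cases h5 : s.a .su j i = 0 <;>
            simp [e2K, e2su, h4, h5]
        rw [key]
        split
        · rename_i h4
          simp only [ne_eq, not_true_eq_false, false_iff]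
          exact fun h => h.2 j (Nat.lt_succ_self j) h4
        · rename_i h4
          rw [h3]
          refine and_congr_right fun _ => ⟨fun h q hq => ?_, fun h q hq => h q (by omega)⟩
          rcases Nat.lt_succ_iff_lt_or_eq.mp hq with hq | rfl
          · exact h q hq
          · exact h4)
      have e1K : Opd.val s1 §.K = i := by simp [hs1]
      rw [e1K] at h3 he
      have h3' : s2.v .f ≠ 0 ↔ Canon s i := h3
      have e2K : s2.v .K = i := by rw [f2.v .K rfl]; simp [hs1]
      have e2cn : s2.v .cn = Nat.count (Canon s) i := by rw [f2.v .cn rfl]; simp [hs1, h1]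
      have e2ca : s2.a .ca = s'.a .ca := by rw [f2.a .ca rfl]; simp [hs1]
      have e2id : s2.a .id = s'.a .id := by rw [f2.a .id rfl]; simp [hs1]
      set s3 := (((s2.setV .M i).tick.setA .ca i 0 (s2.v .f)).tick.setA .id i 0
        (Nat.count (Canon s) i)).tick with hs3
      have e : ev (table Z) canonAt (s'.setV .K i).tick = ev (table Z) (.ifnz .f (.inc .cn) .skip) s3 := by
        have : ev (table Z) canonAt (s'.setV .K i).tick =
            ev (table Z) (.put .ca §.K (.lit 0) §.f ;; .put .id §.K (.lit 0) §.cn ;;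
              .ifnz .f (.inc .cn) .skip) (ev (table Z) (.loop .M §.K canonStep) s1) := by
          rw [hs1]
          simp only [canonAt]
          simp only [ev]
          simp [eok]
        rw [this, he, hs3]
        simp [ev, e2K, e2cn]
      rw [e]
      set s4 := ev (table Z) (.ifnz .f (.inc .cn) .skip) s3 with hs4
      have f4 : Frame (.ifnz .f (.inc .cn) .skip) s3 s4 := frame_ev _ _
      refine ⟨?_, fun r hr => ?_⟩
      · by_cases hc : Canon s i
        · rw [Nat.count_succ, if_pos hc]
          simp [hs4, ev, hs3, h3'.mpr hc, e2cn]
        · have : s2.v .f = 0 := by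
            by_contra hne; exact hc (h3'.mp hne)
          rw [Nat.count_succ, if_neg hc]
          simp [hs4, ev, hs3, this, e2cn]
      · rw [f4.a .ca rfl, f4.a .id rfl]
        rcases Nat.lt_succ_iff_lt_or_eq.mp hr with hr | rfl
        · have := h2 r hr
          simpa [hs3, hr.ne, e2ca, e2id] using this
        · simpa [hs3] using h3')
  have e1 : Opd.val s0 §.m = m := by simp [hs0, hm]
  have : ev (table Z) canon s = (s'.setV .K (Opd.val s0 §.m)).tick := by rw [← he]; rfl
  rw [this]
  rw [e1] at h1 h2
  exact ⟨by simpa using h1, h2⟩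

def strictAt : Cmd :=
  .get .f .su §.K §.M ;; .ifeq §.K §.M (.set .f (.lit 0)) .skip ;;
  .get .t .ca §.K (.lit 0) ;; .ifnz .t .skip (.set .f (.lit 0)) ;;
  .get .t .ca §.M (.lit 0) ;; .ifnz .t .skip (.set .f (.lit 0)) ;; .put .ss §.K §.M §.f

/-- Compute the strict containment relation between the distinct sets. -/
def stricts : Cmd := .loop .K §.m (.loop .M §.m strictAt)

theorem stricts_spec {T : ℕ → ℕ → ℕ} {s : St} {m : ℕ} (hm : s.v .m = m) :
    ∀ K < m, ∀ M < m, (ev T stricts s).a .ss K M ≠ 0 ↔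
      s.a .su K M ≠ 0 ∧ K ≠ M ∧ s.a .ca K 0 ≠ 0 ∧ s.a .ca M 0 ≠ 0 := by
  have := fill_two (T := T) (x := .K) (y := .M) (o := §.m) (p := §.m) (c := strictAt) (s := s) .ss
    (fun K M c => c ≠ 0 ↔ s.a .su K M ≠ 0 ∧ K ≠ M ∧ s.a .ca K 0 ≠ 0 ∧ s.a .ca M 0 ≠ 0)
    (by simp) rfl (fun s' hf => hf.v .m rfl) (by
      intro K M s' hK hM hf eK eM
      have esu : s'.a .su = s.a .su := hf.a .su rfl
      have eca : s'.a .ca = s.a .ca := hf.a .ca rfl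
      simp only [strictAt, ev]
      by_cases h1 : K = M <;> by_cases h2 : s.a .ca K 0 = 0 <;> by_cases h3 : s.a .ca M 0 = 0 <;>
        simp_all <;> omega)
  intro K hK M hM
  exact this K (by simpa [hm] using hK) M (by simpa [hm] using hM)

end Imp

namespace Imp

variable {T : ℕ → ℕ → ℕ}

/-! ### Output of the transitive reduction -/

def climbStep : Cmd :=
  .get .t .ss §.K §.r ;; .ifnz .t (.get .t .ss §.r §.cur ;; .ifnz .t (.set .cur §.r) .skip) .skip

def climb : Cmd := .set .cur §.M ;; .loop .r §.m climbStep

def markStep : Cmd := .get .t .ss §.cur §.r ;; .ifnz .t (.put .mk §.K §.r (.lit 1)) .skip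

def mark : Cmd := .put .mk §.K §.cur (.lit 1) ;; .loop .r §.m markStep

def emitArc : Cmd :=
  .get .t .id §.K (.lit 0) ;; .emit §.t ;; .get .t .id §.cur (.lit 0) ;; .emit §.t

def arcOut : Cmd := climb ;; emitArc ;; mark

def outAt : Cmd :=
  .get .t .ss §.K §.M ;; .ifnz .t (.get .t .mk §.K §.M ;; .ifnz .t .skip arcOut) .skip

def outAll : Cmd := .loop .K §.m (.loop .M §.m outAt)

/-- The matrix `ss` is a strict order on `0, …, m - 1`. -/
structure IsOrder (m : ℕ) (R : ℕ → ℕ → ℕ) : Prop where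
  irrefl : ∀ a < m, R a a = 0
  trans : ∀ a < m, ∀ b < m, ∀ c < m, R a b ≠ 0 → R b c ≠ 0 → R a c ≠ 0

/-- A single pass is enough to reach a maximal set below `K`. Whenever row `r` lies strictly between
`cur` and `K`, `cur` moves up to `r`. A row already passed cannot lie between a later `cur` and `K`,
for by transitivity it would have lain above the earlier one. -/
theorem climb_spec {s : St} {m K M : ℕ} (hm : s.v .m = m) (hR : IsOrder m (s.a .ss)) (hK : s.v .K = K)
    (hM : s.v .M = M) (hMm : M < m) (hKM : s.a .ss K M ≠ 0) :
    ∃ c < m, (ev T climb s).v .cur = c ∧ s.a .ss K c ≠ 0 ∧ (c = M ∨ s.a .ss c M ≠ 0) ∧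
      ∀ r < m, s.a .ss K r ≠ 0 → s.a .ss r c = 0 := by
  set s1 := (s.setV .cur M).tick with hs1
  set R := s.a .ss with hRdef
  obtain ⟨s', hf, ⟨c, hc, h1, h2, h3, h4⟩, he⟩ := loop_rule T .r §.m climbStep s1
    (fun i s' => ∃ c < m, s'.v .cur = c ∧ R K c ≠ 0 ∧ (c = M ∨ R c M ≠ 0) ∧
      ∀ r < i, R K r ≠ 0 → R r c = 0) ⟨M, hMm, by simp [hs1], hKM, .inl rfl, by simp⟩ (by
      rintro i s' hi hf ⟨c, hc, h1, h2, h3, h4⟩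
      simp only [Opd.val_var, hs1, St.tick_v, St.setV_v, reduceCtorEq, if_false, hm] at hi
      have eK : s'.v .K = K := by rw [hf.v .K rfl]; simp [hs1, hK]
      have ess : s'.a .ss = R := by rw [hf.a .ss rfl]; simp [hs1, hRdef]
      by_cases h5 : R K i = 0
      · refine ⟨c, hc, by simp [climbStep, ev, eK, ess, h5, h1], h2, h3, fun r hr hKr => ?_⟩
        rcases Nat.lt_succ_iff_lt_or_eq.mp hr with hr | rfl
        · exact h4 r hr hKr
        · exact absurd h5 hKr
      by_cases h6 : R i c = 0
      · refine ⟨c, hc, by simp [climbStep, ev, eK, ess, h5, h6, h1], h2, h3, fun r hr hKr => ?_⟩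
        rcases Nat.lt_succ_iff_lt_or_eq.mp hr with hr | rfl
        · exact h4 r hr hKr
        · exact h6
      · refine ⟨i, hi, by simp [climbStep, ev, eK, ess, h5, h6, h1], h5, .inr ?_, fun r hr hKr => ?_⟩
        · rcases h3 with rfl | h3
          · exact h6
          · exact hR.trans i hi c hc M hMm h6 h3
        · rcases Nat.lt_succ_iff_lt_or_eq.mp hr with hr | rfl
          · by_contra hne
            exact hR.trans r (by omega) i hi c hc hne h6 (h4 r hr hKr)
          · exact hR.irrefl r hi)
  have e1 : Opd.val s1 §.m = m := by simp [hs1, hm]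
  have : ev T climb s = (s'.setV .r (Opd.val s1 §.m)).tick := by
    rw [← he, hs1]
    simp [climb, ev, hM]
  rw [this]
  rw [e1] at h4
  exact ⟨c, hc, by simpa using h1, h2, h3, h4⟩

/-- Marking the child together with all that lies below it ensures that no later start of a climb
below `K` leads to this child again. -/
theorem mark_spec {s : St} {m K c : ℕ} (hm : s.v .m = m) (hK : s.v .K = K) (hc : s.v .cur = c)
    (i j : ℕ) (hj : j < m) :
    (ev T mark s).a .mk i j ≠ 0 ↔ s.a .mk i j ≠ 0 ∨ (i = K ∧ (j = c ∨ s.a .ss c j ≠ 0)) := by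
  set s1 := (s.setA .mk K c 1).tick with hs1
  obtain ⟨s', hf, h1, he⟩ := loop_rule T .r §.m markStep s1
    (fun l s' => ∀ i j, s'.a .mk i j ≠ 0 ↔ s.a .mk i j ≠ 0 ∨ (i = K ∧ (j = c ∨ (j < l ∧ s.a .ss c j ≠ 0))))
    (by
      intro i j
      simp only [hs1, St.tick_a, St.setA_a, true_and]
      by_cases h : i = K ∧ j = c
      · simp [h]
      · simp only [h, if_false, not_lt_zero, false_and, or_false]) (by
      intro l s' hl hf h1 i j
      have eK : s'.v .K = K := by rw [hf.v .K rfl]; simp [hs1, hK]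
      have ec : s'.v .cur = c := by rw [hf.v .cur rfl]; simp [hs1, hc]
      have ess : s'.a .ss = s.a .ss := by rw [hf.a .ss rfl]; simp [hs1, funext_iff]
      by_cases h2 : s.a .ss c l = 0
      · have : (ev T markStep (s'.setV .r l).tick).a .mk = s'.a .mk := by
          simp [markStep, ev, ec, ess, h2]
        rw [this, h1]
        refine or_congr_right (and_congr_right fun _ => or_congr_right ⟨fun h => ⟨by omega, h.2⟩, fun h => ⟨?_, h.2⟩⟩)
        rcases Nat.lt_succ_iff_lt_or_eq.mp h.1 with h3 | rfl
        · exact h3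
        · exact absurd h2 h.2
      · have : (ev T markStep (s'.setV .r l).tick).a .mk i j = if i = K ∧ j = l then 1 else s'.a .mk i j := by
          simp [markStep, ev, ec, ess, h2, eK]
        rw [this]
        split
        · rename_i h3
          simp only [ne_eq, one_ne_zero, not_false_eq_true, true_iff]
          exact .inr ⟨h3.1, .inr ⟨by omega, by rw [h3.2]; exact h2⟩⟩
        · rename_i h3
          rw [h1]
          refine or_congr_right (and_congr_right fun hi => or_congr_right ⟨fun h => ⟨by omega, h.2⟩, fun h => ⟨?_, h.2⟩⟩)
          rcases Nat.lt_succ_iff_lt_or_eq.mp h.1 with h4 | rfl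
          · exact h4
          · exact absurd ⟨hi, rfl⟩ h3)
  have e1 : Opd.val s1 §.m = m := by simp [hs1, hm]
  have : ev T mark s = (s'.setV .r (Opd.val s1 §.m)).tick := by
    rw [← he, hs1]
    simp [mark, ev, hK, hc]
  rw [this]
  rw [e1] at h1
  change s'.a .mk i j ≠ 0 ↔ _
  rw [h1]
  simp [hj]

/-- The output written for a list of arcs. -/
def arcOutput (f : ℕ → ℕ) (L : List (ℕ × ℕ)) : List ℕ := L.flatMap fun p => [f p.1, f p.2]

/-- The arcs in `L` have been written, after the pairs before `(i, j)` have been examined. -/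
structure Emitted (m : ℕ) (s0 : St) (i j : ℕ) (L : List (ℕ × ℕ)) (s : St) : Prop where
  out : s.out = s0.out ++ arcOutput (fun r => s0.a .id r 0) L
  nodup : L.Nodup
  mem : ∀ p ∈ L, p.1 < m ∧ p.2 < m ∧ s0.a .ss p.1 p.2 ≠ 0 ∧
    ∀ r < m, s0.a .ss p.1 r ≠ 0 → s0.a .ss r p.2 = 0
  marked : ∀ K < m, ∀ r < m, s.a .mk K r ≠ 0 ↔ ∃ c, (K, c) ∈ L ∧ (r = c ∨ s0.a .ss c r ≠ 0)
  done : ∀ K < m, ∀ M < m, (K < i ∨ K = i ∧ M < j) → s0.a .ss K M ≠ 0 → s.a .mk K M ≠ 0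

theorem Emitted.congr {m i j i' j' : ℕ} {s0 s s' : St} {L : List (ℕ × ℕ)} (h : Emitted m s0 i j L s)
    (h1 : s'.out = s.out) (h2 : s'.a .mk = s.a .mk)
    (h3 : ∀ K < m, ∀ M < m, (K < i' ∨ K = i' ∧ M < j') → (K < i ∨ K = i ∧ M < j)) :
    Emitted m s0 i' j' L s' :=
  ⟨by rw [h1]; exact h.out, h.nodup, h.mem, by rw [h2]; exact h.marked,
    fun K hK M hM hd => by rw [h2]; exact h.done K hK M hM (h3 K hK M hM hd)⟩

theorem arcOut_t {s : St} {m : ℕ} (hm : s.v .m = m) : (ev T arcOut s).t ≤ s.t + (20 + 20 * m) := by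
  have h := (ev_t_le (T := T) (c := arcOut) (L := [.m]) (by decide) (b := fun _ => m) (s := s)
    (by simp [hm])).1
  refine h.trans ?_
  simp only [arcOut, climb, emitArc, mark, climbStep, markStep, Cmd.cost, Opd.bound]
  omega

/-- Amortized cost: a call takes at most 5 steps, unless it writes an arc, and then the climb and
the marking, linear in `m`, are charged to that arc. -/
theorem outAt_spec {m K M : ℕ} {s0 s : St} {L : List (ℕ × ℕ)} (hm : s.v .m = m)
    (hR : IsOrder m (s0.a .ss)) (hss : s.a .ss = s0.a .ss) (hid : s.a .id = s0.a .id) (hK : s.v .K = K)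
    (hM : s.v .M = M) (hKm : K < m) (hMm : M < m) (h : Emitted m s0 K M L s) :
    ∃ L', Emitted m s0 K (M + 1) L' (ev T outAt s) ∧
      (ev T outAt s).t + (20 + 20 * m) * L.length ≤ s.t + 5 + (20 + 20 * m) * L'.length := by
  have step : ∀ s' : St, (s0.a .ss K M ≠ 0 → s'.a .mk K M ≠ 0) → s'.out = s.out → s'.a .mk = s.a .mk →
      Emitted m s0 K (M + 1) L s' := by
    intro s' h1 h2 h3
    refine ⟨by rw [h2]; exact h.out, h.nodup, h.mem, by rw [h3]; exact h.marked, fun K' hK' M' hM' hd hs => ?_⟩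
    by_cases hKM : K' = K ∧ M' = M
    · rw [hKM.1, hKM.2] at hs ⊢
      exact h1 hs
    · rw [h3]
      exact h.done K' hK' M' hM' (by omega) hs
  by_cases h1 : s0.a .ss K M = 0
  · have e : ev T outAt s = (s.setV .t 0).tick.tick.tick := by
      simp [outAt, ev, hK, hM, hss, h1]
    rw [e]
    exact ⟨L, step _ (fun h => absurd h1 h) rfl rfl, by simp⟩
  by_cases h2 : s.a .mk K M = 0
  · set s1 := ((s.setV .t (s0.a .ss K M)).tick.tick.setV .t 0).tick.tick with hs1
    have e : ev T outAt s = ev T arcOut s1 := by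
      simp [outAt, ev, hK, hM, hss, h1, h2, hs1]
    rw [e]
    have e1m : s1.v .m = m := by simp [hs1, hm]
    have e1K : s1.v .K = K := by simp [hs1, hK]
    have e1M : s1.v .M = M := by simp [hs1, hM]
    have e1ss : s1.a .ss = s0.a .ss := by simp [hs1, hss]
    obtain ⟨c, hc, h3, h4, h5, h6⟩ := climb_spec (T := T) e1m (by rw [e1ss]; exact hR) e1K e1M hMm
      (by rw [e1ss]; exact h1)
    rw [e1ss] at h4 h5 h6
    set s2 := ev T climb s1 with hs2
    have f2 : Frame climb s1 s2 := frame_ev _ _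
    have e2o : s2.out = s.out := by rw [hs2, ev_out rfl]; rfl
    have e2K : s2.v .K = K := by rw [f2.v .K rfl, e1K]
    have e2id : s2.a .id = s0.a .id := by rw [f2.a .id rfl]; simp [hs1, hid]
    set s3 := ev T emitArc s2 with hs3
    have f3 : Frame emitArc s2 s3 := frame_ev _ _
    have e3o : s3.out = s.out ++ [s0.a .id K 0, s0.a .id c 0] := by
      simp [hs3, emitArc, ev, e2o, e2K, e2id, h3]
    have e3mk : s3.a .mk = s.a .mk := by rw [f3.a .mk rfl, f2.a .mk rfl]; simp [hs1]
    have e3ss : s3.a .ss = s0.a .ss := by rw [f3.a .ss rfl, f2.a .ss rfl, e1ss]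
    have h7 := mark_spec (T := T) (s := s3) (m := m) (K := K) (c := c)
      (by rw [f3.v .m rfl, f2.v .m rfl, e1m]) (by rw [f3.v .K rfl, e2K]) (by rw [f3.v .cur rfl, h3])
    set s4 := ev T mark s3 with hs4
    have e4o : s4.out = s.out ++ [s0.a .id K 0, s0.a .id c 0] := by rw [hs4, ev_out rfl, e3o]
    have e4 : ev T arcOut s1 = s4 := rfl
    rw [e3mk, e3ss] at h7
    have ht := arcOut_t (T := T) e1m
    rw [e4] at ht ⊢
    have e1t : s1.t = s.t + 4 := by simp [hs1]
    have hm4 : ∀ K' < m, ∀ r < m, s4.a .mk K' r ≠ 0 ↔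
        ∃ c', (K', c') ∈ L ++ [(K, c)] ∧ (r = c' ∨ s0.a .ss c' r ≠ 0) := by
      intro K' hK' r hr
      rw [h7 K' r hr, h.marked K' hK' r hr]
      constructor
      · rintro (⟨c', h8, h9⟩ | ⟨rfl, h9⟩)
        · exact ⟨c', List.mem_append_left _ h8, h9⟩
        · exact ⟨c, by simp, h9⟩
      · rintro ⟨c', h8, h9⟩
        rcases List.mem_append.mp h8 with h8 | h8
        · exact .inl ⟨c', h8, h9⟩
        · simp only [List.mem_singleton, Prod.mk.injEq] at h8
          rw [h8.2] at h9
          exact .inr ⟨h8.1, h9⟩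
    refine ⟨L ++ [(K, c)], ⟨?_, ?_, ?_, hm4, ?_⟩, ?_⟩
    · rw [e4o, h.out]
      simp [arcOutput]
    -- Had the arc been written before, `M` would have been marked as lying below its head or being
    -- equal to it.
    · rw [List.nodup_append]
      refine ⟨h.nodup, by simp, ?_⟩
      rintro a ha b hb rfl
      simp only [List.mem_singleton] at hb
      rw [hb] at ha
      exact (h.marked K hKm M hMm).mpr ⟨c, ha, h5.imp Eq.symm id⟩ h2
    · intro p hp
      rcases List.mem_append.mp hp with hp | hp
      · exact h.mem p hp
      · simp only [List.mem_singleton] at hp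
        rw [hp]
        exact ⟨hKm, hc, h4, h6⟩
    · intro K' hK' M' hM' hd hs
      by_cases hKM : K' = K ∧ M' = M
      · rw [hKM.1, hKM.2, hm4 K hKm M hMm]
        exact ⟨c, by simp, h5.imp Eq.symm id⟩
      · rw [h7 K' M' hM']
        exact .inl (h.done K' hK' M' hM' (by omega) hs)
    · rw [List.length_append, List.length_singleton, Nat.mul_succ]
      omega
  · have e : ev T outAt s = ((s.setV .t (s0.a .ss K M)).tick.tick.setV .t (s.a .mk K M)).tick.tick.tick := by
      simp [outAt, ev, hK, hM, hss, h1, h2]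
    rw [e]
    exact ⟨L, step _ (fun _ => h2) rfl rfl, by simp⟩

theorem outAll_spec {m : ℕ} {s : St} (hm : s.v .m = m) (hR : IsOrder m (s.a .ss))
    (hmk : ∀ i j, s.a .mk i j = 0) :
    ∃ L : List (ℕ × ℕ), L.Nodup ∧
      (∀ K c, (K, c) ∈ L ↔ K < m ∧ c < m ∧ s.a .ss K c ≠ 0 ∧
        ∀ r < m, s.a .ss K r ≠ 0 → s.a .ss r c = 0) ∧
      (ev T outAll s).out = s.out ++ arcOutput (fun r => s.a .id r 0) L ∧
      (ev T outAll s).t ≤ s.t + 2 + m * (3 + 6 * m) + (20 + 20 * m) * L.length := by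
  obtain ⟨s', hf, ⟨L, h1, h2⟩, he⟩ := loop_rule T .K §.m (.loop .M §.m outAt) s
    (fun i s' => ∃ L, Emitted m s i 0 L s' ∧
      s'.t ≤ s.t + 1 + i * (3 + 6 * m) + (20 + 20 * m) * L.length)
    ⟨[], ⟨by simp [arcOutput], by simp, by simp, by simp [hmk], by omega⟩, by simp⟩ (by
      rintro i s' hi hf ⟨L, h1, h2⟩
      simp only [Opd.val_var, hm] at hi
      set s1 := (s'.setV .K i).tick with hs1
      have e1m : s1.v .m = m := by simp [hs1, hf.v .m rfl, hm]
      obtain ⟨s2, f2, ⟨L2, h3, h4⟩, he⟩ := loop_rule T .M §.m outAt s1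
        (fun j s' => ∃ L', Emitted m s i j L' s' ∧
          s'.t + (20 + 20 * m) * L.length ≤ s1.t + 1 + j * 6 + (20 + 20 * m) * L'.length)
        ⟨L, h1.congr rfl rfl (fun _ _ _ _ h => h), by simp⟩ (by
          rintro j s2 hj f2 ⟨L2, h3, h4⟩
          simp only [Opd.val_var, e1m] at hj
          obtain ⟨L3, h5, h6⟩ := outAt_spec (T := T) (m := m) (K := i) (M := j) (s0 := s) (L := L2)
            (s := (s2.setV .M j).tick) (by simp [f2.v .m rfl, e1m]) hR
            (by simp [f2.a .ss rfl, hs1, hf.a .ss rfl]) (by simp [f2.a .id rfl, hs1, hf.a .id rfl])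
            (by simp [f2.v .K rfl, hs1]) (by simp) hi hj (h3.congr rfl rfl (fun _ _ _ _ h => h))
          refine ⟨L3, h5, ?_⟩
          simp only [St.tick_t, St.setV_t] at h6
          omega)
      rw [he]
      refine ⟨L2, h3.congr rfl rfl (fun K _ M hM hd => ?_), ?_⟩
      · simp only [Opd.val_var, e1m]
        omega
      · simp only [Opd.val_var, e1m] at h4
        simp only [St.tick_t, St.setV_t]
        have : s1.t = s'.t + 1 := rfl
        rw [Nat.succ_mul]
        omega)
  have e1 : Opd.val s §.m = m := by simp [hm]
  have : ev T outAll s = (s'.setV .K (Opd.val s §.m)).tick := by rw [← he]; rfl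
  rw [this]
  rw [e1] at h1 h2
  refine ⟨L, h1.nodup, fun K c => ⟨fun h => h1.mem _ h, fun ⟨hK, hc, h3, h4⟩ => ?_⟩, h1.out, ?_⟩
  -- Everything below `K` is marked in the end. A `c` with nothing strictly between it and `K` can
  -- be marked only as a child of `K` itself.
  · obtain ⟨c', h5, h6⟩ := (h1.marked K hK c hc).mp (h1.done K hK c hc (.inl hK) h3)
    rcases h6 with rfl | h6
    · exact h5
    · have h7 := h1.mem _ h5
      exact absurd (h4 c' h7.2.1 h7.2.2.1) h6
  · simp only [St.tick_t, St.setV_t]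
    omega

end Imp

namespace Imp

variable {n k : ℕ} {Z : FSM (Fin n) (Fin k)}

/-! ### Encodings of the decomposition tree -/

/-- `S 0, …, S (m - 1)`, restricted to `ok`, lists the indecomposable thin modules, the singletons
first. -/
structure Listing (Z : FSM (Fin n) (Fin k)) (m : ℕ) (ok : ℕ → Prop) (S : ℕ → Set (Fin n)) : Prop where
  le : n ≤ m
  sound : ∀ r < m, ok r → S r ∈ Z.Ind
  complete : ∀ K ∈ Z.Ind, ∃ r < m, ok r ∧ S r = K
  single : ∀ q : Fin n, ok q ∧ S q = {q}

/-- `r` is the first index of `S r`. -/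
def First (ok : ℕ → Prop) (S : ℕ → Set (Fin n)) (r : ℕ) : Prop := ok r ∧ ∀ q < r, ok q → S q ≠ S r

variable {m : ℕ} {ok : ℕ → Prop} {S : ℕ → Set (Fin n)} {C : ℕ → Prop} {L : List (ℕ × ℕ)}

theorem eq_of_first (hC : ∀ r < m, C r ↔ First ok S r) {a b : ℕ} (ha : a < m) (hb : b < m) (hCa : C a)
    (hCb : C b) (h : S a = S b) : a = b := by
  have h1 := (hC a ha).mp hCa
  have h2 := (hC b hb).mp hCb
  rcases lt_trichotomy a b with hlt | heq | hlt
  · exact absurd h (h2.2 a hlt h1.1)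
  · exact heq
  · exact absurd h.symm (h1.2 b hlt h2.1)

theorem Listing.exists_first (h : Listing Z m ok S) (hC : ∀ r < m, C r ↔ First ok S r) {K : Set (Fin n)}
    (hK : K ∈ Z.Ind) : ∃ r < m, C r ∧ S r = K := by
  classical
  have hex := h.complete K hK
  have h1 := Nat.find_spec hex
  refine ⟨Nat.find hex, h1.1, (hC _ h1.1).mpr ⟨h1.2.1, fun q hq hok heq => ?_⟩, h1.2.2⟩
  exact Nat.find_min hex hq ⟨hq.trans h1.1, hok, heq.trans h1.2.2⟩

/-- The arcs of the decomposition tree, as pairs of indices. -/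
def IsArcs (m : ℕ) (C : ℕ → Prop) (S : ℕ → Set (Fin n)) (L : List (ℕ × ℕ)) : Prop :=
  ∀ a b, (a, b) ∈ L ↔ a < m ∧ b < m ∧ C a ∧ C b ∧ S b ⊂ S a ∧ ∀ r < m, C r → S r ⊂ S a → ¬ S b ⊂ S r

/-- Count arcs by their heads. The parents of a set are pairwise incomparable, all contain any
chosen state `q` of it, and none is `{q}`; so there are at most `3 * k` of them. This is where the
antichain bound pays for the cost of O(m) per arc. -/
theorem Listing.length_le (hZ : Z.Accessible) (h : Listing Z m ok S) (hC : ∀ r < m, C r ↔ First ok S r)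
    (hnd : L.Nodup) (hL : IsArcs m C S L) : L.length ≤ 3 * k * m := by
  classical
  rw [← List.toFinset_card_of_nodup hnd]
  have key := Finset.card_le_mul_card_image_of_maps_to (s := L.toFinset) (t := Finset.range m)
    (f := Prod.snd) (fun p hp => Finset.mem_range.mpr ((hL p.1 p.2).mp (List.mem_toFinset.mp hp)).2.1)
    (3 * k) (by
      intro c hc
      have hmem : ∀ p ∈ L.toFinset.filter (fun p => p.2 = c), (p.1, c) ∈ L := by
        intro p hp
        rw [Finset.mem_filter, List.mem_toFinset] at hp
        rw [← hp.2]
        exact hp.1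
      by_cases hemp : (L.toFinset.filter (fun p => p.2 = c)) = ∅
      · rw [hemp]; simp
      obtain ⟨p0, hp0⟩ := Finset.nonempty_iff_ne_empty.mpr hemp
      obtain ⟨-, hcm, -, hCc, -, -⟩ := (hL _ _).mp (hmem p0 hp0)
      have hcI := h.sound c hcm ((hC c hcm).mp hCc).1
      obtain ⟨q, hq⟩ : (S c).Nonempty := hcI.1.1.1
      have hinj : Set.InjOn (fun p : ℕ × ℕ => S p.1) (L.toFinset.filter (fun p => p.2 = c) : Set (ℕ × ℕ)) := by
        intro p hp p' hp' heq
        obtain ⟨h1, -, h2, -⟩ := (hL _ _).mp (hmem p hp)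
        obtain ⟨h1', -, h2', -⟩ := (hL _ _).mp (hmem p' hp')
        have h3 := (Finset.mem_filter.mp hp).2
        have h3' := (Finset.mem_filter.mp hp').2
        exact Prod.ext (eq_of_first hC h1 h1' h2 h2' heq) (h3.trans h3'.symm)
      rw [← Finset.card_image_of_injOn hinj]
      have hb := FSM.card_antichain_le hZ (q := q)
        (S := (L.toFinset.filter (fun p => p.2 = c)).image (fun p : ℕ × ℕ => S p.1)) (by
          intro K hK
          obtain ⟨p, hp, rfl⟩ := Finset.mem_image.mp hK
          obtain ⟨h1, -, h2, -, h3, -⟩ := (hL _ _).mp (hmem p hp)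
          refine ⟨h.sound p.1 h1 ((hC _ h1).mp h2).1, h3.1 hq, fun heq => ?_⟩
          simp only [heq] at h3
          exact h3.2 (Set.singleton_subset_iff.mpr hq)) (by
          intro K hK K' hK' hne hsub
          obtain ⟨p, hp, rfl⟩ := Finset.mem_image.mp hK
          obtain ⟨p', hp', rfl⟩ := Finset.mem_image.mp hK'
          obtain ⟨h1, -, h2, -, h3, -⟩ := (hL _ _).mp (hmem p hp)
          obtain ⟨-, -, -, -, -, h4⟩ := (hL _ _).mp (hmem p' hp')
          exact h4 p.1 h1 h2 (hsub.ssubset_of_ne hne) h3)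
      simpa using hb)
  simpa using key

open Classical in
-- On first occurrences, `Nat.count C` and `Nat.nth C` are mutually inverse, which gives the
-- numbering of the nodes. An indecomposable module between two sets always has a row, so testing
-- rows is the same as testing nodes.
theorem Listing.isTreeEncoding (h : Listing Z m ok S) (hC : ∀ r < m, C r ↔ First ok S r)
    (hnd : L.Nodup) (hL : IsArcs m C S L) :
    Z.IsTreeEncoding (Nat.count C m :: arcOutput (Nat.count C) L) := by
  set N := Nat.count C m with hN
  have hcard : ∀ j < N, ∀ hf : {j | C j}.Finite, j < hf.toFinset.card := fun j hj hf =>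
    hj.trans_le (Nat.count_le_card hf m)
  have hlt : ∀ j < N, Nat.nth C j < m := fun j hj => Nat.nth_lt_of_lt_count hj
  have hCn : ∀ j < N, C (Nat.nth C j) := fun j hj => Nat.nth_mem j (hcard j hj)
  have hcn : ∀ j < N, Nat.count C (Nat.nth C j) = j := fun j hj => Nat.count_nth (hcard j hj)
  have hcl : ∀ r < m, C r → Nat.count C r < N := fun r hr hCr => Nat.count_strict_mono hCr hr
  have hnc : ∀ r, C r → Nat.nth C (Nat.count C r) = r := fun r hr => Nat.nth_count hr
  let f : Fin N → Z.Ind := fun j => ⟨S (Nat.nth C j), h.sound _ (hlt j j.2)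
    ((hC _ (hlt j j.2)).mp (hCn j j.2)).1⟩
  have hf : Function.Bijective f := by
    constructor
    · intro i j hij
      have : Nat.nth C i = Nat.nth C j := eq_of_first hC (hlt i i.2) (hlt j j.2) (hCn i i.2) (hCn j j.2)
        (congrArg Subtype.val hij)
      exact Fin.ext (by rw [← hcn i i.2, this, hcn j j.2])
    · rintro ⟨K, hK⟩
      obtain ⟨r, hr, hCr, rfl⟩ := h.exists_first hC hK
      exact ⟨⟨Nat.count C r, hcl r hr hCr⟩, Subtype.ext (by simp [f, hnc r hCr])⟩
  have hsing : ∀ i < n, C i := by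
    intro i hi
    refine (hC i (hi.trans_le h.le)).mpr ⟨(h.single ⟨i, hi⟩).1, fun q hq _ heq => ?_⟩
    have h1 := (h.single ⟨i, hi⟩).2
    have h2 := (h.single ⟨q, hq.trans hi⟩).2
    rw [h1, h2] at heq
    have := congrArg Fin.val (Set.singleton_injective heq)
    simp at this
    omega
  have hci : ∀ i < n, Nat.count C i = i := fun i hi =>
    Nat.count_iff_forall.mpr fun j hj => hsing j (hj.trans hi)
  have hpos : 0 < N := by
    have := Z.start.2
    have h1 := hcl 0 (by have := h.le; omega) (hsing 0 (by omega))
    omega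
  -- The value of `g` is irrelevant at rows that are not first occurrences. The default 0 is a legal
  -- node because row 0, a singleton, counts.
  obtain ⟨g, hg⟩ : ∃ g : ℕ → Fin N, ∀ r < m, C r → (g r).val = Nat.count C r :=
    ⟨fun r => if hr : Nat.count C r < N then ⟨_, hr⟩ else ⟨0, hpos⟩, fun r hr hCr => by
      simp [hcl r hr hCr]⟩
  refine ⟨N, Equiv.ofBijective f hf, L.map fun p => (g p.1, g p.2), ?_, ?_, ?_, ?_⟩
  · intro i
    have h1 := hcl i (i.2.trans_le h.le) (hsing i i.2)
    rw [hci i i.2] at h1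
    refine ⟨⟨i, h1⟩, rfl, ?_⟩
    change S (Nat.nth C i) = {i}
    have := hnc i (hsing i i.2)
    rw [hci i i.2] at this
    rw [this]
    exact (h.single i).2
  · refine List.Nodup.map_on ?_ hnd
    rintro ⟨a, b⟩ hp ⟨a', b'⟩ hp' heq
    obtain ⟨h1, h2, h3, h4, -⟩ := (hL _ _).mp hp
    obtain ⟨h1', h2', h3', h4', -⟩ := (hL _ _).mp hp'
    simp only [Prod.mk.injEq, Fin.ext_iff] at heq
    rw [hg _ h1 h3, hg _ h1' h3', hg _ h2 h4, hg _ h2' h4'] at heq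
    rw [← hnc a h3, ← hnc b h4, heq.1, heq.2, hnc a' h3', hnc b' h4']
  · intro a b
    rw [FSM.treeArc_iff]
    change _ ↔ S (Nat.nth C b) ⊂ S (Nat.nth C a) ∧ ¬ ∃ K ∈ Z.Ind, S (Nat.nth C b) ⊂ K ∧ K ⊂ S (Nat.nth C a)
    have hga : ∀ j : Fin N, g (Nat.nth C j) = j := fun j => Fin.ext (by
      rw [hg _ (hlt j j.2) (hCn j j.2), hcn j j.2])
    have : (a, b) ∈ L.map (fun p => (g p.1, g p.2)) ↔ (Nat.nth C a, Nat.nth C b) ∈ L := by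
      rw [List.mem_map]
      constructor
      · rintro ⟨⟨a', b'⟩, hp, heq⟩
        obtain ⟨h1, h2, h3, h4, -⟩ := (hL _ _).mp hp
        simp only [Prod.mk.injEq] at heq
        rw [← heq.1, ← heq.2, hg _ h1 h3, hg _ h2 h4, hnc _ h3, hnc _ h4]
        exact hp
      · intro hp
        exact ⟨_, hp, by simp [hga]⟩
    rw [this, hL]
    constructor
    · rintro ⟨-, -, -, -, h1, h2⟩
      refine ⟨h1, ?_⟩
      rintro ⟨K, hK, h3, h4⟩
      obtain ⟨r, hr, hCr, rfl⟩ := h.exists_first hC hK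
      exact h2 r hr hCr h4 h3
    · rintro ⟨h1, h2⟩
      exact ⟨hlt a a.2, hlt b b.2, hCn a a.2, hCn b b.2, h1, fun r hr hCr h3 h4 =>
        h2 ⟨_, h.sound r hr ((hC r hr).mp hCr).1, h4, h3⟩⟩
  · congr 1
    rw [arcOutput, List.flatMap_map]
    refine List.flatMap_congr fun p hp => ?_
    obtain ⟨h1, h2, h3, h4, -⟩ := (hL p.1 p.2).mp hp
    rw [hg _ h1 h3, hg _ h2 h4]

end Imp

namespace Imp

variable {n k : ℕ} {Z : FSM (Fin n) (Fin k)} {T : ℕ → ℕ → ℕ}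

/-! ### The whole program -/

def thrice (x : Var) : Cmd := .inc x ;; .inc x ;; .inc x

def setup : Cmd :=
  .set .m (.lit 0) ;; .loop .i §.n (thrice .m) ;;
  .set .bn (.lit 0) ;; .loop .i §.n (.inc .bn ;; .loop .j §.k (thrice .bn))

def prepare : Cmd := cyc ;; admits ;; rows ;; subs ;; canon ;; stricts ;; .emit §.cn

/-- Compute the decomposition tree. -/
def main : Cmd := setup ;; prepare ;; outAll

theorem setup_spec {s : St} (hn : s.v .n = n) (hk : s.v .k = k) :
    (ev T setup s).v .m = 3 * n ∧ (ev T setup s).v .bn = 3 * n * k + n := by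
  obtain ⟨s1, f1, h1, e1⟩ := loop_rule T .i §.n (thrice .m) (s.setV .m 0).tick
    (fun i s' => s'.v .m = 3 * i) (by simp) (by
      intro i s' _ _ h
      simp [thrice, ev, h]
      omega)
  set s2 := ((s1.setV .i n).tick.setV .bn 0).tick with hs2
  have e2n : s2.v .n = n := by simp [hs2, f1.v .n rfl, hn]
  have e2k : s2.v .k = k := by simp [hs2, f1.v .k rfl, hk]
  obtain ⟨s3, f3, h3, e3⟩ := loop_rule T .i §.n (.inc .bn ;; .loop .j §.k (thrice .bn)) s2
    (fun i s' => s'.v .bn = 3 * i * k + i) (by simp [hs2]) (by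
      intro i s' _ f h
      set s4 := ((s'.setV .i i).tick.setV .bn (s'.v .bn + 1)).tick with hs4
      have e4k : s4.v .k = k := by simp [hs4, f.v .k rfl, e2k]
      obtain ⟨s5, f5, h5, e5⟩ := loop_rule T .j §.k (thrice .bn) s4
        (fun j s' => s'.v .bn = 3 * i * k + i + 1 + 3 * j) (by simp [hs4, h]) (by
          intro j s' _ _ h
          simp [thrice, ev, h]
          omega)
      have : ev T (.inc .bn ;; .loop .j §.k (thrice .bn)) (s'.setV .i i).tick =
          ev T (.loop .j §.k (thrice .bn)) s4 := rfl
      rw [this, e5]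
      simp only [Opd.val_var, e4k] at h5
      simp only [St.tick_v, St.setV_v, reduceCtorEq, if_false, h5]
      ring)
  have e : ev T setup s = (s3.setV .i n).tick := by
    have : ev T setup s = ev T (.set .bn (.lit 0) ;; .loop .i §.n (.inc .bn ;; .loop .j §.k (thrice .bn)))
      (ev T (.loop .i §.n (thrice .m)) (s.setV .m 0).tick) := rfl
    rw [this, e1]
    have h4 : ((s1.setV .i (Opd.val (s.setV .m 0).tick §.n)).tick.setV .bn 0).tick = s2 := by
      simp [hs2, hn]
    have : ∀ s : St, ev T (.set .bn (.lit 0) ;; .loop .i §.n (.inc .bn ;; .loop .j §.k (thrice .bn))) s =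
      ev T (.loop .i §.n (.inc .bn ;; .loop .j §.k (thrice .bn))) (s.setV .bn 0).tick := fun _ => rfl
    rw [this, h4, e3]
    simp [e2n]
  rw [e]
  simp only [Opd.val_var, e2n] at h3
  refine ⟨?_, by simpa using h3⟩
  simp only [St.tick_v, St.setV_v, reduceCtorEq, if_false]
  rw [f3.v .m rfl]
  simpa [hs2, hn] using h1

/-- Bounds for the loop bounds. -/
def bnd (n k : ℕ) : Var → ℕ
  | .k => k
  | .m => 3 * n
  | .bn => 3 * n * k + n
  | _ => n

theorem setup_cost : setup.cost (bnd n k) = 6 + 8 * n + 4 * (n * k) := by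
  simp only [setup, thrice, Cmd.cost, Opd.bound, bnd, Function.update_apply, reduceCtorEq, if_false]
  ring

/-- The terms of order `n ^ 2 * k` include the searches, one per entry and per row, the cycle test
and the containment test. The terms without `k` are kept apart for the case of an empty alphabet. -/
theorem prepare_cost :
    prepare.cost (bnd n k) = 23 + 159 * n + 76 * (n * k) + 435 * n ^ 2 + 628 * (n ^ 2 * k) := by
  simp only [prepare, cyc, cycAt, cycWalk, cycStep, admits, admitsAt, admitsRow, reach, build, walk,
    walkInit, walkStep, clr, arcsAt, arcsPred, arcsOff, addArc, push, search, searchInit, searchStep,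
    searchArc, rows, singles, singleAt, nears, nearAt, near, nearStep, update, hullRow, mkRow, mkSet,
    copyStep, exitAt, exitStep, exitRows, exitRowAt, nearExit, nearExitStep, exitRow, notSub,
    notSubStep, subs, subAt, subTest, subStep, canon, canonAt, canonStep, stricts, strictAt, Cmd.cost,
    Opd.bound, bnd, Function.update_apply, reduceCtorEq, if_false, if_true]
  ring

/-- The initial state. -/
def St.initial (Z : FSM (Fin n) (Fin k)) : St where
  v := fun
    | .n => n
    | .k => k
    | .s => Z.start
    | _ => 0
  a := fun _ _ _ => 0
  out := []
  t := 0

theorem Table.listing {s : St} (h : Table Z s) :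
    Listing Z (3 * n) (fun r => s.a .ok r 0 ≠ 0) (s.set n) where
  le := by omega
  sound r hr hok := by
    obtain ⟨u, v, h1, -, h2⟩ := h.sound r hr hok
    rwa [h1.set_eq]
  complete K hK := by
    obtain ⟨r, hr, hok, u, v, h1, rfl⟩ := h.complete K hK
    exact ⟨r, hr, hok, h1.set_eq⟩
  single q := ⟨(h.single q).1, by rw [(h.single q).2.set_eq, FSM.hull_self]⟩

theorem arcOutput_congr {f g : ℕ → ℕ} {L : List (ℕ × ℕ)}
    (h : ∀ p ∈ L, f p.1 = g p.1 ∧ f p.2 = g p.2) : arcOutput f L = arcOutput g L := by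
  unfold arcOutput
  induction L with
  | nil => rfl
  | cons p L ih =>
    rw [List.flatMap_cons, List.flatMap_cons, ih fun q hq => h q (List.mem_cons_of_mem _ hq),
      (h p List.mem_cons_self).1, (h p List.mem_cons_self).2]

open Classical in
/-- The state after the preparations: the containment order on the listed modules is known. -/
theorem prepare_spec (hZ : Z.Accessible) {s : St} (hn : s.v .n = n) (hk : s.v .k = k)
    (hs : s.v .s = Z.start) (hm : s.v .m = 3 * n) (hbn : s.v .bn = 3 * n * k + n) :
    ∃ (ok C : ℕ → Prop) (S : ℕ → Set (Fin n)), Listing Z (3 * n) ok S ∧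
      (∀ r < 3 * n, C r ↔ First ok S r) ∧
      (∀ a < 3 * n, ∀ b < 3 * n, (ev (table Z) prepare s).a .ss a b ≠ 0 ↔ C a ∧ C b ∧ S b ⊂ S a) ∧
      (∀ r < 3 * n, (ev (table Z) prepare s).a .id r 0 = Nat.count C r) ∧
      (ev (table Z) prepare s).out = s.out ++ [Nat.count C (3 * n)] := by
  set T := table Z
  set s1 := ev T cyc s with h1
  have f1 : Frame cyc s s1 := frame_ev _ _
  have c1 : Ctx Z s1 := ⟨by rw [f1.v .n rfl, hn], by rw [f1.v .k rfl, hk], by rw [f1.v .s rfl, hs],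
    by rw [f1.v .m rfl, hm], by rw [f1.v .bn rfl, hbn], cyc_spec hn hk⟩
  set s2 := ev T admits s1 with h2
  have c2 : Ctx Z s2 := c1.of_frame (frame_ev _ _) rfl
  set s3 := ev T rows s2 with h3
  have c3 : Ctx Z s3 := c2.of_frame (frame_ev _ _) rfl
  have t3 : Table Z s3 := rows_spec hZ c2 (admits_spec c1)
  set s4 := ev T subs s3 with h4
  have f4 : Frame subs s3 s4 := frame_ev _ _
  have su4 := subs_spec hZ c3 t3
  have c4 : Ctx Z s4 := c3.of_frame f4 rfl
  obtain ⟨cn5, ca5⟩ := canon_spec (Z := Z) c4.hm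
  set s5 := ev T canon s4 with h5
  have f5 : Frame canon s4 s5 := frame_ev _ _
  have c5 : Ctx Z s5 := c4.of_frame f5 rfl
  have ss6 := stricts_spec (T := T) c5.hm
  set s6 := ev T stricts s5 with h6
  have f6 : Frame stricts s5 s6 := frame_ev _ _
  have e7 : ev T prepare s = (s6.emit (s6.v .cn)).tick := rfl
  have hC : ∀ r < 3 * n, Canon s4 r ↔ First (fun r => s3.a .ok r 0 ≠ 0) (s3.set n) r := by
    intro r hr
    unfold Canon First
    rw [f4.a .ok rfl]
    refine and_congr_right fun hok => forall₂_congr fun q hq => ?_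
    rw [su4 r hr q (by omega), su4 q (by omega) r hr]
    constructor
    · exact fun h hq' he => h ⟨⟨hok, hq', he.le⟩, hq', hok, he.ge⟩
    · exact fun h h' => h h'.2.1 (h'.1.2.2.antisymm h'.2.2.2)
  refine ⟨fun r => s3.a .ok r 0 ≠ 0, Canon s4, s3.set n, t3.listing, hC, ?_, ?_, ?_⟩
  · intro a ha b hb
    rw [e7, St.tick_a, St.emit_a, ss6 a ha b hb, (ca5 a ha).1, (ca5 b hb).1, f5.a .su rfl,
      su4 a ha b hb]
    constructor
    · rintro ⟨⟨-, -, h⟩, hne, h1, h2⟩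
      exact ⟨h1, h2, h.ssubset_of_ne fun he => hne (eq_of_first hC ha hb h1 h2 he.symm)⟩
    · rintro ⟨h1, h2, h⟩
      exact ⟨⟨((hC a ha).mp h1).1, ((hC b hb).mp h2).1, h.subset⟩,
        fun he => h.ne (by rw [he]), h1, h2⟩
  · intro r hr
    rw [e7, St.tick_a, St.emit_a, f6.a .id rfl, (ca5 r hr).2]
  · rw [e7, St.tick_out, St.emit_out, f6.v .cn rfl, cn5]
    have o : s6.out = s.out := ((((((ev_out (c := stricts) (by decide) s5).trans
      (ev_out (c := canon) (by decide) s4)).trans (ev_out (c := subs) (by decide) s3)).trans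
      (ev_out (c := rows) (by decide) s2)).trans (ev_out (c := admits) (by decide) s1)).trans
      (ev_out (c := cyc) (by decide) s))
    rw [o]

/-- Only the empty word exists. This is what allows `n ^ 2` to be bounded by `n ^ 2 * k + 1` when
there are no symbols. -/
theorem eq_one_of_accessible {Z : FSM (Fin n) (Fin 0)} (hZ : Z.Accessible) : n = 1 := by
  have h : ∀ q, q = Z.start := by
    intro q
    obtain ⟨w, hw⟩ := hZ q
    obtain rfl : w = [] := List.eq_nil_of_subset_nil fun a => a.elim0
    simpa [FSM.output, eq_comm] using hw
  have : Subsingleton (Fin n) := ⟨fun a b => (h a).trans (h b).symm⟩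
  have := Fin.subsingleton_iff_le_one.mp this
  have := Z.start.pos
  omega

/-- The constant 2200 is a rounded sum: the coefficients of `setup_cost`, `prepare_cost` and the
output phase, with every monomial bounded by `n ^ 2 * k + 1`. -/
theorem main_spec (hZ : Z.Accessible) :
    Z.IsTreeEncoding (ev (table Z) main (.initial Z)).out ∧
      (ev (table Z) main (.initial Z)).t ≤ 2200 * (n ^ 2 * k + 1) := by
  classical
  set T := table Z
  set s0 := St.initial Z with h0
  obtain ⟨m1, bn1⟩ := setup_spec (T := T) (s := s0) (n := n) (k := k) rfl rfl
  have t1 := (ev_t_le (T := T) (c := setup) (L := [.n, .k]) (b := bnd n k) (s := s0) (by decide)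
    (by simp [bnd, h0, St.initial])).1
  have o1 : (ev T setup s0).out = [] := ev_out (c := setup) (by decide) s0
  have e3 : ev T main s0 = ev T outAll (ev T prepare (ev T setup s0)) := rfl
  have f1 : Frame setup s0 (ev T setup s0) := frame_ev _ _
  rw [e3]
  clear e3
  generalize ev T setup s0 = s1 at *
  have n1 : s1.v .n = n := f1.v .n rfl
  have k1 : s1.v .k = k := f1.v .k rfl
  obtain ⟨ok, C, S, hS, hC, ss2, id2, out2⟩ := prepare_spec hZ n1 k1 (f1.v .s rfl) m1 bn1
  have t2 := (ev_t_le (T := T) (c := prepare) (L := [.n, .k, .m, .bn]) (b := bnd n k) (s := s1)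
    (by decide) (by simp [bnd, n1, k1, m1, bn1])).1
  have f2 : Frame prepare s1 (ev T prepare s1) := frame_ev _ _
  generalize ev T prepare s1 = s2 at *
  obtain ⟨L, hnd, hL, out3, t3⟩ := outAll_spec (T := T) ((f2.v .m rfl).trans m1) (s := s2) (by
      refine ⟨fun a ha => ?_, fun a ha b hb c hc hab hbc => ?_⟩
      · by_contra h
        exact ((ss2 a ha a ha).mp h).2.2.ne rfl
      · rw [ss2 a ha b hb] at hab
        rw [ss2 b hb c hc] at hbc
        exact (ss2 a ha c hc).mpr ⟨hab.1, hbc.2.1, hbc.2.2.trans hab.2.2⟩) (by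
      intro i j
      rw [f2.a .mk rfl, f1.a .mk rfl]
      rfl)
  have hA : IsArcs (3 * n) C S L := by
    intro a b
    rw [hL]
    refine and_congr_right fun ha => and_congr_right fun hb => ?_
    rw [ss2 a ha b hb, and_assoc, and_assoc]
    refine and_congr_right fun hCa => and_congr_right fun hCb => and_congr_right fun _ =>
      forall₂_congr fun r hr => ?_
    rw [← not_ne_iff (a := s2.a .ss r b), ss2 a ha r hr, ss2 r hr b hb]
    exact ⟨fun h hCr h1 h2 => h ⟨hCa, hCr, h1⟩ ⟨hCr, hCb, h2⟩,
      fun h h1 h2 => h h1.2.1 h1.2.2 h2.2.2⟩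
  have hlen := hS.length_le hZ hC hnd hA
  refine ⟨?_, t3.trans ?_⟩
  · rw [out3, out2, o1, List.nil_append, List.singleton_append]
    rw [arcOutput_congr (g := Nat.count C) fun p hp =>
      ⟨id2 _ ((hA p.1 p.2).mp hp).1, id2 _ ((hA p.1 p.2).mp hp).2.1⟩]
    exact hS.isTreeEncoding hC hnd hA
  · rw [setup_cost] at t1
    rw [prepare_cost] at t2
    -- There are at most `3 * k * (3 * n)` arcs, each charged with an amount linear in the number `3
    -- * n` of rows.
    have h4 : (20 + 20 * (3 * n)) * L.length ≤ (20 + 20 * (3 * n)) * (3 * k * (3 * n)) :=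
      Nat.mul_le_mul_left _ hlen
    have e4 : (20 + 20 * (3 * n)) * (3 * k * (3 * n)) = 180 * (n * k) + 540 * (n ^ 2 * k) := by ring
    have e5 : 3 * n * (3 + 6 * (3 * n)) = 9 * n + 54 * n ^ 2 := by ring
    have h0t : s0.t = 0 := rfl
    have hn : 1 ≤ n := Z.start.pos
    have hnn : n ≤ n ^ 2 := Nat.le_self_pow two_ne_zero n
    have hnk : n * k ≤ n ^ 2 * k := Nat.mul_le_mul_right _ hnn
    have hn2 : n ^ 2 ≤ n ^ 2 * k + 1 := by
      rcases Nat.eq_zero_or_pos k with rfl | hk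
      · simp [eq_one_of_accessible hZ]
      · exact (Nat.le_mul_of_pos_right _ hk).trans (Nat.le_succ _)
    omega

end Imp

/-! ### Reading the input, and the word size. -/

namespace Imp

open RAM

variable {n k : ℕ} {Z : FSM (Fin n) (Fin k)}

theorem getD_flatMap_map {α : Type*} (l : List α) (f : α → Fin k → ℕ) (i j : ℕ) (hj : j < k) :
    (l.flatMap fun u => (List.finRange k).map (f u)).getD (i * k + j) 0 =
      (l[i]?).elim 0 fun u => f u ⟨j, hj⟩ := by
  induction l generalizing i with
  | nil => simp
  | cons u l ih =>
    rw [List.flatMap_cons]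
    cases i with
    | zero =>
      rw [List.getD_append _ _ _ _ (by simpa using hj)]
      simp [List.getD_eq_getElem?_getD, hj]
    | succ i =>
      rw [List.getD_append_right _ _ _ _ (by simp only [List.length_map, List.length_finRange]; nlinarith)]
      have e : (i + 1) * k + j - ((List.finRange k).map (f u)).length = i * k + j := by
        simp only [List.length_map, List.length_finRange]
        rw [add_mul, one_mul]
        omega
      rw [e, ih, List.getElem?_cons_succ]

theorem encode_getD_table (i j : ℕ) (hi : i < n) (hj : j < k) :
    Z.encode.getD (i * k + j + 3) 0 = table Z i j := by
  have : Z.encode.getD (i * k + j + 3) 0 =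
      ((List.finRange n).flatMap fun u => (List.finRange k).map fun x =>
        (Z.δ u x).elim 0 fun v => v.val + 1).getD (i * k + j) 0 := rfl
  rw [this, getD_flatMap_map _ (fun u x => (Z.δ u x).elim 0 fun v => v.val + 1) _ _ hj]
  have h := table_fin (Z := Z) ⟨i, hi⟩ ⟨j, hj⟩
  simp only at h
  rw [h, List.getElem?_eq_getElem (by simpa using hi)]
  simp only [Option.elim_some, List.getElem_finRange]
  cases h' : Z.δ ⟨i, hi⟩ ⟨j, hj⟩ <;> simp [enc, h']

theorem length_encode : Z.encode.length = 3 + n * k := by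
  simp [FSM.encode, List.length_flatMap]
  omega

/-- Load the header of the input. -/
def header : Prog :=
  .seq (.load 8 5) <| .seq (.const 1 1) <| .seq (.load 9 1) <| .seq (.const 1 2) <|
  .seq (.load 10 1) <| .seq (.add 6 8 5) <| .seq (.add 7 9 5) <| .seq (.mul 0 6 7) <|
  .seq (.const 1 3) (.add 0 0 1)

/-- The variables `n`, `k`, `s` have the codes 0, 1, 2, so their registers are 8, 9, 10 and are
filled directly from the first three cells. Memory behind the input reads as 0, so all arrays are
initially zero. -/
theorem exec_header {W : ℕ} (hW : n * k + n + k + 4 ≤ W) :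
    ∃ σ, Exec W header (init Z.encode) σ 10 ∧ Rep n k (table Z) (.initial Z) σ := by
  have hs := Z.start.isLt
  refine ⟨_, .seq (.load _ _ _ (show n < W by omega)) <| .seq (.const _ _ _ (by omega)) <|
    .seq (.load _ _ _ (show k < W by omega)) <| .seq (.const _ _ _ (by omega)) <|
    .seq (.load _ _ _ (show Z.start.val < W by omega)) <|
    .seq (.add _ _ _ _ (show n + 0 < W by omega)) <| .seq (.add _ _ _ _ (show k + 0 < W by omega)) <|
    .seq (.mul _ _ _ _ (show n * k < W by omega)) <| .seq (.const _ _ _ (by omega))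
    (.add _ _ _ _ (show n * k + 3 < W by omega)), ?_⟩
  refine ⟨add_comm (n * k) 3, rfl, rfl, rfl, fun x => by cases x <;> rfl, fun r i j => ?_,
    encode_getD_table, rfl⟩
  refine List.getD_eq_default _ _ ?_
  rw [length_encode]
  unfold pos
  omega

theorem Opd.litLe_mono {B B' : ℕ} (hB : B ≤ B') {o : Opd} (h : o.litLe B = true) :
    o.litLe B' = true := by
  cases o with
  | var => rfl
  | lit c =>
    simp only [Opd.litLe, decide_eq_true_eq] at *
    omega

theorem Cmd.litLe_mono {B B' : ℕ} (hB : B ≤ B') {c : Cmd} (h : c.litLe B = true) :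
    c.litLe B' = true := by
  induction c with
  | skip | inc | dec => rfl
  | set | emit => exact Opd.litLe_mono hB h
  | get | tab =>
    simp only [Cmd.litLe, Bool.and_eq_true] at *
    exact ⟨Opd.litLe_mono hB h.1, Opd.litLe_mono hB h.2⟩
  | put =>
    simp only [Cmd.litLe, Bool.and_eq_true] at *
    exact ⟨⟨Opd.litLe_mono hB h.1.1, Opd.litLe_mono hB h.1.2⟩, Opd.litLe_mono hB h.2⟩
  | seq c d ihc ihd | ifnz x c d ihc ihd =>
    simp only [Cmd.litLe, Bool.and_eq_true] at *
    exact ⟨ihc h.1, ihd h.2⟩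
  | ifeq o p c d ihc ihd =>
    simp only [Cmd.litLe, Bool.and_eq_true] at *
    exact ⟨⟨⟨Opd.litLe_mono hB h.1.1.1, Opd.litLe_mono hB h.1.1.2⟩, ihc h.1.2⟩, ihd h.2⟩
  | loop x o c ih =>
    simp only [Cmd.litLe, Bool.and_eq_true] at *
    exact ⟨Opd.litLe_mono hB h.1, ih h.2⟩

theorem table_le (i j : ℕ) : table Z i j ≤ n := by
  unfold table
  split
  · rename_i h
    cases h' : Z.δ ⟨i, h.1⟩ ⟨j, h.2⟩ with
    | none => simp
    | some v => simp only [enc_some]; omega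
  · exact Nat.zero_le _

/-- The word size suffices. -/
theorem word_bound {n k B E N : ℕ} (hB : B = n + k + 1) (hE : E = 2200 * (n ^ 2 * k + 1))
    (hN : N = n + k + 2) :
    (4 * (B + E) * (B + E) + (B + E)) * 20 + 20 + (3 + n * k) + 2 * (B + E) < N ^ 40 := by
  have hn : n ≤ N := by omega
  have hk : k ≤ N := by omega
  have h2 : 2 ≤ N := by omega
  have h1 : n ^ 2 * k ≤ N ^ 3 := by
    calc n ^ 2 * k ≤ N ^ 2 * N := by gcongr
      _ = N ^ 3 := by ring
  have hp : ∀ d, 2 ^ d ≤ N ^ d := fun d => Nat.pow_le_pow_left h2 d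
  have hN3 : 1 ≤ N ^ 3 := Nat.one_le_pow _ _ (by omega)
  have hNN : N ≤ N ^ 3 := Nat.le_self_pow (by omega) N
  -- Constants are absorbed into powers of `N`, which is at least 2: here `B + E` is at most 4401
  -- times `N ^ 3`, and 4401 is below `2 ^ 13`.
  have hBE : B + E ≤ N ^ 16 := by
    calc B + E ≤ 2 ^ 13 * N ^ 3 := by
          generalize N ^ 3 = N3 at *
          omega
      _ ≤ N ^ 13 * N ^ 3 := Nat.mul_le_mul_right _ (hp 13)
      _ = N ^ 16 := by ring
  have hnk : n * k ≤ N ^ 32 := by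
    calc n * k ≤ N * N := Nat.mul_le_mul hn hk
      _ = N ^ 2 := by ring
      _ ≤ N ^ 32 := Nat.pow_le_pow_right (by omega) (by omega)
  have hsq : (B + E) * (B + E) ≤ N ^ 32 := by
    calc (B + E) * (B + E) ≤ N ^ 16 * N ^ 16 := Nat.mul_le_mul hBE hBE
      _ = N ^ 32 := by ring
  have h32 : N ^ 16 ≤ N ^ 32 := Nat.pow_le_pow_right (by omega) (by omega)
  have h33 : 1 ≤ N ^ 32 := Nat.one_le_pow _ _ (by omega)
  -- The quantity to be bounded is at most 126 times `N ^ 32`, which is below `2 ^ 8 * N ^ 32`.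
  have h40 : 2 ^ 8 * N ^ 32 ≤ N ^ 40 := by
    calc 2 ^ 8 * N ^ 32 ≤ N ^ 8 * N ^ 32 := Nat.mul_le_mul_right _ (hp 8)
      _ = N ^ 40 := by ring
  rw [mul_assoc 4]
  generalize N ^ 40 = N40 at *
  generalize N ^ 32 = N32 at *
  generalize N ^ 16 = N16 at *
  generalize (B + E) * (B + E) = D at *
  omega

end Imp

/-- There is one RAM program that, on every accessible FSM with `n` states and `k` symbols, outputs
its decomposition tree within `C * (n ^ 2 * k + 1)` steps, using words of `O(log (n + k))` bits.
(The `+ 1` matters only for `k = 0`, where `n = 1`.) -/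
theorem mainTheorem8 :
    ∃ (P : RAM.Prog) (C d : ℕ), ∀ (n k : ℕ) (Z : FSM (Fin n) (Fin k)), Z.Accessible →
      ∃ (s : RAM.Store) (t : ℕ),
        RAM.Exec ((n + k + 2) ^ d) P (RAM.init Z.encode) s t ∧
        t ≤ C * (n ^ 2 * k + 1) ∧
        Z.IsTreeEncoding s.out := by
  -- Each unit of the clock costs at most 12 machine steps, and the header takes 10; the exponent 40
  -- is that of `Imp.word_bound`.
  refine ⟨.seq Imp.header (Imp.comp Imp.main), 12 * 2200 + 10, 40, fun n k Z hZ => ?_⟩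
  obtain ⟨htree, htime⟩ := Imp.main_spec hZ
  have hW := Imp.word_bound (n := n) (k := k) rfl rfl rfl
  obtain ⟨σ, hσ, hR⟩ := Imp.exec_header (Z := Z) (W := (n + k + 2) ^ 40) (by omega)
  obtain ⟨σ', τ, hexec, hR', hτ, -⟩ := Imp.exec_comp (T := Imp.table Z) (B := n + k + 1)
    (fun i j h => dif_neg h) (fun i j => (Imp.table_le i j).trans (by omega)) (by omega) hW
    -- All literals of the program are 0 or 1. This is decided with the concrete bound 1 and then
    -- weakened to `n + k + 1`.
    Imp.main (by decide) (Imp.Cmd.litLe_mono (B := 1) (by omega) (by decide))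
    (.initial Z) σ hR
    ⟨fun x => by cases x <;> simp only [Imp.St.initial] <;> omega, fun _ _ _ => Nat.zero_le _⟩ htime
  refine ⟨σ', _, .seq hσ hexec, ?_, by rw [hR'.out]; exact htree⟩
  have : (Imp.St.initial Z).t = 0 := rfl
  omega
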